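/- **Setting.** Let $M$ be a smooth manifold and $(G,H,t,m)$ a Lie crossed module: $G,H$ are Lie groups with Lie algebras $\mathfrak g,\mathfrak h$, and $t:H\to G$, $m:G\to\mathrm{Aut}(H)$ are smooth homomorphisms with $t(m(a)(A))=a\,t(A)\,a^{-1}$ and $m(t(A))(B)=ABA^{-1}$. Let $\dot t$ be the differential of $t$ at $1_H$, $\dot m(a)$ the differential of $m(a)$ at $1_H$, and $\widehat m(x)(X)$ the derivative at $a=1_G$ of $a\mapsto\dot m(a)(X)$ in the direction $x\in\mathfrak g$. A *connection doublet* is a pair $(\theta,\Upsilon)\in\Omega^1(M,\mathfrak g)\times\Omega^2(M,\mathfrak h)$ with $d\theta+\tfrac12[\theta,\theta]-\dot t(\Upsilon)=0$; it is *flat* if $d\Upsilon+[\theta,\Upsilon]=0$, where $\mathfrak g$ acts on $\mathfrak h$ by $\widehat m$. A *$1$-gauge transformation* is a pair $(g,J)$ of a smooth map $g:M\to G$ and a form $J\in\Omega^1(M,\mathfrak h)$. **Curves and surfaces.** A curve $\gamma:p_0\to p_1$ is a smooth map $\gamma:\mathbb R\to M$ such that, for some $0<\epsilon<\frac12$, $\gamma(x)=p_0$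 for $x<\epsilon$ and $\gamma(x)=p_1$ for $x>1-\epsilon$. A surface $\Sigma:\gamma_0\Rightarrow\gamma_1$ between curves $\gamma_0,\gamma_1:p_0\to p_1$ is a smooth map $\Sigma:\mathbb R^2\to M$ such that, for some $0<\epsilon<\frac12$, $\Sigma(x,y)$ equals $p_0$ for $x<\epsilon$, $p_1$ for $x>1-\epsilon$, $\gamma_0(x)$ for $y<\epsilon$ and $\gamma_1(x)$ for $y>1-\epsilon$. A thin homotopy of curves $\gamma_0,\gamma_1:p_0\to p_1$ is a surface $h:\gamma_0\Rightarrow\gamma_1$ with $\mathrm{rank}\,dh\le1$. A homotopy of two surfaces $\Sigma_0,\Sigma_1$ (each between some curves $p_0\to p_1$) is a smooth map $K:\mathbb R^3\to M$ such that, for some $\epsilon>0$, $K(x,y,z)$ equals $p_0$ for $x<\epsilon$, $p_1$ for $x>1-\epsilon$, $K(x,0,z)$ for $y<\epsilon$, $K(x,1,z)$ for $y>1-\epsilon$, $\Sigma_0(x,y)$ for $z<\epsilon$, $\Sigma_1(x,y)$ for $z>1-\epsilon$, and $\mathrm{rank}\,dK(x,0,z)\le 1$, $\mathrm{rank}\,dK(x,1,z)\le1$;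 it is thin if moreover $\mathrm{rank}\,dK\le2$ everywhere. **Parallel transport.** For a smooth map $S:\mathbb R^2\to M$ put $a=S^*\theta=a_x\,dx+a_y\,dy$ and $B=S^*\Upsilon=B_{xy}\,dx\wedge dy$. For $x_0,y_0\in\mathbb R$ let $f(\cdot,x_0;\cdot),\,g(\cdot;\cdot,y_0):\mathbb R^2\to G$ and $W(\cdot,x_0;\cdot,y_0):\mathbb R^2\to H$ be the unique smooth solutions of $$\partial_xf(x,x_0;y)\,f(x,x_0;y)^{-1}=-a_x(x,y),\qquad f(x_0,x_0;y)=1_G,$$ $$\partial_yg(x;y,y_0)\,g(x;y,y_0)^{-1}=-a_y(x,y),\qquad g(x;y_0,y_0)=1_G,$$ $$\partial_x\bigl(\partial_yW(x,x_0;y,y_0)\,W(x,x_0;y,y_0)^{-1}\bigr)=-\dot m\bigl(g(x_0;y,y_0)^{-1}f(x,x_0;y)^{-1}\bigr)(B_{xy}(x,y)),$$ $$W(x_0,x_0;y,y_0)=W(x,x_0;y_0,y_0)=1_H .$$ The $2$-parallel transport along a surface $\Sigma$ is $F(\Sigma)=W(0,1;1,0)\in H$ for $S=\Sigma$. The $1$-parallel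 transport along a curve $\gamma$ is $F(\gamma)=f(1,0;y)\in G$ for $S=I_\gamma$, $I_\gamma(x,y)=\gamma(x)$ (it does not depend on $y$). For a $1$-gauge transformation $(g,J)$ and a curve $\gamma$ let $\Psi(\cdot,x_0;\cdot):\mathbb R^2\to H$ be the unique smooth solution, for $S=I_\gamma$, of $$\Psi(x,x_0;y)^{-1}\partial_x\Psi(x,x_0;y)=-\dot m\bigl(f(x,x_0;y)^{-1}g(\gamma(x))^{-1}\bigr)\bigl((I_\gamma^*J)_x(x,y)\bigr),\qquad \Psi(x_0,x_0;y)=1_H,$$ and put $G_{g,J}(\gamma)=\Psi(0,1;y)\in H$ (it does not depend on $y$). By thin homotopy invariance $F$ and $G_{g,J}$ induce maps $\bar F$ (the parallel transport $2$-functor of the path $2$-groupoid) and $\bar G_{g,J}$ (the gauge pseudonatural transformation) on thin homotopy classes of curves and, for $\bar F$, of surfaces; when the doublet is flat, $F$ also induces a map $\bar F^0$ on homotopy classes of surfaces (the $2$-cells of the fundamental $2$-groupoid, which has the same $1$-cells as the path $2$-groupoid). **Smoothness.** A map on a subset of $\mathbb R^n$ is smooth if near each point of the subset it is the restriction of a smooth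 map defined on an open subset of $\mathbb R^n$. For $A\subset\mathbb R^d$, a family of maps $\Sigma_\alpha:\mathbb R^2\to M$ (resp. $\gamma_\alpha:\mathbb R\to M$), $\alpha\in A$, depends smoothly on $\alpha$ if $(\alpha,x,y)\mapsto\Sigma_\alpha(x,y)$ is smooth on $A\times\mathbb R^2$ (resp. $(\alpha,x)\mapsto\gamma_\alpha(x)$ on $A\times\mathbb R$). **Proposition.** Let $(\theta,\Upsilon)$ be a connection doublet and let $A\subset\mathbb R^d$ be closed and bounded. 1. Let $\Sigma_\alpha:\gamma_{0\alpha}\Rightarrow\gamma_{1\alpha}$, $\alpha\in A$, be a family of surfaces depending smoothly on $\alpha$, where $\gamma_{0\alpha},\gamma_{1\alpha}:p_{0\alpha}\to p_{1\alpha}$. Then the maps $\alpha\mapsto F(\gamma_{0\alpha})\in G$, $\alpha\mapsto F(\gamma_{1\alpha})\in G$ and $\alpha\mapsto F(\Sigma_\alpha)\in H$ are smooth on $A$, and so are $\alpha\mapsto\bar F([\gamma_{0\alpha}])$, $\alpha\mapsto\bar F([\gamma_{1\alpha}])$ and $\alpha\mapsto\bar F([\Sigma_\alpha])$. If $(\theta,\Upsilon)$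 is flat, then $\alpha\mapsto\bar F^0([\Sigma_\alpha])\in H$ is also smooth on $A$. 2. Let $(g,J)$ be a $1$-gauge transformation and let $\gamma_\alpha:p_{0\alpha}\to p_{1\alpha}$, $\alpha\in A$, be a family of curves depending smoothly on $\alpha$. Then $\alpha\mapsto G_{g,J}(\gamma_\alpha)\in H$ and $\alpha\mapsto\bar G_{g,J}([\gamma_\alpha])\in H$ are smooth on $A$ (in particular when the doublet is flat, where $\bar G_{g,J}$ is regarded as a transformation of functors on the fundamental $2$-groupoid). -/

import Mathlib

open scoped Manifold ContDiff

namespace HigherTransport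

noncomputable section

/-! All manifolds are real, finite-dimensional and without boundary: a manifold `M` is modelled on
the normed space `E` through `𝓘(ℝ, E)`.  For a Lie group `G` modelled on `EG`, the Lie algebra
`𝔤 = T₁G` is Mathlib's `GroupLieAlgebra 𝓘(ℝ, EG) G`, which is by definition a copy of the model
space `EG`; since forms need a normed space of values, the values are written as elements
of `EG`. -/

section Smoothness

/-- A map defined on an arbitrary subset `S` of a normed space is smooth if near every point of `S`
it is the restriction of a smooth map defined on an open subset of the ambient space. -/
def SmoothOnSubset {V : Type*} [NormedAddCommGroup V] [NormedSpace ℝ V]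
    (EN : Type*) [NormedAddCommGroup EN] [NormedSpace ℝ EN]
    {N : Type*} [TopologicalSpace N] [ChartedSpace EN N]
    (S : Set V) (f : S → N) : Prop :=
  ∀ a : S, ∃ U : Set V, IsOpen U ∧ (a : V) ∈ U ∧
    ∃ F : V → N, ContMDiffOn 𝓘(ℝ, V) 𝓘(ℝ, EN) ∞ F U ∧ ∀ b : S, (b : V) ∈ U → F b = f b

/-- A family `f a : X → N`, `a ∈ A`, of maps depends smoothly on the parameter `a` if `(a, x) ↦ f a x`
is smooth on `A × X`. -/
def SmoothFamily {V : Type*} [NormedAddCommGroup V] [NormedSpace ℝ V]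
    {X : Type*} [NormedAddCommGroup X] [NormedSpace ℝ X]
    (EN : Type*) [NormedAddCommGroup EN] [NormedSpace ℝ EN]
    {N : Type*} [TopologicalSpace N] [ChartedSpace EN N]
    (A : Set V) (f : A → X → N) : Prop :=
  SmoothOnSubset EN (A ×ˢ (Set.univ : Set X)) (fun q => f ⟨q.1.1, q.2.1⟩ q.1.2)

end Smoothness

section Forms

/-- The local expression, in the preferred chart at `p`, of a field of alternating `k`-linear maps
on the tangent spaces of `M`: its pull-back under the inverse of the chart. -/
def localRep {E : Type*} [NormedAddCommGroup E] [NormedSpace ℝ E]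
    {M : Type*} [TopologicalSpace M] [ChartedSpace E M]
    {V : Type*} [NormedAddCommGroup V] [NormedSpace ℝ V] {k : ℕ}
    (η : ∀ p : M, TangentSpace 𝓘(ℝ, E) p [⋀^Fin k]→L[ℝ] V) (p : M) (e : E) :
    E [⋀^Fin k]→L[ℝ] V :=
  (η ((extChartAt 𝓘(ℝ, E) p).symm e)).compContinuousLinearMap
    (mfderiv 𝓘(ℝ, E) 𝓘(ℝ, E) (extChartAt 𝓘(ℝ, E) p).symm e)

/-- Smooth differential `k`-forms on `M` with values in the normed space `V`. -/
structure DiffForm (E : Type*) [NormedAddCommGroup E] [NormedSpace ℝ E]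
    (M : Type*) [TopologicalSpace M] [ChartedSpace E M]
    (V : Type*) [NormedAddCommGroup V] [NormedSpace ℝ V] (k : ℕ) where
  toFun : ∀ p : M, TangentSpace 𝓘(ℝ, E) p [⋀^Fin k]→L[ℝ] V
  smooth : ∀ p : M, ContDiffOn ℝ ∞ (localRep toFun p) (extChartAt 𝓘(ℝ, E) p).target

/-- The exterior derivative at `p`: the exterior derivative of the local expression in the
preferred chart at `p`, pulled back to `T_p M` under the chart. -/
def DiffForm.extD {E : Type*} [NormedAddCommGroup E] [NormedSpace ℝ E]
    {M : Type*} [TopologicalSpace M] [ChartedSpace E M]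
    {V : Type*} [NormedAddCommGroup V] [NormedSpace ℝ V] {k : ℕ}
    (η : DiffForm E M V k) (p : M) : TangentSpace 𝓘(ℝ, E) p [⋀^Fin (k + 1)]→L[ℝ] V :=
  (extDeriv (localRep η.toFun p) (extChartAt 𝓘(ℝ, E) p p)).compContinuousLinearMap
    (mfderiv 𝓘(ℝ, E) 𝓘(ℝ, E) (extChartAt 𝓘(ℝ, E) p) p)

variable {E : Type*} [NormedAddCommGroup E] [NormedSpace ℝ E]
  {M : Type*} [TopologicalSpace M] [ChartedSpace E M]
  {V : Type*} [NormedAddCommGroup V] [NormedSpace ℝ V]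

/-- The coefficient of `dx` in the pull-back of a `1`-form under a map `ℝ² → M`. -/
def pullX (η : DiffForm E M V 1) (S : ℝ × ℝ → M) (q : ℝ × ℝ) : V :=
  η.toFun (S q) ![mfderiv 𝓘(ℝ, ℝ × ℝ) 𝓘(ℝ, E) S q ((1, 0) : ℝ × ℝ)]

/-- The coefficient of `dy` in the pull-back of a `1`-form under a map `ℝ² → M`. -/
def pullY (η : DiffForm E M V 1) (S : ℝ × ℝ → M) (q : ℝ × ℝ) : V :=
  η.toFun (S q) ![mfderiv 𝓘(ℝ, ℝ × ℝ) 𝓘(ℝ, E) S q ((0, 1) : ℝ × ℝ)]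

/-- The coefficient of `dx ∧ dy` in the pull-back of a `2`-form under a map `ℝ² → M`. -/
def pullXY (η : DiffForm E M V 2) (S : ℝ × ℝ → M) (q : ℝ × ℝ) : V :=
  η.toFun (S q) ![mfderiv 𝓘(ℝ, ℝ × ℝ) 𝓘(ℝ, E) S q ((1, 0) : ℝ × ℝ),
    mfderiv 𝓘(ℝ, ℝ × ℝ) 𝓘(ℝ, E) S q ((0, 1) : ℝ × ℝ)]

end Forms

section Groups

/-- `u'(x) u(x)⁻¹ ∈ 𝔤`, for a curve `u` in a Lie group. -/
def rightLogDeriv {EG : Type*} [NormedAddCommGroup EG] [NormedSpace ℝ EG]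
    {G : Type*} [TopologicalSpace G] [ChartedSpace EG G] [Group G] (u : ℝ → G) (x : ℝ) : EG :=
  mfderiv 𝓘(ℝ, ℝ) 𝓘(ℝ, EG) (fun s => u s * (u x)⁻¹) x (1 : ℝ)

/-- `u(x)⁻¹ u'(x) ∈ 𝔤`, for a curve `u` in a Lie group. -/
def leftLogDeriv {EG : Type*} [NormedAddCommGroup EG] [NormedSpace ℝ EG]
    {G : Type*} [TopologicalSpace G] [ChartedSpace EG G] [Group G] (u : ℝ → G) (x : ℝ) : EG :=
  mfderiv 𝓘(ℝ, ℝ) 𝓘(ℝ, EG) (fun s => (u x)⁻¹ * u s) x (1 : ℝ)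

/-- The bracket of the Lie algebra of `G`. -/
def lieBr {EG : Type*} [NormedAddCommGroup EG] [NormedSpace ℝ EG]
    (G : Type*) [TopologicalSpace G] [ChartedSpace EG G] [Group G] (v w : EG) : EG :=
  let v' : GroupLieAlgebra 𝓘(ℝ, EG) G := v
  let w' : GroupLieAlgebra 𝓘(ℝ, EG) G := w
  let z : GroupLieAlgebra 𝓘(ℝ, EG) G := ⁅v', w'⁆
  z

/-- A Lie crossed module `(G, H, t, m)`: Lie groups with smooth homomorphisms `t : H → G` and
`m : G → Aut H` satisfying equivariance and the Peiffer identity. -/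
structure LieCrossedModule (EG : Type*) [NormedAddCommGroup EG] [NormedSpace ℝ EG]
    (G : Type*) [TopologicalSpace G] [ChartedSpace EG G] [Group G]
    (EH : Type*) [NormedAddCommGroup EH] [NormedSpace ℝ EH]
    (H : Type*) [TopologicalSpace H] [ChartedSpace EH H] [Group H] where
  t : H →* G
  m : G →* MulAut H
  smooth_t : ContMDiff 𝓘(ℝ, EH) 𝓘(ℝ, EG) ∞ t
  smooth_m : ContMDiff (𝓘(ℝ, EG).prod 𝓘(ℝ, EH)) 𝓘(ℝ, EH) ∞ (fun q : G × H => m q.1 q.2)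
  t_m : ∀ (a : G) (A : H), t (m a A) = a * t A * a⁻¹
  m_t : ∀ A B : H, m (t A) B = A * B * A⁻¹

variable {EG : Type*} [NormedAddCommGroup EG] [NormedSpace ℝ EG]
  {G : Type*} [TopologicalSpace G] [ChartedSpace EG G] [Group G]
  {EH : Type*} [NormedAddCommGroup EH] [NormedSpace ℝ EH]
  {H : Type*} [TopologicalSpace H] [ChartedSpace EH H] [Group H]

/-- `ṫ : 𝔥 → 𝔤`, the differential of `t` at `1`. -/
def LieCrossedModule.tDot (C : LieCrossedModule EG G EH H) (v : EH) : EG :=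
  mfderiv 𝓘(ℝ, EH) 𝓘(ℝ, EG) C.t (1 : H) v

/-- `ṁ(a) : 𝔥 → 𝔥`, the differential of `m(a)` at `1`. -/
def LieCrossedModule.mDot (C : LieCrossedModule EG G EH H) (a : G) (v : EH) : EH :=
  mfderiv 𝓘(ℝ, EH) 𝓘(ℝ, EH) (fun B : H => C.m a B) (1 : H) v

/-- `m̂ : 𝔤 × 𝔥 → 𝔥`, the differential of `ṁ` at `1`. -/
def LieCrossedModule.mHat (C : LieCrossedModule EG G EH H) (x : EG) (v : EH) : EH :=
  mfderiv 𝓘(ℝ, EG) 𝓘(ℝ, EH) (fun a : G => C.mDot a v) (1 : G) x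

end Groups

section Cocycles

variable {EG : Type*} [NormedAddCommGroup EG] [NormedSpace ℝ EG]
  {G : Type*} [TopologicalSpace G] [ChartedSpace EG G] [Group G]
  {EH : Type*} [NormedAddCommGroup EH] [NormedSpace ℝ EH]
  {H : Type*} [TopologicalSpace H] [ChartedSpace EH H] [Group H]

/-- `u : ℝ² → G` is smooth with `∂ₓu u⁻¹ = -aₓ` and `u(x₀, y) = 1`. -/
def IsSolF (ax : ℝ × ℝ → EG) (x₀ : ℝ) (u : ℝ × ℝ → G) : Prop :=
  ContMDiff 𝓘(ℝ, ℝ × ℝ) 𝓘(ℝ, EG) ∞ u ∧ (∀ y, u (x₀, y) = 1) ∧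
    ∀ x y, rightLogDeriv (fun s => u (s, y)) x = -ax (x, y)

/-- `v : ℝ² → G` is smooth with `∂ᵧv v⁻¹ = -aᵧ` and `v(x, y₀) = 1`. -/
def IsSolG (ay : ℝ × ℝ → EG) (y₀ : ℝ) (v : ℝ × ℝ → G) : Prop :=
  ContMDiff 𝓘(ℝ, ℝ × ℝ) 𝓘(ℝ, EG) ∞ v ∧ (∀ x, v (x, y₀) = 1) ∧
    ∀ x y, rightLogDeriv (fun s => v (x, s)) y = -ay (x, y)

/-- The component `f(x, x₀; y)` of the cocycle of a connection doublet on `ℝ²`: the value at `(x, y)`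
of the unique solution `u` of `IsSolF`. -/
def cocycleF (G : Type*) [TopologicalSpace G] [ChartedSpace EG G] [Group G]
    (ax : ℝ × ℝ → EG) (x x₀ y : ℝ) : G :=
  Classical.epsilon (fun u : ℝ × ℝ → G => IsSolF ax x₀ u) (x, y)

/-- The component `g(x; y, y₀)` of the cocycle of a connection doublet on `ℝ²`: the value at `(x, y)`
of the unique solution `v` of `IsSolG`. -/
def cocycleG (G : Type*) [TopologicalSpace G] [ChartedSpace EG G] [Group G]
    (ay : ℝ × ℝ → EG) (x y y₀ : ℝ) : G :=
  Classical.epsilon (fun v : ℝ × ℝ → G => IsSolG ay y₀ v) (x, y)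

/-- `W : ℝ² → H` is smooth with `∂ₓ(∂ᵧW W⁻¹) = -ṁ(g(x₀; y, y₀)⁻¹ f(x, x₀; y)⁻¹)(B_xy)` and
`W(x₀, y) = W(x, y₀) = 1`. -/
def IsSolW (C : LieCrossedModule EG G EH H) (ax ay : ℝ × ℝ → EG) (B : ℝ × ℝ → EH) (x₀ y₀ : ℝ)
    (W : ℝ × ℝ → H) : Prop :=
  ContMDiff 𝓘(ℝ, ℝ × ℝ) 𝓘(ℝ, EH) ∞ W ∧ (∀ y, W (x₀, y) = 1) ∧ (∀ x, W (x, y₀) = 1) ∧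
    ∀ x y, deriv (fun s => (rightLogDeriv (fun r => W (s, r)) y : EH)) x =
      -C.mDot ((cocycleG G ay x₀ y y₀)⁻¹ * (cocycleF G ax x x₀ y)⁻¹) (B (x, y))

/-- The component `W(x, x₀; y, y₀)` of the cocycle of a connection doublet on `ℝ²`: the value
at `(x, y)` of the unique solution of `IsSolW`. -/
def cocycleW (C : LieCrossedModule EG G EH H) (ax ay : ℝ × ℝ → EG) (B : ℝ × ℝ → EH)
    (x x₀ y y₀ : ℝ) : H :=
  Classical.epsilon (fun W : ℝ × ℝ → H => IsSolW C ax ay B x₀ y₀ W) (x, y)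

/-- `Λ : ℝ² → H` is smooth with `Λ⁻¹ ∂ₓΛ = -ṁ(f(x, x₀; y)⁻¹ ϰ(x, y)⁻¹)(Γₓ)` and `Λ(x₀, y) = 1`. -/
def IsSolPsi (C : LieCrossedModule EG G EH H) (ax : ℝ × ℝ → EG) (ϰ : ℝ × ℝ → G)
    (Γx : ℝ × ℝ → EH) (x₀ : ℝ) (Λ : ℝ × ℝ → H) : Prop :=
  ContMDiff 𝓘(ℝ, ℝ × ℝ) 𝓘(ℝ, EH) ∞ Λ ∧ (∀ y, Λ (x₀, y) = 1) ∧
    ∀ x y, leftLogDeriv (fun s => Λ (s, y)) x =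
      -C.mDot ((cocycleF G ax x x₀ y)⁻¹ * (ϰ (x, y))⁻¹) (Γx (x, y))

/-- The component `Ψ(x, x₀; y)` of the integral `1`-gauge transformation of a differential one
`(ϰ, Γ)` on `ℝ²`: the value at `(x, y)` of the unique solution of `IsSolPsi`. -/
def gaugePsi (C : LieCrossedModule EG G EH H) (ax : ℝ × ℝ → EG) (ϰ : ℝ × ℝ → G)
    (Γx : ℝ × ℝ → EH) (x x₀ y : ℝ) : H :=
  Classical.epsilon (fun Λ : ℝ × ℝ → H => IsSolPsi C ax ϰ Γx x₀ Λ) (x, y)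

end Cocycles

section Paths

/-- Curves `p₀ → p₁` with sitting instants. -/
structure Curve (E : Type*) [NormedAddCommGroup E] [NormedSpace ℝ E]
    {M : Type*} [TopologicalSpace M] [ChartedSpace E M] (p₀ p₁ : M) where
  toFun : ℝ → M
  smooth : ContMDiff 𝓘(ℝ, ℝ) 𝓘(ℝ, E) ∞ toFun
  sitting : ∃ ε : ℝ, 0 < ε ∧ ε < 1 / 2 ∧
    (∀ x, x < ε → toFun x = p₀) ∧ (∀ x, 1 - ε < x → toFun x = p₁)

variable {E : Type*} [NormedAddCommGroup E] [NormedSpace ℝ E]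
  {M : Type*} [TopologicalSpace M] [ChartedSpace E M] {p₀ p₁ : M}

/-- Surfaces `γ₀ ⇒ γ₁` with sitting instants. -/
structure Surface (γ₀ γ₁ : Curve E p₀ p₁) where
  toFun : ℝ × ℝ → M
  smooth : ContMDiff 𝓘(ℝ, ℝ × ℝ) 𝓘(ℝ, E) ∞ toFun
  sitting : ∃ ε : ℝ, 0 < ε ∧ ε < 1 / 2 ∧
    (∀ x y, x < ε → toFun (x, y) = p₀) ∧ (∀ x y, 1 - ε < x → toFun (x, y) = p₁) ∧
    (∀ x y, y < ε → toFun (x, y) = γ₀.toFun x) ∧ (∀ x y, 1 - ε < y → toFun (x, y) = γ₁.toFun x)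

/-- The unit surface `I_γ(x, y) = γ(x)`, as a map. -/
def Curve.unit (γ : Curve E p₀ p₁) : ℝ × ℝ → M := fun q => γ.toFun q.1

/-- Thin homotopy of curves. -/
def Curve.ThinHomotopic (γ₀ γ₁ : Curve E p₀ p₁) : Prop :=
  ∃ h : Surface γ₀ γ₁, ∀ q : ℝ × ℝ,
    (mfderiv 𝓘(ℝ, ℝ × ℝ) 𝓘(ℝ, E) h.toFun q).toLinearMap.rank ≤ 1

/-- The `1`-cells `p₀ → p₁` of the path `2`-groupoid: thin homotopy classes of curves. -/
def PathClass (E : Type*) [NormedAddCommGroup E] [NormedSpace ℝ E]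
    {M : Type*} [TopologicalSpace M] [ChartedSpace E M] (p₀ p₁ : M) : Type _ :=
  Quot (Curve.ThinHomotopic (E := E) (p₀ := p₀) (p₁ := p₁))

/-- Surfaces between arbitrary curves `p₀ → p₁`. -/
structure AnySurface (E : Type*) [NormedAddCommGroup E] [NormedSpace ℝ E]
    {M : Type*} [TopologicalSpace M] [ChartedSpace E M] (p₀ p₁ : M) where
  source : Curve E p₀ p₁
  target : Curve E p₀ p₁
  surface : Surface source target

/-- Homotopies of surfaces, that is, maps `K : ℝ³ → M` with sitting instants that restrict
to the given surfaces at the two ends and are thin on the faces `y = 0` and `y = 1`. -/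
def IsSurfaceHomotopy (S₀ S₁ : AnySurface E p₀ p₁) (K : ℝ × ℝ × ℝ → M) : Prop :=
  ContMDiff 𝓘(ℝ, ℝ × ℝ × ℝ) 𝓘(ℝ, E) ∞ K ∧
  (∃ ε : ℝ, 0 < ε ∧ ε < 1 / 2 ∧
    (∀ x y z, x < ε → K (x, y, z) = p₀) ∧ (∀ x y z, 1 - ε < x → K (x, y, z) = p₁) ∧
    (∀ x y z, y < ε → K (x, y, z) = K (x, 0, z)) ∧
    (∀ x y z, 1 - ε < y → K (x, y, z) = K (x, 1, z)) ∧
    (∀ x y z, z < ε → K (x, y, z) = S₀.surface.toFun (x, y)) ∧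
    (∀ x y z, 1 - ε < z → K (x, y, z) = S₁.surface.toFun (x, y))) ∧
  (∀ x z, (mfderiv 𝓘(ℝ, ℝ × ℝ × ℝ) 𝓘(ℝ, E) K (x, 0, z)).toLinearMap.rank ≤ 1) ∧
  (∀ x z, (mfderiv 𝓘(ℝ, ℝ × ℝ × ℝ) 𝓘(ℝ, E) K (x, 1, z)).toLinearMap.rank ≤ 1)

/-- Homotopy of surfaces. -/
def AnySurface.Homotopic (S₀ S₁ : AnySurface E p₀ p₁) : Prop :=
  ∃ K : ℝ × ℝ × ℝ → M, IsSurfaceHomotopy S₀ S₁ K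

/-- Thin homotopy of surfaces. -/
def AnySurface.ThinHomotopic (S₀ S₁ : AnySurface E p₀ p₁) : Prop :=
  ∃ K : ℝ × ℝ × ℝ → M, IsSurfaceHomotopy S₀ S₁ K ∧
    ∀ q, (mfderiv 𝓘(ℝ, ℝ × ℝ × ℝ) 𝓘(ℝ, E) K q).toLinearMap.rank ≤ 2

/-- The `2`-cells of the path `2`-groupoid over `p₀`, `p₁`: thin homotopy classes of surfaces. -/
def SurfaceClass (E : Type*) [NormedAddCommGroup E] [NormedSpace ℝ E]
    {M : Type*} [TopologicalSpace M] [ChartedSpace E M] (p₀ p₁ : M) : Type _ :=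
  Quot (AnySurface.ThinHomotopic (E := E) (p₀ := p₀) (p₁ := p₁))

/-- The `2`-cells of the fundamental `2`-groupoid over `p₀`, `p₁`: homotopy classes of surfaces. -/
def SurfaceClass₀ (E : Type*) [NormedAddCommGroup E] [NormedSpace ℝ E]
    {M : Type*} [TopologicalSpace M] [ChartedSpace E M] (p₀ p₁ : M) : Type _ :=
  Quot (AnySurface.Homotopic (E := E) (p₀ := p₀) (p₁ := p₁))

open Classical in
/-- The map induced on the quotient by `r` by a group-valued map that is constant on `r`-classes.
It is set to `1` for a map that is not constant on `r`-classes; parallel transport being invariant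
under (thin) homotopy, this convention does not affect the maps `functor₁`, `functor₂`,
`gaugeFunctor` below, nor `flatFunctor₂` for a flat doublet. -/
def inducedMap {α K : Type*} [Group K] (r : α → α → Prop) (F : α → K) : Quot r → K :=
  if h : ∀ a b, r a b → F a = F b then Quot.lift F h else fun _ => 1

end Paths

section Transport

variable {E : Type*} [NormedAddCommGroup E] [NormedSpace ℝ E]
  {M : Type*} [TopologicalSpace M] [ChartedSpace E M]
  {EG : Type*} [NormedAddCommGroup EG] [NormedSpace ℝ EG]
  {G : Type*} [TopologicalSpace G] [ChartedSpace EG G] [Group G]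
  {EH : Type*} [NormedAddCommGroup EH] [NormedSpace ℝ EH]
  {H : Type*} [TopologicalSpace H] [ChartedSpace EH H] [Group H]

/-- A `(G, H)`-connection doublet on `M`: forms `θ ∈ Ω¹(M, 𝔤)`, `Υ ∈ Ω²(M, 𝔥)` with
`dθ + ½[θ, θ] - ṫ(Υ) = 0`.  Here `½[θ, θ](v, w) = [θ(v), θ(w)]`. -/
structure ConnDoublet (E : Type*) [NormedAddCommGroup E] [NormedSpace ℝ E]
    (M : Type*) [TopologicalSpace M] [ChartedSpace E M]
    (C : LieCrossedModule EG G EH H) where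
  θ : DiffForm E M EG 1
  Υ : DiffForm E M EH 2
  fake_flat : ∀ (p : M) (v w : TangentSpace 𝓘(ℝ, E) p),
    θ.extD p ![v, w] + lieBr G (θ.toFun p ![v]) (θ.toFun p ![w])
      - C.tDot (Υ.toFun p ![v, w]) = 0

variable {C : LieCrossedModule EG G EH H} (D : ConnDoublet E M C) {p₀ p₁ : M}

/-- Flatness `dΥ + [θ, Υ] = 0`, where `𝔤` acts on `𝔥` by `m̂`. -/
def ConnDoublet.IsFlat : Prop :=
  ∀ (p : M) (v₁ v₂ v₃ : TangentSpace 𝓘(ℝ, E) p),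
    D.Υ.extD p ![v₁, v₂, v₃]
      + (C.mHat (D.θ.toFun p ![v₁]) (D.Υ.toFun p ![v₂, v₃])
        - C.mHat (D.θ.toFun p ![v₂]) (D.Υ.toFun p ![v₁, v₃])
        + C.mHat (D.θ.toFun p ![v₃]) (D.Υ.toFun p ![v₁, v₂])) = 0

/-- The `1`-parallel transport `F(γ) = f(1, 0; y)`, `f` the cocycle of the pull-back of the doublet
under the unit surface of `γ`, which does not depend on `y`. -/
def ConnDoublet.transport₁ (γ : Curve E p₀ p₁) : G :=
  cocycleF G (pullX D.θ γ.unit) 1 0 0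

/-- The `2`-parallel transport `F(Σ) = W(0, 1; 1, 0)`, `W` the cocycle of the pull-back of the doublet
under `Σ`. -/
def ConnDoublet.transport₂ {γ₀ γ₁ : Curve E p₀ p₁} (S : Surface γ₀ γ₁) : H :=
  cocycleW C (pullX D.θ S.toFun) (pullY D.θ S.toFun) (pullXY D.Υ S.toFun) 0 1 1 0

/-- The parallel transport `2`-functor on `1`-cells. -/
def ConnDoublet.functor₁ : PathClass E p₀ p₁ → G :=
  inducedMap Curve.ThinHomotopic (fun γ => D.transport₁ γ)

/-- The parallel transport `2`-functor on `2`-cells of the path `2`-groupoid. -/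
def ConnDoublet.functor₂ : SurfaceClass E p₀ p₁ → H :=
  inducedMap AnySurface.ThinHomotopic (fun S => D.transport₂ S.surface)

/-- The parallel transport `2`-functor of a flat doublet on `2`-cells of the fundamental
`2`-groupoid. -/
def ConnDoublet.flatFunctor₂ : SurfaceClass₀ E p₀ p₁ → H :=
  inducedMap AnySurface.Homotopic (fun S => D.transport₂ S.surface)

/-- A differential `(G, H)`-`1`-gauge transformation: a smooth map `g : M → G` and a form
`J ∈ Ω¹(M, 𝔥)`. -/
structure GaugeTransf (E : Type*) [NormedAddCommGroup E] [NormedSpace ℝ E]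
    (M : Type*) [TopologicalSpace M] [ChartedSpace E M]
    (EG : Type*) [NormedAddCommGroup EG] [NormedSpace ℝ EG]
    (G : Type*) [TopologicalSpace G] [ChartedSpace EG G]
    (EH : Type*) [NormedAddCommGroup EH] [NormedSpace ℝ EH] where
  g : M → G
  smooth_g : ContMDiff 𝓘(ℝ, E) 𝓘(ℝ, EG) ∞ g
  J : DiffForm E M EH 1

/-- `G_{g,J;θ,Υ}(γ) = Ψ(0, 1; y)`, `Ψ` the integral gauge transformation of the pull-back of `(g, J)`
under the unit surface of `γ`, which does not depend on `y`. -/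
def ConnDoublet.gaugeTransport (T : GaugeTransf E M EG G EH) (γ : Curve E p₀ p₁) : H :=
  gaugePsi C (pullX D.θ γ.unit) (fun q => T.g (γ.unit q)) (pullX T.J γ.unit) 0 1 0

/-- The `2`-cells of the gauge pseudonatural transformation, as a map on `1`-cells of the path
`2`-groupoid (equally, of the fundamental `2`-groupoid, which has the same `1`-cells). -/
def ConnDoublet.gaugeFunctor (T : GaugeTransf E M EG G EH) : PathClass E p₀ p₁ → H :=
  inducedMap Curve.ThinHomotopic (fun γ => D.gaugeTransport T γ)

end Transport

end

end HigherTransport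

/-! Every transport is a value of the solution of an ordinary differential equation in `G` or `H`,
with vector-valued coefficients built from pulled-back forms. For a smooth family over the closed
set `A` these coefficients are smooth on `A × ℝ²`, and a partition of unity extends them to `ℝ^d ×
ℝ²` (`SmoothFamily.exists_contDiff`). Only the coefficients are extended globally, never the maps
into `M`. The equations are solved over the whole parameter space with smooth dependence on the
parameters (`exists_solution`), and by uniqueness (`eqOn_of_rlog_eq`) the solution at a parameter in
`A` is the cocycle of the definition. For `W`, an integration in `x` (`exists_smooth_primitive`)
precedes an equation in `y`. For `Ψ`, the vector-valued coefficient to extend is `ṁ(g⁻¹)(J)`,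
because a `G`-valued map need not extend.

Smooth dependence on initial data comes from the implicit function theorem in the Banach space
`C([-1, 1], X)` (`exists_local_flow`). Logarithmic derivatives are computed in the single chart at
the unit (`rlog`, `dOne`).

The maps induced on classes are trivial by convention unless the transport is constant on classes,
so homotopy invariance has to be proved too. It rests on `rlog_eq_of_flat`: a map from the plane
that integrates a flat form in the first direction, and in the second direction along one line,
integrates it everywhere. Along a thin homotopy of curves `Υ` pulls back to zero, so `-θ` is flat
and the `1`-transport integrates it in both directions. As `θ` vanishes along the edges where the
homotopy is constant, the transport at the two ends agrees. The gauge transformation is treated in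
the same way, with the form `ṁ(κ)(J)`.

For a homotopy `K` of surfaces, let `w₂ = ∂ᵧW W⁻¹` and let `w₃` be the analogous primitive of the
`xz`-coefficient of `Υ`. Integrating `dΥ + [θ, Υ]` along `x` shows that `(w₂, w₃)` is flat on the
face `x = 0` (`ConnDoublet.fderiv_sub_eq_lieBr_of_curvature`), provided this `3`-form vanishes along
`K`: by rank in the thin case, by hypothesis in the flat case. Hence `w₃ = ∂_zW W⁻¹` on that face,
and `w₃` is zero at `y = 1` by the rank condition, so the `2`-transport is constant in `z`. -/

open scoped Manifold ContDiff Topology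

namespace HigherTransport

/-! ### Smoothness of composition operators on spaces of continuous functions -/

section Nemytskii

variable {K : Type*} [TopologicalSpace K] [CompactSpace K]

/-- Pointwise application of a continuous family of linear maps, as a bilinear map. -/
noncomputable def pointwiseApply (K : Type*) [TopologicalSpace K] [CompactSpace K]
    (E F : Type*) [NormedAddCommGroup E] [NormedSpace ℝ E]
    [NormedAddCommGroup F] [NormedSpace ℝ F] :
    C(K, E →L[ℝ] F) →L[ℝ] C(K, E) →L[ℝ] C(K, F) :=
  LinearMap.mkContinuous₂
    (LinearMap.mk₂ ℝ (fun (A : C(K, E →L[ℝ] F)) (h : C(K, E)) =>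
        (⟨fun s => A s (h s), A.continuous.clm_apply h.continuous⟩ : C(K, F)))
      (fun _ _ _ => by ext; simp) (fun _ _ _ => by ext; simp)
      (fun _ _ _ => by ext; simp) (fun _ _ _ => by ext; simp)) 1
    (fun A h => by
      refine (ContinuousMap.norm_le _ (by positivity)).2 fun s => ?_
      rw [one_mul]
      exact ((A s).le_opNorm _).trans (mul_le_mul (A.norm_coe_le_norm s) (h.norm_coe_le_norm s)
        (norm_nonneg _) (by positivity)))

@[simp] theorem pointwiseApply_apply {E F : Type*} [NormedAddCommGroup E] [NormedSpace ℝ E]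
    [NormedAddCommGroup F] [NormedSpace ℝ F] (A : C(K, E →L[ℝ] F)) (h : C(K, E)) (s : K) :
    pointwiseApply K E F A h s = A s (h s) := rfl

/-- Compact support makes `fderiv ℝ g` globally Lipschitz. The mean value inequality then bounds the
Taylor remainder by a multiple of `‖h s‖ ^ 2`, uniformly in `s`, which is what differentiability in
the sup norm requires. -/
theorem hasFDerivAt_postcomp {E F : Type*} [NormedAddCommGroup E] [NormedSpace ℝ E]
    [NormedAddCommGroup F] [NormedSpace ℝ F] {g : E → F} (hg : ContDiff ℝ ∞ g)
    (hc : HasCompactSupport g) (u : C(K, E)) :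
    HasFDerivAt (fun u : C(K, E) => (⟨g, hg.continuous⟩ : C(E, F)).comp u)
      (pointwiseApply K E F
        ((⟨fderiv ℝ g, hg.continuous_fderiv (by simp)⟩ : C(E, E →L[ℝ] F)).comp u)) u := by
  obtain ⟨L, hL⟩ := ContDiff.lipschitzWith_of_hasCompactSupport (hc.fderiv ℝ)
    (hg.fderiv_right (m := ∞) (by simp)) (by simp)
  have key : ∀ a b : E, ‖g b - g a - fderiv ℝ g a (b - a)‖ ≤ L * ‖b - a‖ * ‖b - a‖ := by
    intro a b
    refine Convex.norm_image_sub_le_of_norm_fderiv_le' (s := Metric.closedBall a ‖b - a‖)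
      (fun x _ => (hg.differentiable (by simp)) x) (fun x hx => ?_) (convex_closedBall _ _)
      (by simp) (by simp [dist_eq_norm])
    have := hL.dist_le_mul x a
    rw [dist_eq_norm] at this
    exact this.trans (mul_le_mul_of_nonneg_left hx L.2)
  rw [hasFDerivAt_iff_isLittleO_nhds_zero]
  have hO : (fun h : C(K, E) => (⟨g, hg.continuous⟩ : C(E, F)).comp (u + h) -
      (⟨g, hg.continuous⟩ : C(E, F)).comp u - pointwiseApply K E F
        ((⟨fderiv ℝ g, hg.continuous_fderiv (by simp)⟩ : C(E, E →L[ℝ] F)).comp u) h)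
      =O[𝓝 0] fun h : C(K, E) => ‖h‖ ^ 2 := by
    refine Asymptotics.IsBigO.of_bound L (Filter.Eventually.of_forall fun h => ?_)
    refine (ContinuousMap.norm_le _ (by positivity)).2 fun s => ?_
    have h1 := key (u s) (u s + h s)
    have h2 : ‖h s‖ ≤ ‖h‖ := h.norm_coe_le_norm s
    simp only [add_sub_cancel_left] at h1
    simp only [ContinuousMap.sub_apply, ContinuousMap.comp_apply, ContinuousMap.coe_mk,
      ContinuousMap.add_apply, pointwiseApply_apply]
    refine h1.trans ?_
    rw [Real.norm_of_nonneg (by positivity), mul_assoc, sq]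
    gcongr
  refine hO.trans_isLittleO ?_
  exact (Asymptotics.isLittleO_norm_pow_id one_lt_two)

/-- The Nemytskii operator `u ↦ g ∘ u` of a smooth compactly supported map is smooth. -/
theorem contDiff_postcomp {E : Type u} [NormedAddCommGroup E] [NormedSpace ℝ E] (n : ℕ) :
    ∀ {F : Type u} [NormedAddCommGroup F] [NormedSpace ℝ F] {g : E → F} (hg : ContDiff ℝ ∞ g)
      (_ : HasCompactSupport g),
      ContDiff ℝ n (fun u : C(K, E) => (⟨g, hg.continuous⟩ : C(E, F)).comp u) := by
  induction n with
  | zero =>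
    intro F _ _ g hg hc
    rw [Nat.cast_zero, contDiff_zero]
    exact continuous_iff_continuousAt.2 fun u => (hasFDerivAt_postcomp hg hc u).continuousAt
  | succ n ih =>
    intro F _ _ g hg hc
    rw [Nat.cast_succ, contDiff_succ_iff_fderiv]
    refine ⟨fun u => (hasFDerivAt_postcomp hg hc u).differentiableAt, by simp, ?_⟩
    -- The derivative is again a composition operator, now for `fderiv ℝ g`, whose values lie in
    -- another space; this is why `F` is quantified inside the induction.
    have h1 := ih (g := fderiv ℝ g) (hg.fderiv_right (by simp)) (hc.fderiv ℝ)
    have : fderiv ℝ (fun u : C(K, E) => (⟨g, hg.continuous⟩ : C(E, F)).comp u) = fun u =>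
        pointwiseApply K E F
        ((⟨fderiv ℝ g, hg.continuous_fderiv (by simp)⟩ : C(E, E →L[ℝ] F)).comp u) :=
      funext fun u => (hasFDerivAt_postcomp hg hc u).fderiv
    rw [this]
    exact (pointwiseApply K E F).contDiff.comp h1

end Nemytskii

/-! ### Smoothness of implicit functions on a neighbourhood -/

section ImplicitFunction

/-- The implicit function of a smooth equation is smooth near the base point. -/
theorem eventually_contDiffAt_implicitFunction
    {E₁ : Type*} [NormedAddCommGroup E₁] [NormedSpace ℝ E₁] [CompleteSpace E₁]
    {E₂ : Type*} [NormedAddCommGroup E₂] [NormedSpace ℝ E₂] [CompleteSpace E₂]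
    {F : Type*} [NormedAddCommGroup F] [NormedSpace ℝ F] [CompleteSpace F]
    {f : E₁ × E₂ → F} (hf : ContDiff ℝ ∞ f) {u : E₁ × E₂}
    (hi : (fderiv ℝ f u ∘L .inr ℝ E₁ E₂).IsInvertible) :
    ∀ᶠ x in 𝓝 u.1, ContDiffAt ℝ ∞ (hf.contDiffAt.implicitFunction (by simp) hi) x := by
  set ψ := hf.contDiffAt.implicitFunction (by simp) hi with hψ
  have hsm : ContDiffAt ℝ ∞ ψ u.1 := hf.contDiffAt.contDiffAt_implicitFunction (by simp) hi
  have hsu : ψ u.1 = u.2 := hf.contDiffAt.implicitFunction_apply_self (by simp) hi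
  -- `ContDiffAt ℝ ∞` at one point gives neighbourhoods that may shrink with the order. The implicit
  -- function theorem is therefore applied afresh at each nearby `(x, ψ x)`; local uniqueness shows
  -- that it produces the same germ.
  have h1 : ∀ᶠ x in 𝓝 u.1, ∀ᶠ y in 𝓝 x, f (y, ψ y) = f u :=
    (hf.contDiffAt.eventually_apply_implicitFunction (by simp) hi).eventually_nhds
  have h2 : ∀ᶠ x in 𝓝 u.1, ContDiffAt ℝ 1 ψ x :=
    (hsm.of_le (m := 1) (by exact_mod_cast le_top)).eventually (by simp)
  have h3 : ∀ᶠ x in 𝓝 u.1, (fderiv ℝ f (x, ψ x) ∘L .inr ℝ E₁ E₂).IsInvertible := by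
    have hcont : ContinuousAt (fun x => fderiv ℝ f (x, ψ x) ∘L .inr ℝ E₁ E₂) u.1 := by
      have : ContinuousAt (fun x => fderiv ℝ f (x, ψ x)) u.1 :=
        (hf.continuous_fderiv (by simp)).continuousAt.comp
          (continuousAt_id.prodMk hsm.continuousAt)
      exact this.clm_comp continuousAt_const
    have hop : {T : E₂ →L[ℝ] F | T.IsInvertible} ∈ 𝓝 (fderiv ℝ f (u.1, ψ u.1) ∘L .inr ℝ E₁ E₂) := by
      rw [hsu]
      obtain ⟨e, he⟩ := hi
      have := e.nhds
      rw [he] at this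
      filter_upwards [this] with T hT
      exact hT
    exact hcont hop
  filter_upwards [h1, h2, h3] with x hx1 hx2 hx3
  have hc : ContDiffAt ℝ ∞ f (x, ψ x) := hf.contDiffAt
  have hs := hc.contDiffAt_implicitFunction (by simp) hx3
  refine hs.congr_of_eventuallyEq ?_
  have h4 := hc.eventually_apply_eq_iff_implicitFunction (by simp) hx3
  have h5 : Filter.Tendsto (fun y => (y, ψ y)) (𝓝 x) (𝓝 (x, ψ x)) :=
    continuousAt_id.prodMk hx2.continuousAt
  filter_upwards [h5.eventually h4, hx1] with y hy1 hy2
  exact (hy1.1 (hy2.trans hx1.self_of_nhds.symm)).symm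

end ImplicitFunction

/-! ### Local flows by the implicit function theorem -/

section Flow

open Set MeasureTheory

/-- The integral from `0` as an operator on continuous functions on `[-1, 1]`. -/
noncomputable def integralOp (X : Type*) [NormedAddCommGroup X] [NormedSpace ℝ X] :
    C(Icc (-1 : ℝ) 1, X) →L[ℝ] C(Icc (-1 : ℝ) 1, X) :=
  have hcont (w : C(Icc (-1 : ℝ) 1, X)) :
      Continuous (fun r : ℝ => w (projIcc (-1) 1 (by norm_num) r)) :=
    w.continuous.comp continuous_projIcc
  LinearMap.mkContinuous
    { toFun := fun w => ⟨fun s => ∫ r in (0 : ℝ)..s, w (projIcc (-1) 1 (by norm_num) r),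
        (intervalIntegral.continuous_primitive
          (fun _ _ => (hcont w).intervalIntegrable _ _) 0).comp continuous_subtype_val⟩
      map_add' := fun w w' => by
        ext s
        exact intervalIntegral.integral_add ((hcont w).intervalIntegrable _ _)
          ((hcont w').intervalIntegrable _ _)
      map_smul' := fun c w => by
        ext s
        exact intervalIntegral.integral_smul c _ } 1
    (fun w => by
      refine (ContinuousMap.norm_le _ (by positivity)).2 fun s => ?_
      rw [one_mul]
      refine (intervalIntegral.norm_integral_le_of_norm_le_const (C := ‖w‖)
        (fun r _ => w.norm_coe_le_norm _)).trans ?_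
      rw [sub_zero]
      exact mul_le_of_le_one_right (norm_nonneg _) (abs_le.2 s.2))

theorem projIcc_mul_mem {l r : ℝ} (hl : l ∈ Icc (-1 : ℝ) 1) (hr : r ∈ Icc (-1 : ℝ) 1) :
    l * r ∈ Icc (-1 : ℝ) 1 := by
  rw [mem_Icc, ← abs_le] at *
  rw [abs_mul]
  exact mul_le_one₀ hl (abs_nonneg _) hr

/-- Local flow of a smooth compactly supported vector field, smooth in time and initial value. -/
theorem exists_local_flow {X : Type*} [NormedAddCommGroup X] [NormedSpace ℝ X]
    [CompleteSpace X] {v : X → X} (hv : ContDiff ℝ ∞ v) (hc : HasCompactSupport v) (x₀ : X) :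
    ∃ Φ : ℝ × X → X, ∃ δ : ℝ, 0 < δ ∧ ∀ t x, |t| < δ → ‖x - x₀‖ < δ →
      ContDiffAt ℝ ∞ Φ (t, x) ∧ Φ (0, x) = x ∧
        HasDerivAt (fun s => Φ (s, x)) (v (Φ (t, x))) t := by
  let N : C(Icc (-1 : ℝ) 1, X) → C(Icc (-1 : ℝ) 1, X) := fun u =>
    (⟨v, hv.continuous⟩ : C(X, X)).comp u
  have hN : ContDiff ℝ ∞ N := contDiff_infty.2 fun n => contDiff_postcomp n hv hc
  let cst : X →L[ℝ] C(Icc (-1 : ℝ) 1, X) := ContinuousLinearMap.const ℝ (Icc (-1 : ℝ) 1)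
  -- The zeros of `f` are the curves `s ↦ γ (t * s)` with `γ' = v ∘ γ` and `γ 0 = x`. Rescaling
  -- keeps the interval `[-1, 1]` fixed and turns time into a parameter, so that the implicit
  -- function theorem yields joint smoothness.
  let f : (ℝ × X) × C(Icc (-1 : ℝ) 1, X) → C(Icc (-1 : ℝ) 1, X) := fun w =>
    w.2 - cst w.1.2 - w.1.1 • integralOp X (N w.2)
  have hf : ContDiff ℝ ∞ f := by
    refine (contDiff_snd.sub (cst.contDiff.comp (contDiff_snd.comp contDiff_fst))).sub ?_
    exact (contDiff_fst.comp contDiff_fst).smul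
      ((integralOp X).contDiff.comp (hN.comp contDiff_snd))
  have happ : ∀ (t : ℝ) (x : X) (u : C(Icc (-1 : ℝ) 1, X)), f ((t, x), u) = 0 ↔
      ∀ s, u s = x + t • ∫ r in (0 : ℝ)..s, v (u (projIcc (-1) 1 (by norm_num) r)) := by
    intro t x u
    rw [ContinuousMap.ext_iff]
    refine forall_congr' fun s => ?_
    change u s - x - t • ∫ r in (0 : ℝ)..s, v (u (projIcc (-1) 1 (by norm_num) r)) = 0 ↔ _
    rw [sub_sub, sub_eq_zero]
  set w₀ : (ℝ × X) × C(Icc (-1 : ℝ) 1, X) := ((0, x₀), cst x₀) with hw₀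
  have hfw₀ : f w₀ = 0 := by simp [f, hw₀]
  -- At `t = 0` the integral term disappears and the partial derivative in `u` is the identity.
  have hi : (fderiv ℝ f w₀ ∘L .inr ℝ (ℝ × X) C(Icc (-1 : ℝ) 1, X)).IsInvertible := by
    have h1 : HasFDerivAt (fun u => f (w₀.1, u))
        (fderiv ℝ f w₀ ∘L .inr ℝ (ℝ × X) C(Icc (-1 : ℝ) 1, X)) w₀.2 :=
      ((hf.differentiable (by simp)) (w₀.1, w₀.2)).hasFDerivAt.comp w₀.2
        (hasFDerivAt_prodMk_right w₀.1 w₀.2)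
    have h2 : (fun u => f (w₀.1, u)) = fun u => u - cst x₀ := by
      ext u
      simp [f, hw₀]
    rw [h2] at h1
    rw [h1.unique ((hasFDerivAt_id _).sub_const _)]
    exact ⟨ContinuousLinearEquiv.refl ℝ _, rfl⟩
  set ψ := hf.contDiffAt.implicitFunction (by simp) hi with hψ
  have hψs := eventually_contDiffAt_implicitFunction hf hi
  have hψ0 : ψ (0, x₀) = cst x₀ := hf.contDiffAt.implicitFunction_apply_self (by simp) hi
  have hψe : ∀ᶠ p in 𝓝 ((0 : ℝ), x₀), f (p, ψ p) = 0 := by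
    have := hf.contDiffAt.eventually_apply_implicitFunction (by simp) hi
    rwa [hfw₀] at this
  have hψu := hf.contDiffAt.eventually_apply_eq_iff_implicitFunction (by simp) hi
  rw [hfw₀] at hψu
  obtain ⟨ρ, hρ, hρu⟩ := Metric.eventually_nhds_iff_ball.1 hψu
  have hnear : ∀ᶠ p in 𝓝 ((0 : ℝ), x₀), ψ p ∈ Metric.ball (cst x₀) ρ := by
    have : ContinuousAt ψ (0, x₀) := hψs.self_of_nhds.continuousAt
    refine this (Metric.isOpen_ball.mem_nhds ?_)
    rw [hψ0]
    exact Metric.mem_ball_self hρ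
  obtain ⟨η, hη, hall⟩ := Metric.eventually_nhds_iff_ball.1 (hψs.and (hψe.and hnear))
  have hall' : ∀ t x, |t| < min η ρ → ‖x - x₀‖ < min η ρ → ContDiffAt ℝ ∞ ψ (t, x) ∧
      f ((t, x), ψ (t, x)) = 0 ∧ ψ (t, x) ∈ Metric.ball (cst x₀) ρ := by
    intro t x ht hx
    refine hall (t, x) ?_
    rw [Metric.mem_ball, Prod.dist_eq, max_lt_iff, Real.dist_eq, sub_zero, dist_eq_norm]
    exact ⟨ht.trans_le (min_le_left _ _), hx.trans_le (min_le_left _ _)⟩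
  have one_mem : (1 : ℝ) ∈ Icc (-1 : ℝ) 1 := by norm_num
  -- scaling
  have hscale : ∀ t x, |t| < min η ρ → ‖x - x₀‖ < min η ρ → ∀ l : Icc (-1 : ℝ) 1,
      ψ (l * t, x) ⟨1, one_mem⟩ = ψ (t, x) l := by
    intro t x ht hx l
    obtain ⟨-, hz, hb⟩ := hall' t x ht hx
    -- The rescaled curve solves the equation for time `l * t` and is no farther from the constant
    -- curve than `ψ (t, x)`. It thus lies in the ball where zeros are unique.
    let ul : C(Icc (-1 : ℝ) 1, X) :=
      ⟨fun s => ψ (t, x) ⟨l * s, projIcc_mul_mem l.2 s.2⟩, by fun_prop⟩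
    have hul : f ((l * t, x), ul) = 0 := by
      rw [happ] at hz ⊢
      intro s
      change ψ (t, x) ⟨l * s, projIcc_mul_mem l.2 s.2⟩ = _
      rw [hz, mul_comm (l : ℝ) t, mul_smul]
      congr 2
      have := intervalIntegral.smul_integral_comp_mul_left (a := 0) (b := (s : ℝ))
        (fun r => v (ψ (t, x) (projIcc (-1) 1 (by norm_num) r))) (l : ℝ)
      rw [mul_zero] at this
      rw [← this]
      congr 1
      refine intervalIntegral.integral_congr fun r hr => ?_
      have hr' : r ∈ Icc (-1 : ℝ) 1 := by
        have h0 : (0 : ℝ) ∈ Icc (-1 : ℝ) 1 := by norm_num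
        exact (convex_Icc (-1 : ℝ) 1).ordConnected.uIcc_subset h0 s.2 hr
      simp only [ul, ContinuousMap.coe_mk]
      rw [projIcc_of_mem _ (projIcc_mul_mem l.2 hr'), projIcc_of_mem _ hr']
    have hmem : ((l * t, x), ul) ∈ Metric.ball w₀ ρ := by
      rw [Metric.mem_ball, Prod.dist_eq, Prod.dist_eq, max_lt_iff, max_lt_iff]
      refine ⟨⟨?_, ?_⟩, ?_⟩
      · rw [Real.dist_eq, sub_zero, abs_mul]
        exact (mul_le_of_le_one_left (abs_nonneg _) (abs_le.2 l.2)).trans_lt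
          (ht.trans_le (min_le_right _ _))
      · rw [dist_eq_norm]
        exact hx.trans_le (min_le_right _ _)
      · rw [Metric.mem_ball] at hb
        refine lt_of_le_of_lt ?_ hb
        refine (ContinuousMap.dist_le dist_nonneg).2 fun s => ?_
        exact ContinuousMap.dist_apply_le_dist (f := ψ (t, x)) (g := cst x₀)
          ⟨l * s, projIcc_mul_mem l.2 s.2⟩
    have := (hρu _ hmem).1 hul
    change ψ (l * t, x) = ul at this
    rw [this]
    simp [ul]
  refine ⟨fun p => ψ p ⟨1, one_mem⟩, min η ρ, lt_min hη hρ, fun t x ht hx => ⟨?_, ?_, ?_⟩⟩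
  · exact (ContinuousMap.evalCLM ℝ (⟨1, one_mem⟩ : Icc (-1 : ℝ) 1)).contDiff.contDiffAt.comp (t, x)
      (hall' t x ht hx).1
  · have := (happ _ _ _).1 (hall' 0 x (by simpa using lt_min hη hρ) hx).2.1 ⟨1, one_mem⟩
    simpa using this
  -- With a fixed `τ` between `|t|` and the radius, the scaling relation reads `Φ (s, x)` off the
  -- single curve `ψ (τ, x)` for all `s` near `t`. The derivative in time becomes that of an
  -- integral in its upper limit.
  · obtain ⟨τ, hτ1, hτ2⟩ := exists_between ht
    have hτ0 : 0 < τ := (abs_nonneg t).trans_lt hτ1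
    have hz := (happ _ _ _).1 (hall' τ x (by rwa [abs_of_pos hτ0]) hx).2.1
    have hmem : ∀ s, |s| < τ → s / τ ∈ Icc (-1 : ℝ) 1 := fun s hs => by
      rw [mem_Icc, ← abs_le, abs_div, abs_of_pos hτ0, div_le_one hτ0]
      exact hs.le
    have hval : ∀ s (hs : |s| < τ), ψ (s, x) ⟨1, one_mem⟩ = ψ (τ, x) ⟨s / τ, hmem s hs⟩ := by
      intro s hs
      rw [← hscale τ x (by rwa [abs_of_pos hτ0]) hx ⟨s / τ, hmem s hs⟩]
      simp [div_mul_cancel₀ _ hτ0.ne']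
    have hcont : Continuous (fun r : ℝ => v (ψ (τ, x) (projIcc (-1) 1 (by norm_num) r))) :=
      hv.continuous.comp ((ψ (τ, x)).continuous.comp continuous_projIcc)
    have hd : HasDerivAt (fun s : ℝ => x + τ • ∫ r in (0 : ℝ)..(s / τ),
        v (ψ (τ, x) (projIcc (-1) 1 (by norm_num) r)))
        (v (ψ (τ, x) (projIcc (-1) 1 (by norm_num) (t / τ)))) t := by
      have h1 : HasDerivAt (fun s : ℝ => ∫ r in (0 : ℝ)..s,
          v (ψ (τ, x) (projIcc (-1) 1 (by norm_num) r))) _ (t / τ) :=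
        hcont.deriv_integral _ _ _ ▸ (intervalIntegral.differentiable_integral_of_continuous
          hcont _).hasDerivAt
      have h2 := ((h1.scomp t ((hasDerivAt_id t).div_const τ)).const_smul τ).const_add x
      convert! h2 using 1
      simp [smul_smul, hτ0.ne']
    have he : (fun s => ψ (s, x) ⟨1, one_mem⟩) =ᶠ[𝓝 t] fun s : ℝ => x + τ • ∫ r in (0 : ℝ)..(s / τ),
        v (ψ (τ, x) (projIcc (-1) 1 (by norm_num) r)) := by
      filter_upwards [(isOpen_lt continuous_abs continuous_const).mem_nhds hτ1] with s hs
      rw [hval s hs, hz]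
    change HasDerivAt (fun s => ψ (s, x) ⟨1, one_mem⟩) (v (ψ (t, x) ⟨1, one_mem⟩)) t
    rw [hval t hτ1]
    have := hd.congr_of_eventuallyEq he
    rwa [projIcc_of_mem _ (hmem t hτ1)] at this

end Flow

/-! ### Differentials at the unit of a Lie group, in one chart -/

section LieGroupCalculus

variable {P : Type*} [NormedAddCommGroup P] [NormedSpace ℝ P]
  {EG : Type*} [NormedAddCommGroup EG] [NormedSpace ℝ EG]
  {G : Type*} [TopologicalSpace G] [ChartedSpace EG G] [Group G]
  {EH : Type*} [NormedAddCommGroup EH] [NormedSpace ℝ EH]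
  {H : Type*} [TopologicalSpace H] [ChartedSpace EH H] [Group H]
  {EK : Type*} [NormedAddCommGroup EK] [NormedSpace ℝ EK]
  {K : Type*} [TopologicalSpace K] [ChartedSpace EK K] [Group K]

/-- The preferred chart at the unit of a Lie group. -/
noncomputable def unitChart (EG : Type*) [NormedAddCommGroup EG] [NormedSpace ℝ EG]
    (G : Type*) [TopologicalSpace G] [ChartedSpace EG G] [Group G] : PartialEquiv G EG :=
  extChartAt 𝓘(ℝ, EG) (1 : G)

/-- The differential at `p` of a map with value `1` at `p`, in the chart at the unit. -/
noncomputable def dOne (k : P → G) (p : P) : P →L[ℝ] EG :=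
  fderiv ℝ (fun q => unitChart EG G (k q)) p

/-- The right logarithmic derivative `du u⁻¹`. -/
noncomputable def rlog (u : P → G) (p : P) : P →L[ℝ] EG := dOne (fun q => u q * (u p)⁻¹) p

/-- The differential at the unit of a map preserving the unit, in the charts at the units. -/
noncomputable def tanMap (ψ : G → H) : EG →L[ℝ] EH :=
  fderiv ℝ (fun x => unitChart EH H (ψ ((unitChart EG G).symm x))) (unitChart EG G 1)

theorem unitChart_symm_one : (unitChart EG G).symm (unitChart EG G 1) = 1 :=
  extChartAt_to_inv (I := 𝓘(ℝ, EG)) (1 : G)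

theorem eventually_unitChart_symm {X : Type*} [TopologicalSpace X] {k : X → G} {p : X}
    (hk : ContinuousAt k p) (h1 : k p = 1) :
    ∀ᶠ q in 𝓝 p, (unitChart EG G).symm (unitChart EG G (k q)) = k q := by
  have : ∀ᶠ g in 𝓝 (k p), (unitChart EG G).symm (unitChart EG G g) = g := by
    rw [h1]
    filter_upwards [extChartAt_source_mem_nhds (I := 𝓘(ℝ, EG)) (1 : G)] with g hg
    exact (extChartAt 𝓘(ℝ, EG) (1 : G)).left_inv hg
  exact hk.eventually this

theorem eventually_unitChart_right_inv :
    ∀ᶠ x in 𝓝 (unitChart EG G 1), unitChart EG G ((unitChart EG G).symm x) = x := by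
  filter_upwards [extChartAt_target_mem_nhds (I := 𝓘(ℝ, EG)) (1 : G)] with x hx
  exact (extChartAt 𝓘(ℝ, EG) (1 : G)).right_inv hx

theorem ContMDiffAt.unitChart [IsManifold 𝓘(ℝ, EG) ∞ G] {n : ℕ∞} {k : P → G} {p : P}
    (hk : ContMDiffAt 𝓘(ℝ, P) 𝓘(ℝ, EG) n k p) (h1 : k p = 1) :
    ContDiffAt ℝ n (fun q => unitChart EG G (k q)) p := by
  rw [← contMDiffAt_iff_contDiffAt]
  have h : ContMDiffAt 𝓘(ℝ, EG) 𝓘(ℝ, EG) n (extChartAt 𝓘(ℝ, EG) (1 : G)) (k p) := by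
    rw [h1]
    exact (contMDiffAt_extChartAt (n := ∞)).of_le (by exact_mod_cast le_top)
  exact h.comp p hk

theorem contMDiffAt_unitChart_symm [IsManifold 𝓘(ℝ, EG) ∞ G] :
    ContMDiffAt 𝓘(ℝ, EG) 𝓘(ℝ, EG) ∞ (unitChart EG G).symm (unitChart EG G 1) :=
  (contMDiffOn_extChartAt_symm (1 : G)).contMDiffAt (extChartAt_target_mem_nhds (1 : G))

/-- The manifold derivative of a map from a normed space, in the preferred chart at the image. -/
theorem hasFDerivAt_extChartAt_comp {E : Type*} [NormedAddCommGroup E] [NormedSpace ℝ E]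
    {M : Type*} [TopologicalSpace M] [ChartedSpace E M] {k : P → M} {p : P}
    (hk : MDifferentiableAt 𝓘(ℝ, P) 𝓘(ℝ, E) k p) :
    HasFDerivAt (fun q => extChartAt 𝓘(ℝ, E) (k p) (k q))
      (show P →L[ℝ] E from mfderiv 𝓘(ℝ, P) 𝓘(ℝ, E) k p) p := by
  have h := hk.hasMFDerivAt.2
  rw [ModelWithCorners.range_eq_univ] at h
  exact hasFDerivWithinAt_univ.1 h

/-- `mfderiv` is expressed in the preferred chart at the value of the map, which is the chart at the
unit when `k p = 1`. This translates the logarithmic derivatives of the statement into ordinary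
Fréchet derivatives. -/
theorem mfderiv_eq_dOne {k : P → G} {p : P} (hk : MDifferentiableAt 𝓘(ℝ, P) 𝓘(ℝ, EG) k p)
    (h1 : k p = 1) (v : P) :
    (mfderiv 𝓘(ℝ, P) 𝓘(ℝ, EG) k p v : EG) = dOne (EG := EG) k p v := by
  have h := (hasFDerivAt_extChartAt_comp hk).fderiv
  rw [h1] at h
  exact (DFunLike.congr_fun h v).symm

theorem mfderiv_eq_tanMap {ψ : G → H}
    (hψ : MDifferentiableAt 𝓘(ℝ, EG) 𝓘(ℝ, EH) ψ 1) (h1 : ψ 1 = 1) (v : EG) :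
    (mfderiv 𝓘(ℝ, EG) 𝓘(ℝ, EH) ψ 1 v : EH) = tanMap (EG := EG) (EH := EH) ψ v := by
  have h : HasFDerivWithinAt (writtenInExtChartAt 𝓘(ℝ, EG) 𝓘(ℝ, EH) 1 ψ)
      (show EG →L[ℝ] EH from mfderiv 𝓘(ℝ, EG) 𝓘(ℝ, EH) ψ 1) Set.univ (unitChart EG G 1) := by
    have h := hψ.hasMFDerivAt.2
    rw [ModelWithCorners.range_eq_univ] at h
    exact h
  have h' := h.hasFDerivAt_of_univ.fderiv
  have h2 : writtenInExtChartAt 𝓘(ℝ, EG) 𝓘(ℝ, EH) 1 ψ =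
      fun x => unitChart EH H (ψ ((unitChart EG G).symm x)) := by
    ext x
    simp only [writtenInExtChartAt, Function.comp_apply, h1]
    rfl
  rw [h2] at h'
  exact (DFunLike.congr_fun h' v).symm

theorem dOne_unitChart_symm : dOne (EG := EG) (G := G) (unitChart EG G).symm (unitChart EG G 1) =
    ContinuousLinearMap.id ℝ EG := by
  rw [dOne, Filter.EventuallyEq.fderiv_eq (f := fun x => x) eventually_unitChart_right_inv]
  exact fderiv_fun_id

theorem dOne_const (p : P) : dOne (EG := EG) (fun _ : P => (1 : G)) p = 0 := by
  simp [dOne]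

theorem tanMap_id : tanMap (EG := EG) (EH := EG) (fun x : G => x) = ContinuousLinearMap.id ℝ EG :=
  dOne_unitChart_symm

variable [LieGroup 𝓘(ℝ, EG) ∞ G] [LieGroup 𝓘(ℝ, EH) ∞ H]

theorem differentiableAt_unitChart {k : P → G} {p : P}
    (hk : ContMDiffAt 𝓘(ℝ, P) 𝓘(ℝ, EG) 1 k p) (h1 : k p = 1) :
    DifferentiableAt ℝ (fun q => unitChart EG G (k q)) p :=
  (ContMDiffAt.unitChart (n := 1) hk h1).differentiableAt one_ne_zero

/-- Chain rule at the unit, for maps of the chart. -/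
theorem fderiv_comp_unitChart {F : Type*} [NormedAddCommGroup F] [NormedSpace ℝ F] {ψ : G → F}
    (hψ : DifferentiableAt ℝ (fun x => ψ ((unitChart EG G).symm x)) (unitChart EG G 1))
    {k : P → G} {p : P} (hk : ContMDiffAt 𝓘(ℝ, P) 𝓘(ℝ, EG) 1 k p) (h1 : k p = 1) :
    HasFDerivAt (fun q => ψ (k q))
      (fderiv ℝ (fun x => ψ ((unitChart EG G).symm x)) (unitChart EG G 1) ∘L dOne k p) p := by
  have h2 := (differentiableAt_unitChart hk h1).hasFDerivAt
  have h3 : HasFDerivAt (fun x => ψ ((unitChart EG G).symm x))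
      (fderiv ℝ (fun x => ψ ((unitChart EG G).symm x)) (unitChart EG G 1))
      (unitChart EG G (k p)) := by
    rw [h1]; exact hψ.hasFDerivAt
  refine (h3.comp p h2).congr_of_eventuallyEq ?_
  filter_upwards [eventually_unitChart_symm (EG := EG) hk.continuousAt h1] with q hq
  simp only [Function.comp_apply, hq]

theorem differentiableAt_unitChart_comp_symm {ψ : G → H}
    (hψ : ContMDiffAt 𝓘(ℝ, EG) 𝓘(ℝ, EH) 1 ψ 1) (h1 : ψ 1 = 1) :
    DifferentiableAt ℝ (fun x => unitChart EH H (ψ ((unitChart EG G).symm x)))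
      (unitChart EG G 1) := by
  refine differentiableAt_unitChart (k := fun x => ψ ((unitChart EG G).symm x)) ?_
    (by rw [unitChart_symm_one, h1])
  have h3 : ContMDiffAt 𝓘(ℝ, EG) 𝓘(ℝ, EH) 1 ψ ((unitChart EG G).symm (unitChart EG G 1)) := by
    rwa [unitChart_symm_one]
  exact h3.comp _ (contMDiffAt_unitChart_symm.of_le (by simp))

theorem dOne_comp {ψ : G → H} (hψ : ContMDiffAt 𝓘(ℝ, EG) 𝓘(ℝ, EH) 1 ψ 1) (hψ1 : ψ 1 = 1)
    {k : P → G} {p : P} (hk : ContMDiffAt 𝓘(ℝ, P) 𝓘(ℝ, EG) 1 k p) (h1 : k p = 1) :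
    dOne (EG := EH) (fun q => ψ (k q)) p = tanMap ψ ∘L dOne (EG := EG) k p :=
  (fderiv_comp_unitChart (ψ := fun g => unitChart EH H (ψ g))
    (differentiableAt_unitChart_comp_symm hψ hψ1) hk h1).fderiv

theorem tanMap_comp [LieGroup 𝓘(ℝ, EK) ∞ K] {ψ : H → K} {χ : G → H}
    (hψ : ContMDiffAt 𝓘(ℝ, EH) 𝓘(ℝ, EK) 1 ψ 1)
    (hψ1 : ψ 1 = 1) (hχ : ContMDiffAt 𝓘(ℝ, EG) 𝓘(ℝ, EH) 1 χ 1) (hχ1 : χ 1 = 1) :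
    tanMap (fun x => ψ (χ x)) = tanMap (EG := EH) (EH := EK) ψ ∘L tanMap (EG := EG) χ := by
  refine dOne_comp (p := unitChart EG G 1) (k := fun x => χ ((unitChart EG G).symm x)) hψ hψ1 ?_
    (by rw [unitChart_symm_one, hχ1])
  have h3 : ContMDiffAt 𝓘(ℝ, EG) 𝓘(ℝ, EH) 1 χ ((unitChart EG G).symm (unitChart EG G 1)) := by
    rwa [unitChart_symm_one]
  exact h3.comp _ (contMDiffAt_unitChart_symm.of_le (by simp))

/-- In the chart, multiplication has both partial derivatives equal to the identity at the unit,
because each restriction `x ↦ x * 1`, `x ↦ 1 * x` is the identity. -/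
theorem dOne_mul {k l : P → G} {p : P} (hk : ContMDiffAt 𝓘(ℝ, P) 𝓘(ℝ, EG) 1 k p)
    (hl : ContMDiffAt 𝓘(ℝ, P) 𝓘(ℝ, EG) 1 l p) (hk1 : k p = 1) (hl1 : l p = 1) :
    dOne (EG := EG) (fun q => k q * l q) p = dOne k p + dOne l p := by
  set e := unitChart EG G 1 with he
  let s := (unitChart EG G).symm
  have hs : ContMDiffAt 𝓘(ℝ, EG) 𝓘(ℝ, EG) 1 s e := contMDiffAt_unitChart_symm.of_le (by simp)
  have hs1 : s e = 1 := unitChart_symm_one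
  have := topologicalGroup_of_lieGroup 𝓘(ℝ, EG) ∞ (G := G)
  let μ : EG × EG → EG := fun x => unitChart EG G (s x.1 * s x.2)
  have hμs : ContMDiffAt 𝓘(ℝ, EG × EG) 𝓘(ℝ, EG) 1 (fun x : EG × EG => s x.1 * s x.2) (e, e) := by
    have h1 : ContMDiffAt 𝓘(ℝ, EG × EG) 𝓘(ℝ, EG) 1 (fun x : EG × EG => s x.1) (e, e) :=
      hs.comp (e, e) contDiff_fst.contMDiff.contMDiffAt
    have h2 : ContMDiffAt 𝓘(ℝ, EG × EG) 𝓘(ℝ, EG) 1 (fun x : EG × EG => s x.2) (e, e) :=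
      hs.comp (e, e) contDiff_snd.contMDiff.contMDiffAt
    have : LieGroup 𝓘(ℝ, EG) 1 G := LieGroup.of_le (n := ∞) (by simp)
    exact h1.mul h2
  have hμ : HasFDerivAt μ (fderiv ℝ μ (e, e)) (e, e) :=
    (differentiableAt_unitChart hμs (by simp [hs1])).hasFDerivAt
  have hl' : fderiv ℝ μ (e, e) ∘L .inl ℝ EG EG = ContinuousLinearMap.id ℝ EG := by
    refine (HasFDerivAt.comp (f := fun x => (x, e)) e hμ (hasFDerivAt_prodMk_left e e)).unique
      ((hasFDerivAt_id e).congr_of_eventuallyEq ?_)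
    filter_upwards [eventually_unitChart_right_inv] with x hx
    simpa [μ, hs1] using hx
  have hr' : fderiv ℝ μ (e, e) ∘L .inr ℝ EG EG = ContinuousLinearMap.id ℝ EG := by
    refine (HasFDerivAt.comp (f := fun x => (e, x)) e hμ (hasFDerivAt_prodMk_right e e)).unique
      ((hasFDerivAt_id e).congr_of_eventuallyEq ?_)
    filter_upwards [eventually_unitChart_right_inv] with x hx
    simpa [μ, hs1] using hx
  have hkd := (differentiableAt_unitChart hk hk1).hasFDerivAt
  have hld := (differentiableAt_unitChart hl hl1).hasFDerivAt
  have hμ' : HasFDerivAt μ (fderiv ℝ μ (e, e)) (unitChart EG G (k p), unitChart EG G (l p)) := by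
    rwa [hk1, hl1]
  have hcomp := hμ'.comp p (hkd.prodMk hld)
  refine (hcomp.congr_of_eventuallyEq ?_).fderiv.trans ?_
  · filter_upwards [eventually_unitChart_symm (EG := EG) hk.continuousAt hk1,
      eventually_unitChart_symm (EG := EG) hl.continuousAt hl1] with q hq1 hq2
    simp [μ, s, hq1, hq2]
  · ext v
    have h1 := DFunLike.congr_fun hl' (dOne k p v)
    have h2 := DFunLike.congr_fun hr' (dOne l p v)
    simp only [ContinuousLinearMap.comp_apply, ContinuousLinearMap.inl_apply,
      ContinuousLinearMap.inr_apply, ContinuousLinearMap.id_apply] at h1 h2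
    simp only [ContinuousLinearMap.comp_apply, ContinuousLinearMap.prod_apply,
      add_apply]
    rw [← h1, ← h2, ← map_add]
    simp [dOne]

end LieGroupCalculus

/-! ### Product rule and uniqueness for logarithmic derivatives -/

section LogDeriv

variable {P : Type*} [NormedAddCommGroup P] [NormedSpace ℝ P]
  {EG : Type*} [NormedAddCommGroup EG] [NormedSpace ℝ EG]
  {G : Type*} [TopologicalSpace G] [ChartedSpace EG G] [Group G]

/-- The adjoint action of a Lie group on its Lie algebra. -/
noncomputable def lieAd (EG : Type*) [NormedAddCommGroup EG] [NormedSpace ℝ EG]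
    {G : Type*} [TopologicalSpace G] [ChartedSpace EG G] [Group G] (a : G) : EG →L[ℝ] EG :=
  tanMap (fun x : G => a * x * a⁻¹)

theorem rlog_mul_const (u : P → G) (c : G) (p : P) :
    rlog (EG := EG) (fun q => u q * c) p = rlog u p := by
  unfold rlog
  congr 1
  ext q
  group

theorem Filter.EventuallyEq.rlog {u v : P → G} {p : P} (h : u =ᶠ[𝓝 p] v) :
    rlog (EG := EG) u p = rlog v p := by
  refine Filter.EventuallyEq.fderiv_eq ?_
  filter_upwards [h] with q hq
  rw [hq, h.self_of_nhds]

theorem rlog_const (c : G) (p : P) : rlog (EG := EG) (fun _ : P => c) p = 0 := by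
  simp [rlog, dOne]

theorem lieAd_one : lieAd EG (1 : G) = ContinuousLinearMap.id ℝ EG := by
  rw [← tanMap_id (EG := EG) (G := G), lieAd]
  simp

variable [LieGroup 𝓘(ℝ, EG) ∞ G]

theorem contMDiffAt_mul {n : ℕ∞} {u v : P → G} {p : P}
    (hu : ContMDiffAt 𝓘(ℝ, P) 𝓘(ℝ, EG) n u p) (hv : ContMDiffAt 𝓘(ℝ, P) 𝓘(ℝ, EG) n v p) :
    ContMDiffAt 𝓘(ℝ, P) 𝓘(ℝ, EG) n (fun q => u q * v q) p := by
  have : LieGroup 𝓘(ℝ, EG) n G := LieGroup.of_le (n := ∞) (by exact_mod_cast le_top)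
  exact hu.mul hv

theorem contMDiffAt_inv {n : ℕ∞} {u : P → G} {p : P}
    (hu : ContMDiffAt 𝓘(ℝ, P) 𝓘(ℝ, EG) n u p) :
    ContMDiffAt 𝓘(ℝ, P) 𝓘(ℝ, EG) n (fun q => (u q)⁻¹) p := by
  have : LieGroup 𝓘(ℝ, EG) n G := LieGroup.of_le (n := ∞) (by exact_mod_cast le_top)
  exact hu.inv

theorem contMDiff_conj (a : G) :
    ContMDiff 𝓘(ℝ, EG) 𝓘(ℝ, EG) ∞ (fun x : G => a * x * a⁻¹) :=
  (contMDiff_const.mul contMDiff_id).mul contMDiff_const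

/-- The map `u v (u p v p)⁻¹` is the product of `u (u p)⁻¹` and the conjugate by `u p` of `v (v
p)⁻¹`. Both factors are `1` at `p`, so `dOne_mul` applies. -/
theorem rlog_mul {u v : P → G} {p : P} (hu : ContMDiffAt 𝓘(ℝ, P) 𝓘(ℝ, EG) 1 u p)
    (hv : ContMDiffAt 𝓘(ℝ, P) 𝓘(ℝ, EG) 1 v p) :
    rlog (EG := EG) (fun q => u q * v q) p = rlog u p + lieAd EG (u p) ∘L rlog v p := by
  have h1 : (fun q => u q * v q * (u p * v p)⁻¹) = fun q => (u q * (u p)⁻¹) *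
      (u p * (v q * (v p)⁻¹) * (u p)⁻¹) := by
    ext q; group
  have hv' := contMDiffAt_mul (n := 1) hv (contMDiffAt_const (c := (v p)⁻¹))
  have hA := (contMDiff_conj (EG := EG) (u p)).contMDiffAt (x := 1).of_le
    (m := 1) (by exact_mod_cast le_top)
  unfold rlog
  rw [h1, dOne_mul (contMDiffAt_mul (n := 1) hu contMDiffAt_const) ?_ (by simp) (by simp),
    dOne_comp (k := fun q => v q * (v p)⁻¹) hA (by simp) hv' (by simp)]
  · rfl
  · exact contMDiffAt_mul (n := 1) (contMDiffAt_mul (n := 1) contMDiffAt_const hv')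
      contMDiffAt_const

theorem lieAd_mul (a b : G) : lieAd EG (a * b) = lieAd EG a ∘L lieAd EG b := by
  have h (a : G) := (contMDiff_conj (EG := EG) a).contMDiffAt (x := 1).of_le
    (m := 1) (by exact_mod_cast le_top)
  rw [lieAd, lieAd, lieAd, ← tanMap_comp (h a) (by simp) (h b) (by simp)]
  congr 1
  ext x; group

theorem lieAd_inv_apply (a : G) (v : EG) : lieAd EG a⁻¹ (lieAd EG a v) = v := by
  have := DFunLike.congr_fun (lieAd_mul (EG := EG) a⁻¹ a) v
  rw [inv_mul_cancel, lieAd_one] at this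
  exact this.symm

theorem lieAd_apply_inv (a : G) (v : EG) : lieAd EG a (lieAd EG a⁻¹ v) = v := by
  simpa using lieAd_inv_apply (EG := EG) a⁻¹ v

theorem rlog_inv {u : P → G} {p : P} (hu : ContMDiffAt 𝓘(ℝ, P) 𝓘(ℝ, EG) 1 u p) :
    rlog (EG := EG) (fun q => (u q)⁻¹) p = - (lieAd EG (u p)⁻¹ ∘L rlog u p) := by
  have h := rlog_mul (contMDiffAt_inv (n := 1) hu) hu
  simp only [inv_mul_cancel] at h
  rw [rlog_const] at h
  exact eq_neg_of_add_eq_zero_left h.symm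

/-- The chart is centred at `c p` while `rlog` at `q` refers to `c q`. Right translation by `b = c q
(c p)⁻¹` passes from one to the other, so the coordinate expression has zero derivative on a whole
ball. -/
theorem eventually_eq_of_rlog_eq_zero {c : P → G} {p : P}
    (hc : ∀ᶠ q in 𝓝 p, ContMDiffAt 𝓘(ℝ, P) 𝓘(ℝ, EG) 1 c q ∧ rlog (EG := EG) c q = 0) :
    ∀ᶠ q in 𝓝 p, c q = c p := by
  have hcp := contMDiffAt_mul (n := 1) hc.self_of_nhds.1 (contMDiffAt_const (c := (c p)⁻¹))
  have hsrc : ∀ᶠ q in 𝓝 p, c q * (c p)⁻¹ ∈ (unitChart EG G).source := by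
    refine hcp.continuousAt ?_
    rw [mul_inv_cancel]
    exact extChartAt_source_mem_nhds (I := 𝓘(ℝ, EG)) (1 : G)
  have hd : ∀ᶠ q in 𝓝 p, HasFDerivAt (fun q => unitChart EG G (c q * (c p)⁻¹)) (0 : P →L[ℝ] EG) q := by
    filter_upwards [hc, hsrc] with q hq hqs
    let b := c q * (c p)⁻¹
    have hk := contMDiffAt_mul (n := 1) hq.1 (contMDiffAt_const (c := (c q)⁻¹))
    have hmul : ContMDiffAt 𝓘(ℝ, EG) 𝓘(ℝ, EG) 1
        (fun x => (unitChart EG G).symm x * b) (unitChart EG G 1) :=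
      contMDiffAt_mul (n := 1) (contMDiffAt_unitChart_symm.of_le (by simp)) contMDiffAt_const
    have hψ : DifferentiableAt ℝ (fun x => unitChart EG G ((unitChart EG G).symm x * b))
        (unitChart EG G 1) := by
      rw [← mdifferentiableAt_iff_differentiableAt]
      refine MDifferentiableAt.comp (I' := 𝓘(ℝ, EG)) (unitChart EG G 1) (g := unitChart EG G) ?_
        (hmul.mdifferentiableAt (by simp))
      rw [unitChart_symm_one, one_mul]
      refine mdifferentiableAt_extChartAt (I := 𝓘(ℝ, EG)) ?_
      rw [← extChartAt_source 𝓘(ℝ, EG)]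
      exact hqs
    have := fderiv_comp_unitChart (ψ := fun g => unitChart EG G (g * b)) hψ hk (by simp)
    have h0 : dOne (EG := EG) (fun r => c r * (c q)⁻¹) q = 0 := hq.2
    rw [h0, ContinuousLinearMap.comp_zero] at this
    convert! this using 3
    simp [b]
  obtain ⟨ε, hε, hball⟩ := Metric.eventually_nhds_iff_ball.1 (hd.and hsrc)
  filter_upwards [Metric.ball_mem_nhds p hε] with q hq
  have := (convex_ball p ε).is_const_of_fderivWithin_eq_zero (𝕜 := ℝ)
    (f := fun q => unitChart EG G (c q * (c p)⁻¹))
    (fun x hx => (hball x hx).1.differentiableAt.differentiableWithinAt)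
    (fun x hx => by
      rw [fderivWithin_of_isOpen Metric.isOpen_ball hx]
      exact (hball x hx).1.fderiv) hq (Metric.mem_ball_self hε)
  have h2 := (unitChart EG G).injOn (hball q hq).2 (hball p (Metric.mem_ball_self hε)).2 this
  exact mul_inv_eq_one.1 (by simpa using h2)

/-- By the product rule `u⁻¹ v` has zero logarithmic derivative, hence is locally constant, hence
constant on the connected set. This one argument gives every uniqueness statement in `G` and `H`. -/
theorem eqOn_of_rlog_eq {J : Set P} (hJ : IsOpen J) (hJc : IsPreconnected J) {u v : P → G}
    (hu : ∀ p ∈ J, ContMDiffAt 𝓘(ℝ, P) 𝓘(ℝ, EG) 1 u p)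
    (hv : ∀ p ∈ J, ContMDiffAt 𝓘(ℝ, P) 𝓘(ℝ, EG) 1 v p)
    (h : ∀ p ∈ J, rlog (EG := EG) u p = rlog v p) {p₀ : P} (hp₀ : p₀ ∈ J) (h0 : u p₀ = v p₀)
    {p : P} (hp : p ∈ J) : u p = v p := by
  have key : (u p)⁻¹ * v p = (u p₀)⁻¹ * v p₀ := by
    refine hJc.induction₂ (fun x y => (u x)⁻¹ * v x = (u y)⁻¹ * v y) (fun x hx => ?_)
      (fun x y z _ _ _ h1 h2 => h1.trans h2) (fun x y _ _ h1 => h1.symm) hp hp₀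
    refine Filter.Eventually.filter_mono nhdsWithin_le_nhds ?_
    have := eventually_eq_of_rlog_eq_zero (EG := EG) (c := fun q => (u q)⁻¹ * v q) (p := x) (by
      filter_upwards [hJ.mem_nhds hx] with q hq
      refine ⟨contMDiffAt_mul (n := 1) (contMDiffAt_inv (n := 1) (hu q hq)) (hv q hq), ?_⟩
      rw [rlog_mul (contMDiffAt_inv (n := 1) (hu q hq)) (hv q hq), rlog_inv (hu q hq), h q hq,
        neg_add_cancel])
    filter_upwards [this] with y hy
    exact hy.symm
  rw [h0, inv_mul_cancel] at key
  exact (inv_mul_eq_one.1 key)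

end LogDeriv

/-! ### Local solutions of differential equations in a Lie group -/

section GroupODE

variable {Q : Type*} [NormedAddCommGroup Q] [NormedSpace ℝ Q]
  {EG : Type*} [NormedAddCommGroup EG] [NormedSpace ℝ EG]
  {G : Type*} [TopologicalSpace G] [ChartedSpace EG G] [Group G]

/-- `w` is smooth at `(q, s)` and solves `∂ₛw w⁻¹ = a` there. -/
def SolvesAt (a : Q × ℝ → EG) (w : Q × ℝ → G) (p : Q × ℝ) : Prop :=
  ContMDiffAt 𝓘(ℝ, Q × ℝ) 𝓘(ℝ, EG) ∞ w p ∧ rlog (fun r => w (p.1, r)) p.2 1 = a p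

theorem contDiff_smul_of_tsupport_subset {X F : Type*} [NormedAddCommGroup X] [NormedSpace ℝ X]
    [NormedAddCommGroup F] [NormedSpace ℝ F] {χ : X → ℝ} (hχ : ContDiff ℝ ∞ χ) {g : X → F}
    (hg : ∀ x ∈ tsupport χ, ContDiffAt ℝ ∞ g x) : ContDiff ℝ ∞ (fun x => χ x • g x) := by
  refine contDiff_iff_contDiffAt.2 fun x => ?_
  by_cases hx : x ∈ tsupport χ
  · exact hχ.contDiffAt.smul (hg x hx)
  · refine (contDiffAt_const (c := (0 : F))).congr_of_eventuallyEq ?_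
    filter_upwards [(isClosed_tsupport χ).isOpen_compl.mem_nhds hx] with y hy
    rw [image_eq_zero_of_notMem_tsupport hy, zero_smul]

variable (EG G) in
/-- The differential at the unit of the right translation by the element with coordinates `y`. -/
noncomputable def rightTransDeriv (y : EG) : EG →L[ℝ] EG :=
  fderiv ℝ (fun x => unitChart EG G ((unitChart EG G).symm x * (unitChart EG G).symm y))
    (unitChart EG G 1)

theorem rightTransDeriv_one :
    rightTransDeriv EG G (unitChart EG G 1) = ContinuousLinearMap.id ℝ EG := by
  rw [← dOne_unitChart_symm (EG := EG) (G := G), rightTransDeriv, unitChart_symm_one]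
  simp [dOne]

variable [LieGroup 𝓘(ℝ, EG) ∞ G]

/-- A right factor depending only on the parameters cancels in `∂ₛw w⁻¹`. It is the freedom used to
adjust initial values and to match local solutions. -/
theorem SolvesAt.mul_const {a : Q × ℝ → EG} {w : Q × ℝ → G} {p : Q × ℝ} (h : SolvesAt a w p)
    {c : Q → G} (hc : ContMDiffAt 𝓘(ℝ, Q) 𝓘(ℝ, EG) ∞ c p.1) :
    SolvesAt a (fun x => w x * c x.1) p := by
  refine ⟨contMDiffAt_mul (n := ⊤) h.1 (ContMDiffAt.comp (I' := 𝓘(ℝ, Q)) p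
    (f := fun x : Q × ℝ => x.1) hc contDiff_fst.contMDiff.contMDiffAt), ?_⟩
  exact (congrArg (fun L : ℝ →L[ℝ] EG => L 1)
    (rlog_mul_const (fun r => w (p.1, r)) (c p.1) p.2)).trans h.2

theorem contMDiffAt_unitChart_symm' {y : EG} (hy : y ∈ (unitChart EG G).target) :
    ContMDiffAt 𝓘(ℝ, EG) 𝓘(ℝ, EG) ∞ (unitChart EG G).symm y :=
  (contMDiffOn_extChartAt_symm (1 : G)).contMDiffAt ((isOpen_extChartAt_target _).mem_nhds hy)

theorem contDiffAt_unitChart_mul {y : EG} (hy : y ∈ (unitChart EG G).target) :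
    ContDiffAt ℝ ∞ (fun z : EG × EG =>
      unitChart EG G ((unitChart EG G).symm z.2 * (unitChart EG G).symm z.1))
      (y, unitChart EG G 1) := by
  rw [← contMDiffAt_iff_contDiffAt]
  have h1 : ContMDiffAt 𝓘(ℝ, EG × EG) 𝓘(ℝ, EG) ∞ (fun z : EG × EG =>
      (unitChart EG G).symm z.2 * (unitChart EG G).symm z.1) (y, unitChart EG G 1) :=
    contMDiffAt_mul (n := ⊤)
      (ContMDiffAt.comp (I' := 𝓘(ℝ, EG)) _ (g := (unitChart EG G).symm)
        contMDiffAt_unitChart_symm contDiff_snd.contMDiff.contMDiffAt)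
      (ContMDiffAt.comp (I' := 𝓘(ℝ, EG)) _ (g := (unitChart EG G).symm)
        (contMDiffAt_unitChart_symm' hy) contDiff_fst.contMDiff.contMDiffAt)
  refine ContMDiffAt.comp (I' := 𝓘(ℝ, EG)) _ (g := unitChart EG G) ?_ h1
  refine contMDiffAt_extChartAt' ?_
  rw [unitChart_symm_one, one_mul, ← extChartAt_source 𝓘(ℝ, EG)]
  exact (unitChart EG G).map_target hy

theorem contDiffAt_rightTransDeriv {y : EG} (hy : y ∈ (unitChart EG G).target) :
    ContDiffAt ℝ ∞ (rightTransDeriv EG G) y :=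
  ContDiffAt.fderiv (𝕜 := ℝ) (n := ∞) (g := fun _ => unitChart EG G 1)
    (f := fun y x => unitChart EG G ((unitChart EG G).symm x * (unitChart EG G).symm y))
    (contDiffAt_unitChart_mul hy) contDiffAt_const (by simp)

/-- Relation between the coordinate derivative and the right logarithmic derivative. -/
theorem fderiv_unitChart_eq_rightTransDeriv {P : Type*} [NormedAddCommGroup P] [NormedSpace ℝ P]
    {u : P → G} {p : P} (hu : ContMDiffAt 𝓘(ℝ, P) 𝓘(ℝ, EG) 1 u p)
    (hp : u p ∈ (unitChart EG G).source) :
    HasFDerivAt (fun q => unitChart EG G (u q))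
      (rightTransDeriv EG G (unitChart EG G (u p)) ∘L rlog u p) p := by
  have hk := contMDiffAt_mul (n := 1) hu (contMDiffAt_const (c := (u p)⁻¹))
  have ht := (unitChart EG G).map_source hp
  have hψ : DifferentiableAt ℝ (fun x => unitChart EG G ((unitChart EG G).symm x *
      (unitChart EG G).symm (unitChart EG G (u p)))) (unitChart EG G 1) :=
    ((contDiffAt_unitChart_mul ht).comp (unitChart EG G 1)
      (f := fun x => (unitChart EG G (u p), x))
      (contDiffAt_const.prodMk contDiffAt_id)).differentiableAt (by simp)
  have := fderiv_comp_unitChart (ψ := fun g => unitChart EG G (g *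
    (unitChart EG G).symm (unitChart EG G (u p)))) hψ hk (by simp)
  refine this.congr_of_eventuallyEq (Filter.Eventually.of_forall fun q => ?_)
  simp [(unitChart EG G).left_inv hp]

/-- In the chart the equation reads `y' = R_y (a (q, s))` with `R_y = rightTransDeriv EG G y`.
Adjoining `q` and `s` to the unknown makes it autonomous, and a bump function makes the field
compactly supported. -/
theorem exists_local_solution [FiniteDimensional ℝ Q] [FiniteDimensional ℝ EG]
    {a : Q × ℝ → EG} (ha : ContDiff ℝ ∞ a) (p₀ : Q × ℝ) :
    ∃ w : Q × ℝ → G, ∃ δ : ℝ, 0 < δ ∧ ∀ q s, ‖q - p₀.1‖ < δ → |s - p₀.2| < δ →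
      SolvesAt a w (q, s) := by
  set e := unitChart EG G 1 with he
  set x₀ : Q × ℝ × EG := (p₀.1, p₀.2, e) with hx₀
  -- Invertibility of `R_y` is included so that, at the end, it can be cancelled from the coordinate
  -- equation to recover the logarithmic derivative.
  let O : Set (Q × ℝ × EG) := {x | x.2.2 ∈ (unitChart EG G).target ∧
    (rightTransDeriv EG G x.2.2).IsInvertible}
  have hO : O ∈ 𝓝 x₀ := by
    have hc : ContinuousAt (fun x : Q × ℝ × EG => x.2.2) x₀ := by fun_prop
    have h1 : ∀ᶠ y in 𝓝 e, y ∈ (unitChart EG G).target :=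
      extChartAt_target_mem_nhds (I := 𝓘(ℝ, EG)) (1 : G)
    have h2 : ∀ᶠ y in 𝓝 e, (rightTransDeriv EG G y).IsInvertible := by
      have hct : ContinuousAt (rightTransDeriv EG G) e :=
        (contDiffAt_rightTransDeriv h1.self_of_nhds).continuousAt
      have := (ContinuousLinearEquiv.refl ℝ EG).nhds
      refine hct.eventually (p := fun T => T.IsInvertible) ?_
      rw [he, rightTransDeriv_one]
      filter_upwards [this] with T hT
      exact hT
    exact hc.eventually (h1.and h2)
  obtain ⟨R, hR, hRO⟩ := Metric.nhds_basis_closedBall.mem_iff.1 hO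
  let χ : ContDiffBump x₀ := ⟨R / 2, R, by positivity, by linarith⟩
  -- The suspended field: parameters stand still, time has unit speed.
  let g : Q × ℝ × EG → Q × ℝ × EG := fun x => (0, 1, rightTransDeriv EG G x.2.2 (a (x.1, x.2.1)))
  let v : Q × ℝ × EG → Q × ℝ × EG := fun x => χ x • g x
  have hsup : tsupport χ = Metric.closedBall x₀ R := χ.tsupport_eq
  have hv : ContDiff ℝ ∞ v := by
    refine contDiff_smul_of_tsupport_subset χ.contDiff fun x hx => ?_
    rw [hsup] at hx
    have h1 : ContDiffAt ℝ ∞ (fun x : Q × ℝ × EG => rightTransDeriv EG G x.2.2) x :=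
      ContDiffAt.comp x (f := fun x : Q × ℝ × EG => x.2.2)
        (contDiffAt_rightTransDeriv (hRO hx).1) (by fun_prop)
    have h2 : ContDiffAt ℝ ∞ (fun x : Q × ℝ × EG => a (x.1, x.2.1)) x :=
      ha.contDiffAt.comp x (by fun_prop)
    exact contDiffAt_const.prodMk (contDiffAt_const.prodMk (h1.clm_apply h2))
  have hvc : HasCompactSupport v := χ.hasCompactSupport.smul_right
  obtain ⟨Φ, δ, hδ, hΦ⟩ := exists_local_flow hv hvc x₀
  have hnear : ∀ᶠ p in 𝓝 ((0 : ℝ), x₀), Φ p ∈ Metric.closedBall x₀ (R / 2) := by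
    have h := hΦ 0 x₀ (by simpa using hδ) (by simpa using hδ)
    refine h.1.continuousAt (Metric.closedBall_mem_nhds_of_mem ?_)
    rw [h.2.1]
    exact Metric.mem_ball_self (by positivity)
  obtain ⟨η, hη, hball⟩ := Metric.eventually_nhds_iff_ball.1 hnear
  set ρ := min δ η with hρ
  have hρ0 : 0 < ρ := lt_min hδ hη
  have hloc : ∀ t q, |t| < ρ → ‖q - p₀.1‖ < ρ →
      ContDiffAt ℝ ∞ Φ (t, (q, p₀.2, e)) ∧ Φ (0, (q, p₀.2, e)) = (q, p₀.2, e) ∧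
      HasDerivAt (fun s => Φ (s, (q, p₀.2, e))) (g (Φ (t, (q, p₀.2, e)))) t ∧
      Φ (t, (q, p₀.2, e)) ∈ O := by
    intro t q ht hq
    have hx : ‖((q, p₀.2, e) : Q × ℝ × EG) - x₀‖ < ρ := by
      simp only [hx₀, Prod.mk_sub_mk, sub_self, Prod.norm_def, norm_zero]
      exact max_lt hq (by simpa using hρ0)
    obtain ⟨h1, h2, h3⟩ := hΦ t (q, p₀.2, e) (ht.trans_le (min_le_left _ _))
      (hx.trans_le (min_le_left _ _))
    have hb : Φ (t, (q, p₀.2, e)) ∈ Metric.closedBall x₀ (R / 2) := by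
      refine hball _ ?_
      rw [Metric.mem_ball, Prod.dist_eq, max_lt_iff, Real.dist_eq, sub_zero, dist_eq_norm]
      exact ⟨ht.trans_le (min_le_right _ _), hx.trans_le (min_le_right _ _)⟩
    refine ⟨h1, h2, ?_, hRO (Metric.closedBall_subset_closedBall (by linarith) hb)⟩
    have : v (Φ (t, (q, p₀.2, e))) = g (Φ (t, (q, p₀.2, e))) := by
      simp only [v]
      rw [χ.one_of_mem_closedBall hb, one_smul]
    rwa [← this]
  -- The first two components of the flow have derivatives `0` and `1`; hence the third is evaluated
  -- against `a` at the intended point `(q, p₀.2 + t)`.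
  have hconst : ∀ t q, |t| < ρ → ‖q - p₀.1‖ < ρ → (Φ (t, (q, p₀.2, e))).1 = q ∧
      (Φ (t, (q, p₀.2, e))).2.1 = p₀.2 + t := by
    intro t q ht hq
    have hmem : ∀ r, r ∈ Metric.ball (0 : ℝ) ρ ↔ |r| < ρ := fun r => by
      rw [Metric.mem_ball, Real.dist_eq, sub_zero]
    have h0 := (hloc 0 q (by simpa using hρ0) hq).2.1
    have hd1 : ∀ r ∈ Metric.ball (0 : ℝ) ρ,
        HasDerivAt (fun s => (Φ (s, (q, p₀.2, e))).1) 0 r := fun r hr => by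
      have := (hloc r q ((hmem r).1 hr) hq).2.2.1
      exact this.fst
    have hd2 : ∀ r ∈ Metric.ball (0 : ℝ) ρ,
        HasDerivAt (fun s => (Φ (s, (q, p₀.2, e))).2.1 - s) 0 r := fun r hr => by
      have h := (hloc r q ((hmem r).1 hr) hq).2.2.1
      have h' : HasDerivAt (fun s => (Φ (s, (q, p₀.2, e))).2.1) 1 r := h.snd.fst
      simpa only [sub_self] using h'.fun_sub (hasDerivAt_id' r)
    have hc := convex_ball (0 : ℝ) ρ
    have e1 := Metric.isOpen_ball.is_const_of_deriv_eq_zero hc.isPreconnected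
        (fun r hr => (hd1 r hr).differentiableAt.differentiableWithinAt)
        (fun r hr => (hd1 r hr).deriv) ((hmem t).2 ht) (Metric.mem_ball_self hρ0)
    have e2 := Metric.isOpen_ball.is_const_of_deriv_eq_zero hc.isPreconnected
        (fun r hr => (hd2 r hr).differentiableAt.differentiableWithinAt)
        (fun r hr => (hd2 r hr).deriv) ((hmem t).2 ht) (Metric.mem_ball_self hρ0)
    rw [h0] at e1 e2
    exact ⟨e1, by simpa [sub_eq_iff_eq_add] using e2⟩
  let y : Q × ℝ → EG := fun p => (Φ (p.2 - p₀.2, (p.1, p₀.2, e))).2.2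
  refine ⟨fun p => (unitChart EG G).symm (y p), ρ, hρ0, fun q s hq hs => ?_⟩
  obtain ⟨h1, h2, h3, h4⟩ := hloc (s - p₀.2) q hs hq
  have hy : ContDiffAt ℝ ∞ y (q, s) := by
    have : ContDiffAt ℝ ∞ (fun p : Q × ℝ => Φ (p.2 - p₀.2, (p.1, p₀.2, e))) (q, s) :=
      ContDiffAt.comp (q, s) (g := Φ) (f := fun p : Q × ℝ => (p.2 - p₀.2, (p.1, p₀.2, e))) h1
        (by fun_prop)
    exact this.snd.snd
  have hw : ContMDiffAt 𝓘(ℝ, Q × ℝ) 𝓘(ℝ, EG) ∞ (fun p => (unitChart EG G).symm (y p)) (q, s) :=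
    ContMDiffAt.comp (I' := 𝓘(ℝ, EG)) (q, s) (g := (unitChart EG G).symm)
      (contMDiffAt_unitChart_symm' h4.1) hy.contMDiffAt
  refine ⟨hw, ?_⟩
  have hws : ContMDiffAt 𝓘(ℝ, ℝ) 𝓘(ℝ, EG) 1 (fun r => (unitChart EG G).symm (y (q, r))) s :=
    (ContMDiffAt.comp (I' := 𝓘(ℝ, Q × ℝ)) s (f := fun r : ℝ => (q, r)) hw
      (contDiff_prodMk_right q).contMDiff.contMDiffAt).of_le (by simp)
  have hD := fderiv_unitChart_eq_rightTransDeriv hws ((unitChart EG G).map_target h4.1)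
  have hD2 : HasDerivAt (fun r => y (q, r)) (rightTransDeriv EG G (y (q, s)) (a (q, s))) s := by
    have h5 := h3.comp_sub_const s p₀.2
    have := h5.snd.snd
    obtain ⟨c1, c2⟩ := hconst (s - p₀.2) q hs hq
    simp only [g, c1, c2, add_sub_cancel] at this
    exact this
  have heq : (fun r => unitChart EG G ((unitChart EG G).symm (y (q, r)))) =ᶠ[𝓝 s]
      fun r => y (q, r) := by
    have : ∀ᶠ r in 𝓝 s, y (q, r) ∈ (unitChart EG G).target :=
      hD2.continuousAt ((isOpen_extChartAt_target (I := 𝓘(ℝ, EG)) (1 : G)).mem_nhds h4.1)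
    filter_upwards [this] with r hr
    exact (unitChart EG G).right_inv hr
  have hD3 := (hD.congr_of_eventuallyEq heq.symm).hasDerivAt.unique hD2
  have hys := heq.self_of_nhds
  simp only at hys
  rw [hys] at hD3
  obtain ⟨f, hf⟩ := h4.2
  refine f.injective ?_
  have hf' : ∀ x, f x = rightTransDeriv EG G (y (q, s)) x := fun x => by
    rw [← ContinuousLinearEquiv.coe_coe, hf]
  rw [hf', hf']
  exact hD3

end GroupODE

/-! ### Global solutions with smooth dependence on parameters -/

section GlobalODE

variable {Q : Type*} [NormedAddCommGroup Q] [NormedSpace ℝ Q]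
  {EG : Type*} [NormedAddCommGroup EG] [NormedSpace ℝ EG]
  {G : Type*} [TopologicalSpace G] [ChartedSpace EG G] [Group G]

theorem SolvesAt.congr {a : Q × ℝ → EG} {w w' : Q × ℝ → G} {p : Q × ℝ} (h : SolvesAt a w p)
    (hw : w' =ᶠ[𝓝 p] w) : SolvesAt a w' p := by
  refine ⟨h.1.congr_of_eventuallyEq hw, ?_⟩
  have h1 : Filter.Tendsto (fun r => (p.1, r)) (𝓝 p.2) (𝓝 p) :=
    (Continuous.prodMk_right p.1).continuousAt
  rw [← h.2]
  exact congrArg (fun L : ℝ →L[ℝ] EG => L 1) (Filter.EventuallyEq.rlog (h1.eventually hw))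

theorem SolvesAt.contMDiffAt_right {a : Q × ℝ → EG} {w : Q × ℝ → G} {q : Q} {s : ℝ}
    (h : SolvesAt a w (q, s)) : ContMDiffAt 𝓘(ℝ, ℝ) 𝓘(ℝ, EG) 1 (fun r => w (q, r)) s :=
  (ContMDiffAt.comp (I' := 𝓘(ℝ, Q × ℝ)) s (f := fun r : ℝ => (q, r)) h.1
    (contDiff_prodMk_right q).contMDiff.contMDiffAt).of_le (by simp)

theorem SolvesAt.contMDiffAt_left {a : Q × ℝ → EG} {w : Q × ℝ → G} {q : Q} {s : ℝ}
    (h : SolvesAt a w (q, s)) : ContMDiffAt 𝓘(ℝ, Q) 𝓘(ℝ, EG) ∞ (fun r => w (r, s)) q :=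
  ContMDiffAt.comp (I' := 𝓘(ℝ, Q × ℝ)) q (f := fun r : Q => (r, s)) h.1
    (contDiff_prodMk_left s).contMDiff.contMDiffAt

variable [LieGroup 𝓘(ℝ, EG) ∞ G]

theorem SolvesAt.eqOn {a : Q × ℝ → EG} {u v : Q × ℝ → G} {q : Q} {J : Set ℝ} (hJ : IsOpen J)
    (hJc : IsPreconnected J) (hu : ∀ s ∈ J, SolvesAt a u (q, s))
    (hv : ∀ s ∈ J, SolvesAt a v (q, s)) {s₀ : ℝ} (hs₀ : s₀ ∈ J) (h0 : u (q, s₀) = v (q, s₀))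
    {s : ℝ} (hs : s ∈ J) : u (q, s) = v (q, s) := by
  refine eqOn_of_rlog_eq (EG := EG) (u := fun r => u (q, r)) (v := fun r => v (q, r)) hJ hJc
    (fun r hr => (hu r hr).contMDiffAt_right) (fun r hr => (hv r hr).contMDiffAt_right)
    (fun r hr => ?_) hs₀ h0 hs
  ext
  exact (hu r hr).2.trans (hv r hr).2.symm

/-- The set of times reachable from `s₀`, over some ball of parameters, is open and closed in `ℝ`.
No blow-up can occur, since a local solution exists around each time and a right translation joins
it to a given solution. -/
theorem exists_semilocal_solution [FiniteDimensional ℝ Q] [FiniteDimensional ℝ EG]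
    {a : Q × ℝ → EG} (ha : ContDiff ℝ ∞ a) (q₀ : Q) (s₀ s₁ : ℝ) :
    ∃ ε > 0, ∃ J : Set ℝ, IsOpen J ∧ IsPreconnected J ∧ s₀ ∈ J ∧ s₁ ∈ J ∧ ∃ u : Q × ℝ → G,
      ∀ q ∈ Metric.ball q₀ ε, u (q, s₀) = 1 ∧ ∀ s ∈ J, SolvesAt a u (q, s) := by
  let S : Set ℝ := {s₁ | ∃ ε > 0, ∃ J : Set ℝ, IsOpen J ∧ IsPreconnected J ∧ s₀ ∈ J ∧ s₁ ∈ J ∧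
    ∃ u : Q × ℝ → G, ∀ q ∈ Metric.ball q₀ ε, u (q, s₀) = 1 ∧ ∀ s ∈ J, SolvesAt a u (q, s)}
  have hopen : IsOpen S := by
    refine isOpen_iff_mem_nhds.2 fun s hs => ?_
    obtain ⟨ε, hε, J, hJ, hJc, h0, h1, u, hu⟩ := hs
    filter_upwards [hJ.mem_nhds h1] with r hr
    exact ⟨ε, hε, J, hJ, hJc, h0, hr, u, hu⟩
  have hlocal : ∀ s₁ : ℝ, ∃ w : Q × ℝ → G, ∃ δ > 0, ∀ q ∈ Metric.ball q₀ δ,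
      ∀ s ∈ Metric.ball s₁ δ, SolvesAt a w (q, s) := by
    intro s₁
    obtain ⟨w, δ, hδ, hw⟩ := exists_local_solution (G := G) ha (q₀, s₁)
    refine ⟨w, δ, hδ, fun q hq s hs => hw q s ?_ ?_⟩
    · rwa [mem_ball_iff_norm] at hq
    · rwa [Metric.mem_ball, Real.dist_eq] at hs
  have hne : s₀ ∈ S := by
    obtain ⟨w, δ, hδ, hw⟩ := hlocal s₀
    refine ⟨δ, hδ, Metric.ball s₀ δ, Metric.isOpen_ball, (convex_ball _ _).isPreconnected,
      Metric.mem_ball_self hδ, Metric.mem_ball_self hδ, fun p => w p * (w (p.1, s₀))⁻¹,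
      fun q hq => ⟨by simp, fun s hs => ?_⟩⟩
    exact (hw q hq s hs).mul_const (c := fun q => (w (q, s₀))⁻¹)
      (contMDiffAt_inv (n := ⊤) (hw q hq s₀ (Metric.mem_ball_self hδ)).contMDiffAt_left)
  have hclosed : IsClosed S := by
    refine isClosed_of_closure_subset fun t ht => ?_
    obtain ⟨w, δ, hδ, hw⟩ := hlocal t
    obtain ⟨s₂, hs₂, hs₂t⟩ := mem_closure_iff.1 ht (Metric.ball t δ) Metric.isOpen_ball
      (Metric.mem_ball_self hδ)
    obtain ⟨ε, hε, J, hJ, hJc, h0, h1, u, hu⟩ := hs₂t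
    have hbc : IsPreconnected (Metric.ball t δ) := (convex_ball t δ).isPreconnected
    -- The translation, smooth in `q`, makes the local solution around `t` agree with `u` at `s₂`.
    -- Uniqueness on the interval `J ∩ ball t δ` then makes the two pieces glue, over the smaller of
    -- the two parameter balls.
    let w' : Q × ℝ → G := fun p => w p * ((w (p.1, s₂))⁻¹ * u (p.1, s₂))
    have hw' : ∀ q ∈ Metric.ball q₀ (min ε δ), ∀ s ∈ Metric.ball t δ, SolvesAt a w' (q, s) := by
      intro q hq s hs
      have hqε := Metric.ball_subset_ball (min_le_left ε δ) hq
      have hqδ := Metric.ball_subset_ball (min_le_right ε δ) hq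
      exact (hw q hqδ s hs).mul_const (c := fun q => (w (q, s₂))⁻¹ * u (q, s₂))
        (contMDiffAt_mul (n := ⊤)
          (contMDiffAt_inv (n := ⊤) (hw q hqδ s₂ hs₂).contMDiffAt_left)
          ((hu q hqε).2 s₂ h1).contMDiffAt_left)
    have hagree : ∀ q ∈ Metric.ball q₀ (min ε δ), ∀ s ∈ J ∩ Metric.ball t δ,
        u (q, s) = w' (q, s) := by
      intro q hq s hs
      have hqε := Metric.ball_subset_ball (min_le_left ε δ) hq
      refine SolvesAt.eqOn (a := a) (hJ.inter Metric.isOpen_ball)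
        (hJc.ordConnected.inter hbc.ordConnected).isPreconnected
        (fun s hs => (hu q hqε).2 s hs.1) (fun s hs => hw' q hq s hs.2) ⟨h1, hs₂⟩ ?_ hs
      simp [w']
    classical
    let v : Q × ℝ → G := fun p => if p.2 ∈ J then u p else w' p
    refine ⟨min ε δ, lt_min hε hδ, J ∪ Metric.ball t δ, hJ.union Metric.isOpen_ball,
      hJc.union s₂ h1 hs₂ hbc, Or.inl h0, Or.inr (Metric.mem_ball_self hδ), v, fun q hq => ?_⟩
    have hqε := Metric.ball_subset_ball (min_le_left ε δ) hq
    refine ⟨by simp only [v, if_pos h0]; exact (hu q hqε).1, fun s hs => ?_⟩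
    by_cases hsJ : s ∈ J
    · refine ((hu q hqε).2 s hsJ).congr ?_
      filter_upwards [continuousAt_snd.preimage_mem_nhds (hJ.mem_nhds hsJ)] with p hp
      exact if_pos hp
    · have hsb : s ∈ Metric.ball t δ := hs.resolve_left hsJ
      refine (hw' q hq s hsb).congr ?_
      filter_upwards [prod_mem_nhds (Metric.isOpen_ball.mem_nhds hq)
        (Metric.isOpen_ball.mem_nhds hsb)] with p hp
      by_cases hpJ : p.2 ∈ J
      · simp only [v, if_pos hpJ]
        exact hagree p.1 hp.1 p.2 ⟨hpJ, hp.2⟩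
      · simp only [v, if_neg hpJ]
  have huniv : S = Set.univ := IsClopen.eq_univ ⟨hclosed, hopen⟩ ⟨s₀, hne⟩
  have : s₁ ∈ S := huniv ▸ Set.mem_univ s₁
  exact this

/-- Existence of parallel transport depending smoothly on parameters. -/
theorem exists_solution [FiniteDimensional ℝ Q] [FiniteDimensional ℝ EG]
    {a : Q × ℝ → EG} (ha : ContDiff ℝ ∞ a) (s₀ : ℝ) :
    ∃ u : Q × ℝ → G, ContMDiff 𝓘(ℝ, Q × ℝ) 𝓘(ℝ, EG) ∞ u ∧ (∀ q, u (q, s₀) = 1) ∧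
      ∀ p, SolvesAt a u p := by
  choose ε hε J hJ hJc h0 h1 u hu using
    fun p : Q × ℝ => exists_semilocal_solution (G := G) ha p.1 s₀ p.2
  -- Each point uses the solution chosen for it. Near `p` the choices coincide with the single
  -- solution `u p`, as both start from `1` at `s₀` and `J x ∩ J p` is an interval.
  let U : Q × ℝ → G := fun p => u p p
  have key : ∀ p, SolvesAt a U p := by
    intro p
    refine ((hu p p.1 (Metric.mem_ball_self (hε p))).2 p.2 (h1 p)).congr ?_
    filter_upwards [prod_mem_nhds (Metric.ball_mem_nhds p.1 (hε p)) ((hJ p).mem_nhds (h1 p))]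
      with x hx
    have hx1 := Metric.mem_ball_self (x := x.1) (hε x)
    refine SolvesAt.eqOn (a := a) (q := x.1) (J := J x ∩ J p) ((hJ x).inter (hJ p))
      ((hJc x).ordConnected.inter (hJc p).ordConnected).isPreconnected
      (fun s hs => (hu x x.1 hx1).2 s hs.1) (fun s hs => (hu p x.1 hx.1).2 s hs.2)
      ⟨h0 x, h0 p⟩ ?_ ⟨h1 x, hx.2⟩
    rw [(hu x x.1 hx1).1, (hu p x.1 hx.1).1]
  refine ⟨U, fun p => (key p).1, fun q => ?_, key⟩
  exact (hu (q, s₀) q (Metric.mem_ball_self (hε _))).1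

end GlobalODE

/-! ### Integrals and primitives depending on parameters -/

section ParametricIntegral

open MeasureTheory

theorem hasFDerivAt_integral_param {P F : Type*} [NormedAddCommGroup P] [NormedSpace ℝ P]
    [FiniteDimensional ℝ P] [NormedAddCommGroup F] [NormedSpace ℝ F]
    {g : P × ℝ → F} (hg : ContDiff ℝ 1 g) (p : P) :
    HasFDerivAt (fun p => ∫ t in (0 : ℝ)..1, g (p, t))
      (∫ t in (0 : ℝ)..1, fderiv ℝ g (p, t) ∘L .inl ℝ P ℝ) p := by
  have hfd : Continuous (fun x => fderiv ℝ g x ∘L .inl ℝ P ℝ) :=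
    (hg.continuous_fderiv (by simp)).clm_comp continuous_const
  have := FiniteDimensional.proper_real P
  obtain ⟨c, hc⟩ := ((isCompact_closedBall p 1).prod
    (isCompact_Icc (a := (0 : ℝ)) (b := 1))).exists_bound_of_continuousOn hfd.continuousOn
  have hcont : ∀ p, Continuous (fun t => g (p, t)) := fun p =>
    hg.continuous.comp (Continuous.prodMk_right p)
  refine intervalIntegral.hasFDerivAt_integral_of_dominated_of_fderiv_le (bound := fun _ => c)
    (F' := fun p t => fderiv ℝ g (p, t) ∘L .inl ℝ P ℝ)
    (Metric.closedBall_mem_nhds p one_pos)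
    (Filter.Eventually.of_forall fun p => (hcont p).aestronglyMeasurable)
    ((hcont p).intervalIntegrable _ _)
    (hfd.comp (Continuous.prodMk_right p)).aestronglyMeasurable
    (Filter.Eventually.of_forall fun t ht x hx => ?_)
    intervalIntegrable_const (Filter.Eventually.of_forall fun t ht x hx => ?_)
  · rw [Set.uIoc_of_le zero_le_one] at ht
    exact hc (x, t) ⟨hx, ht.1.le, ht.2⟩
  · exact ((hg.differentiable (by simp)) (x, t)).hasFDerivAt.comp x
      (hasFDerivAt_prodMk_left x t)

/-- Differentiation under the integral sign gives directional derivatives that are integrals of the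
same shape with values in the same `F`. The induction therefore proceeds direction by direction,
which suffices in finite dimension. -/
theorem contDiff_integral_param {P F : Type*} [NormedAddCommGroup P] [NormedSpace ℝ P]
    [FiniteDimensional ℝ P] [NormedAddCommGroup F] [NormedSpace ℝ F] (n : ℕ) :
    ∀ {g : P × ℝ → F}, ContDiff ℝ ∞ g → ContDiff ℝ n (fun p => ∫ t in (0 : ℝ)..1, g (p, t)) := by
  induction n with
  | zero =>
    intro g hg
    rw [Nat.cast_zero, contDiff_zero]
    exact continuous_iff_continuousAt.2 fun p =>
      (hasFDerivAt_integral_param (hg.of_le (by simp)) p).continuousAt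
  | succ n ih =>
    intro g hg
    have hd := hasFDerivAt_integral_param (g := g) (hg.of_le (by simp))
    rw [Nat.cast_succ, contDiff_succ_iff_fderiv_apply]
    refine ⟨fun p => (hd p).differentiableAt, by simp, fun y => ?_⟩
    have h1 : ContDiff ℝ ∞ (fun x : P × ℝ => fderiv ℝ g x (y, 0)) :=
      (hg.fderiv_right (m := ∞) (by simp)).clm_apply contDiff_const
    convert ih h1 using 2 with p
    rw [(hd p).fderiv, ContinuousLinearMap.intervalIntegral_apply]
    · simp
    · have hfd : Continuous (fun x => fderiv ℝ g x ∘L .inl ℝ P ℝ) :=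
        (hg.continuous_fderiv (by simp)).clm_comp continuous_const
      exact (hfd.comp (Continuous.prodMk_right p)).intervalIntegrable _ _

/-- A primitive depending smoothly on parameters. -/
theorem exists_smooth_primitive {P F : Type*} [NormedAddCommGroup P] [NormedSpace ℝ P]
    [FiniteDimensional ℝ P] [NormedAddCommGroup F] [NormedSpace ℝ F] [CompleteSpace F]
    {g : P × ℝ → F} (hg : ContDiff ℝ ∞ g) (x₀ : ℝ) :
    ∃ w : P × ℝ → F, ContDiff ℝ ∞ w ∧ (∀ p, w (p, x₀) = 0) ∧
      ∀ p x, HasDerivAt (fun s => w (p, s)) (g (p, x)) x := by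
  -- An affine substitution moves the variable endpoint into the integrand, so the primitive is an
  -- integral over `[0, 1]` with parameters `(p, x)`.
  have key : ∀ p x, (x - x₀) • ∫ t in (0 : ℝ)..1, g (p, t * (x - x₀) + x₀) =
      ∫ s in x₀..x, g (p, s) := fun p x => by
    have := intervalIntegral.smul_integral_comp_mul_add (a := 0) (b := 1)
      (fun s => g (p, s)) (x - x₀) x₀
    simpa [mul_comm] using this
  refine ⟨fun q => (q.2 - x₀) • ∫ t in (0 : ℝ)..1, g (q.1, t * (q.2 - x₀) + x₀), ?_, ?_, ?_⟩
  · have h1 : ContDiff ℝ ∞ (fun r : (P × ℝ) × ℝ => g (r.1.1, r.2 * (r.1.2 - x₀) + x₀)) :=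
      hg.comp (by fun_prop)
    have h2 := contDiff_infty.2 fun n => contDiff_integral_param n h1
    exact ContDiff.smul (by fun_prop) h2
  · simp
  · intro p x
    simp only [key]
    have hc : Continuous (fun s => g (p, s)) := hg.continuous.comp (Continuous.prodMk_right p)
    exact intervalIntegral.integral_hasDerivAt_right (hc.intervalIntegrable _ _)
      (hc.stronglyMeasurableAtFilter _ _) hc.continuousAt

end ParametricIntegral

/-! ### Smooth dependence of logarithmic derivatives and of `ṁ` -/

section SmoothDependence

variable {P : Type*} [NormedAddCommGroup P] [NormedSpace ℝ P]
  {EG : Type*} [NormedAddCommGroup EG] [NormedSpace ℝ EG]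
  {G : Type*} [TopologicalSpace G] [ChartedSpace EG G] [Group G]
  {EH : Type*} [NormedAddCommGroup EH] [NormedSpace ℝ EH]
  {H : Type*} [TopologicalSpace H] [ChartedSpace EH H] [Group H]

theorem rightLogDeriv_eq_rlog [LieGroup 𝓘(ℝ, EG) ∞ G] {u : ℝ → G} {x : ℝ}
    (hu : ContMDiffAt 𝓘(ℝ, ℝ) 𝓘(ℝ, EG) 1 u x) :
    (rightLogDeriv (EG := EG) u x) = rlog u x 1 :=
  mfderiv_eq_dOne ((contMDiffAt_mul (n := 1) hu contMDiffAt_const).mdifferentiableAt (by simp))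
    (by simp) 1

/-- The product of `(u x)⁻¹ u s` and `(u s)⁻¹ u x` is constantly `1`, so their differentials cancel.
The left equation for `Ψ` thereby becomes a right equation for `Ψ⁻¹`. -/
theorem leftLogDeriv_eq_rlog [LieGroup 𝓘(ℝ, EG) ∞ G] {u : ℝ → G} {x : ℝ}
    (hu : ContMDiffAt 𝓘(ℝ, ℝ) 𝓘(ℝ, EG) 1 u x) :
    (leftLogDeriv (EG := EG) u x) = - rlog (fun s => (u s)⁻¹) x 1 := by
  have h1 := contMDiffAt_mul (n := 1) (contMDiffAt_const (c := (u x)⁻¹)) hu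
  have h2 := contMDiffAt_mul (n := 1) (contMDiffAt_inv (n := 1) hu)
    (contMDiffAt_const (c := ((u x)⁻¹)⁻¹))
  have h3 : leftLogDeriv (EG := EG) u x = dOne (EG := EG) (fun s => (u x)⁻¹ * u s) x 1 :=
    mfderiv_eq_dOne (h1.mdifferentiableAt (by simp)) (by simp) 1
  have h4 := dOne_mul (EG := EG) h1 h2 (by simp) (by simp)
  have h5 : (fun q => (u x)⁻¹ * u q * ((u q)⁻¹ * ((u x)⁻¹)⁻¹)) = fun _ : ℝ => (1 : G) := by
    ext q; group
  rw [h5, dOne_const] at h4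
  rw [h3, rlog, eq_neg_of_add_eq_zero_left h4.symm]
  rfl

/-- `rlog u p` is the partial derivative in `q`, on the diagonal, of the chart expression of `u q (u
p)⁻¹`, which is jointly smooth in `(p, q)`. -/
theorem contDiffAt_rlog [LieGroup 𝓘(ℝ, EG) ∞ G] {u : P → G} {p : P}
    (hu : ContMDiffAt 𝓘(ℝ, P) 𝓘(ℝ, EG) ∞ u p) : ContDiffAt ℝ ∞ (rlog (EG := EG) u) p := by
  refine ContDiffAt.fderiv (𝕜 := ℝ) (n := ∞) (g := fun q => q)
    (f := fun p q => unitChart EG G (u q * (u p)⁻¹)) ?_ contDiffAt_id (by simp)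
  refine ContMDiffAt.unitChart (n := ⊤) (k := fun x : P × P => u x.2 * (u x.1)⁻¹) ?_ (by simp)
  exact contMDiffAt_mul (n := ⊤)
    (ContMDiffAt.comp (I' := 𝓘(ℝ, P)) (p, p) (f := fun x : P × P => x.2) hu
      contDiff_snd.contMDiff.contMDiffAt)
    (contMDiffAt_inv (n := ⊤) (ContMDiffAt.comp (I' := 𝓘(ℝ, P)) (p, p) (f := fun x : P × P => x.1)
      hu contDiff_fst.contMDiff.contMDiffAt))

theorem contDiffAt_tanMap {X : Type*} [TopologicalSpace X] [ChartedSpace EG X]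
    [LieGroup 𝓘(ℝ, EH) ∞ H] {Ψ : X × H → H}
    (hΨ : ContMDiff (𝓘(ℝ, EG).prod 𝓘(ℝ, EH)) 𝓘(ℝ, EH) ∞ Ψ) (h1 : ∀ a, Ψ (a, 1) = 1)
    {u : P → X} {p : P} (hu : ContMDiffAt 𝓘(ℝ, P) 𝓘(ℝ, EG) ∞ u p) :
    ContDiffAt ℝ ∞ (fun q => tanMap (EG := EH) (EH := EH) (fun B => Ψ (u q, B))) p := by
  refine ContDiffAt.fderiv (𝕜 := ℝ) (n := ∞) (g := fun _ => unitChart EH H 1)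
    (f := fun q x => unitChart EH H (Ψ (u q, (unitChart EH H).symm x))) ?_ contDiffAt_const
    (by simp)
  refine ContMDiffAt.unitChart (n := ⊤)
    (k := fun x : P × EH => Ψ (u x.1, (unitChart EH H).symm x.2)) ?_
    (by simp only; rw [unitChart_symm_one, h1])
  refine hΨ.contMDiffAt.comp (p, unitChart EH H 1) (ContMDiffAt.prodMk ?_ ?_)
  · exact ContMDiffAt.comp (I' := 𝓘(ℝ, P)) _ (f := fun x : P × EH => x.1) hu
      contDiff_fst.contMDiff.contMDiffAt
  · exact ContMDiffAt.comp (I' := 𝓘(ℝ, EH)) _ (f := fun x : P × EH => x.2)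
      contMDiffAt_unitChart_symm contDiff_snd.contMDiff.contMDiffAt

variable (C : LieCrossedModule EG G EH H)

/-- `ṁ(a)` as a continuous linear map. -/
noncomputable def LieCrossedModule.mDotL (C : LieCrossedModule EG G EH H) (a : G) : EH →L[ℝ] EH :=
  tanMap (fun B => C.m a B)

theorem LieCrossedModule.contMDiff_m (a : G) :
    ContMDiff 𝓘(ℝ, EH) 𝓘(ℝ, EH) ∞ (fun B => C.m a B) :=
  C.smooth_m.comp (contMDiff_const.prodMk contMDiff_id)

theorem LieCrossedModule.mDot_eq (a : G) (v : EH) : C.mDot a v = C.mDotL a v :=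
  mfderiv_eq_tanMap ((C.contMDiff_m a).contMDiffAt.mdifferentiableAt (by simp)) (map_one _) v

theorem LieCrossedModule.contDiffAt_mDotL [LieGroup 𝓘(ℝ, EH) ∞ H] {u : P → G} {p : P}
    (hu : ContMDiffAt 𝓘(ℝ, P) 𝓘(ℝ, EG) ∞ u p) : ContDiffAt ℝ ∞ (fun q => C.mDotL (u q)) p :=
  contDiffAt_tanMap C.smooth_m (fun a => map_one (C.m a)) hu

end SmoothDependence

/-! ### Existence, uniqueness and parameters for `f`, `g`, `W`, `Ψ` -/

section Cocycles

variable {P : Type*} [NormedAddCommGroup P] [NormedSpace ℝ P]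
  {P' : Type*} [NormedAddCommGroup P'] [NormedSpace ℝ P']
  {EG : Type*} [NormedAddCommGroup EG] [NormedSpace ℝ EG]
  {G : Type*} [TopologicalSpace G] [ChartedSpace EG G] [Group G]
  {EH : Type*} [NormedAddCommGroup EH] [NormedSpace ℝ EH]
  {H : Type*} [TopologicalSpace H] [ChartedSpace EH H] [Group H]

theorem _root_.ContMDiff.comp_contDiff {X : Type*} [TopologicalSpace X] [ChartedSpace EG X] {u : P → X}
    (hu : ContMDiff 𝓘(ℝ, P) 𝓘(ℝ, EG) ∞ u) {f : P' → P} (hf : ContDiff ℝ ∞ f) :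
    ContMDiff 𝓘(ℝ, P') 𝓘(ℝ, EG) ∞ (fun x => u (f x)) :=
  hu.comp hf.contMDiff

variable [LieGroup 𝓘(ℝ, EG) ∞ G] [LieGroup 𝓘(ℝ, EH) ∞ H]

theorem rlog_comp {u : P → G} {f : P' → P} {f' : P' →L[ℝ] P} {p : P'}
    (hu : ContMDiffAt 𝓘(ℝ, P) 𝓘(ℝ, EG) 1 u (f p)) (hf : HasFDerivAt f f' p) :
    rlog (EG := EG) (fun q => u (f q)) p = rlog u (f p) ∘L f' :=
  (HasFDerivAt.comp p (differentiableAt_unitChart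
    (contMDiffAt_mul (n := 1) hu (contMDiffAt_const (c := (u (f p))⁻¹))) (by simp)).hasFDerivAt
      hf).fderiv

theorem rlog_fst {u : ℝ × ℝ → G} {x y : ℝ} (hu : ContMDiffAt 𝓘(ℝ, ℝ × ℝ) 𝓘(ℝ, EG) ∞ u (x, y)) :
    rlog (EG := EG) (fun s => u (s, y)) x 1 = rlog u (x, y) (1, 0) := by
  rw [rlog_comp (f := fun s => (s, y)) (hu.of_le (by simp)) (hasFDerivAt_prodMk_left x y)]
  rfl

theorem rlog_snd {u : ℝ × ℝ → G} {x y : ℝ} (hu : ContMDiffAt 𝓘(ℝ, ℝ × ℝ) 𝓘(ℝ, EG) ∞ u (x, y)) :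
    rlog (EG := EG) (fun s => u (x, s)) y 1 = rlog u (x, y) (0, 1) := by
  rw [rlog_comp (f := fun s => (x, s)) (hu.of_le (by simp)) (hasFDerivAt_prodMk_right x y)]
  rfl

theorem eq_of_rlog_eq {u v : ℝ → G} (hu : ContMDiff 𝓘(ℝ, ℝ) 𝓘(ℝ, EG) ∞ u)
    (hv : ContMDiff 𝓘(ℝ, ℝ) 𝓘(ℝ, EG) ∞ v) (h : ∀ s, rlog (EG := EG) u s 1 = rlog v s 1) {s₀ : ℝ}
    (h0 : u s₀ = v s₀) (s : ℝ) : u s = v s :=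
  eqOn_of_rlog_eq (EG := EG) isOpen_univ isPreconnected_univ
    (fun s _ => (hu s).of_le (by simp)) (fun s _ => (hv s).of_le (by simp))
    (fun s _ => by ext; exact h s) (Set.mem_univ s₀) h0 (Set.mem_univ s)

/-! ### The component `f` -/

theorem IsSolF.rlog_eq {ax : ℝ × ℝ → EG} {x₀ : ℝ} {u : ℝ × ℝ → G} (h : IsSolF ax x₀ u)
    (q : ℝ × ℝ) : rlog u q (1, 0) = -ax q := by
  rw [← h.2.2 q.1 q.2, rightLogDeriv_eq_rlog, rlog_fst (h.1 _)]
  exact ((h.1.comp_contDiff (contDiff_prodMk_left q.2)) q.1).of_le (by simp)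

theorem IsSolF.unique {ax : ℝ × ℝ → EG} {x₀ : ℝ} {u v : ℝ × ℝ → G} (hu : IsSolF ax x₀ u)
    (hv : IsSolF ax x₀ v) : u = v := by
  ext ⟨x, y⟩
  refine eq_of_rlog_eq (EG := EG) (u := fun s => u (s, y)) (v := fun s => v (s, y))
    (hu.1.comp_contDiff (contDiff_prodMk_left y)) (hv.1.comp_contDiff (contDiff_prodMk_left y))
    (fun s => ?_) (s₀ := x₀) (by rw [hu.2.1, hv.2.1]) x
  rw [rlog_fst (hu.1 _), rlog_fst (hv.1 _), hu.rlog_eq, hv.rlog_eq]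

/-- `Classical.epsilon` returns some solution as soon as there is one, and solutions are unique; any
solution at hand therefore computes the cocycle. -/
theorem IsSolF.cocycleF_eq {ax : ℝ × ℝ → EG} {x₀ : ℝ} {u : ℝ × ℝ → G} (hu : IsSolF ax x₀ u)
    (x y : ℝ) : cocycleF G ax x x₀ y = u (x, y) := by
  rw [cocycleF, (Classical.epsilon_spec (p := fun u => IsSolF ax x₀ u) ⟨u, hu⟩).unique hu]

theorem exists_isSolF [FiniteDimensional ℝ P] [FiniteDimensional ℝ EG] {ax : P × (ℝ × ℝ) → EG}
    (hax : ContDiff ℝ ∞ ax) (x₀ : ℝ) : ∃ u : P × (ℝ × ℝ) → G,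
      ContMDiff 𝓘(ℝ, P × (ℝ × ℝ)) 𝓘(ℝ, EG) ∞ u ∧
      ∀ p, IsSolF (fun q => ax (p, q)) x₀ (fun q => u (p, q)) := by
  obtain ⟨u, hu, h0, hs⟩ := exists_solution (G := G)
    (a := fun z : (P × ℝ) × ℝ => -ax (z.1.1, (z.2, z.1.2))) (hax.comp (by fun_prop)).neg x₀
  have hu' : ContMDiff 𝓘(ℝ, P × (ℝ × ℝ)) 𝓘(ℝ, EG) ∞
      (fun z : P × (ℝ × ℝ) => u ((z.1, z.2.2), z.2.1)) := hu.comp_contDiff (by fun_prop)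
  refine ⟨_, hu', fun p => ⟨hu'.comp_contDiff (contDiff_prodMk_right p), fun y => h0 _,
    fun x y => ?_⟩⟩
  rw [rightLogDeriv_eq_rlog (hs ((p, y), x)).contMDiffAt_right]
  exact (hs ((p, y), x)).2

/-! ### The component `g` -/

theorem IsSolG.unique {ay : ℝ × ℝ → EG} {y₀ : ℝ} {u v : ℝ × ℝ → G} (hu : IsSolG ay y₀ u)
    (hv : IsSolG ay y₀ v) : u = v := by
  ext ⟨x, y⟩
  have key : ∀ {w : ℝ × ℝ → G}, IsSolG ay y₀ w → ∀ s, rlog (EG := EG) (fun s => w (x, s)) s 1 =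
      -ay (x, s) := fun hw s => by
    rw [← rightLogDeriv_eq_rlog, hw.2.2]
    exact ((hw.1.comp_contDiff (contDiff_prodMk_right x)) s).of_le (by simp)
  exact eq_of_rlog_eq (EG := EG) (u := fun s => u (x, s)) (v := fun s => v (x, s))
    (hu.1.comp_contDiff (contDiff_prodMk_right x)) (hv.1.comp_contDiff (contDiff_prodMk_right x))
    (fun s => (key hu s).trans (key hv s).symm) (s₀ := y₀) (by rw [hu.2.1, hv.2.1]) y

theorem IsSolG.cocycleG_eq {ay : ℝ × ℝ → EG} {y₀ : ℝ} {v : ℝ × ℝ → G} (hv : IsSolG ay y₀ v)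
    (x y : ℝ) : cocycleG G ay x y y₀ = v (x, y) := by
  rw [cocycleG, (Classical.epsilon_spec (p := fun u => IsSolG ay y₀ u) ⟨v, hv⟩).unique hv]

theorem exists_isSolG [FiniteDimensional ℝ P] [FiniteDimensional ℝ EG] {ay : P × (ℝ × ℝ) → EG}
    (hay : ContDiff ℝ ∞ ay) (y₀ : ℝ) : ∃ v : P × (ℝ × ℝ) → G,
      ContMDiff 𝓘(ℝ, P × (ℝ × ℝ)) 𝓘(ℝ, EG) ∞ v ∧
      ∀ p, IsSolG (fun q => ay (p, q)) y₀ (fun q => v (p, q)) := by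
  obtain ⟨u, hu, h0, hs⟩ := exists_solution (G := G)
    (a := fun z : (P × ℝ) × ℝ => -ay (z.1.1, (z.1.2, z.2))) (hay.comp (by fun_prop)).neg y₀
  have hu' : ContMDiff 𝓘(ℝ, P × (ℝ × ℝ)) 𝓘(ℝ, EG) ∞
      (fun z : P × (ℝ × ℝ) => u ((z.1, z.2.1), z.2.2)) := hu.comp_contDiff (by fun_prop)
  refine ⟨_, hu', fun p => ⟨hu'.comp_contDiff (contDiff_prodMk_right p), fun y => h0 _,
    fun x y => ?_⟩⟩
  rw [rightLogDeriv_eq_rlog (hs ((p, x), y)).contMDiffAt_right]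
  exact (hs ((p, x), y)).2

/-! ### The component `W` -/

variable {C : LieCrossedModule EG G EH H}

omit [LieGroup 𝓘(ℝ, EG) ∞ G] in
theorem IsSolW.hasDerivAt {ax ay : ℝ × ℝ → EG} {B : ℝ × ℝ → EH} {x₀ y₀ : ℝ} {W : ℝ × ℝ → H}
    (h : IsSolW C ax ay B x₀ y₀ W) (x y : ℝ) :
    HasDerivAt (fun s => rlog (EG := EH) W (s, y) (0, 1))
      (-C.mDot ((cocycleG G ay x₀ y y₀)⁻¹ * (cocycleF G ax x x₀ y)⁻¹) (B (x, y))) x := by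
  have h1 : (fun s => (rightLogDeriv (EG := EH) (fun r => W (s, r)) y)) =
      fun s => rlog W (s, y) (0, 1) := by
    ext s
    rw [rightLogDeriv_eq_rlog, rlog_snd (h.1 _)]
    exact ((h.1.comp_contDiff (contDiff_prodMk_right s)) y).of_le (by simp)
  rw [← h.2.2.2 x y, h1]
  have h2 : ContDiffAt ℝ ∞ (fun s => rlog (EG := EH) W (s, y) (0, 1)) x :=
    (ContDiffAt.comp x (f := fun s => (s, y)) (contDiffAt_rlog (h.1 _)) (by fun_prop)).clm_apply
      contDiffAt_const
  exact (h2.differentiableAt (by simp)).hasDerivAt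

omit [LieGroup 𝓘(ℝ, EG) ∞ G] in
theorem IsSolW.rlog_left {ax ay : ℝ × ℝ → EG} {B : ℝ × ℝ → EH} {x₀ y₀ : ℝ} {W : ℝ × ℝ → H}
    (h : IsSolW C ax ay B x₀ y₀ W) (y : ℝ) : rlog (EG := EH) W (x₀, y) (0, 1) = 0 := by
  rw [← rlog_snd (h.1 _)]
  simp only [h.2.1, rlog_const]
  rfl

omit [LieGroup 𝓘(ℝ, EG) ∞ G] in
-- The mixed equation determines `∂ᵧW W⁻¹` up to its value at `x₀`, which is zero because `W` is `1`
-- there. Uniqueness in `y` then determines `W`.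
theorem IsSolW.unique {ax ay : ℝ × ℝ → EG} {B : ℝ × ℝ → EH} {x₀ y₀ : ℝ} {W W' : ℝ × ℝ → H}
    (h : IsSolW C ax ay B x₀ y₀ W) (h' : IsSolW C ax ay B x₀ y₀ W') : W = W' := by
  have key : ∀ x y, rlog (EG := EH) W (x, y) (0, 1) = rlog W' (x, y) (0, 1) := fun x y => by
    have hd := fun s => (h.hasDerivAt s y).fun_sub (h'.hasDerivAt s y)
    have := is_const_of_deriv_eq_zero (fun s => (hd s).differentiableAt)
      (fun s => (hd s).deriv.trans (sub_self _)) x x₀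
    rw [h.rlog_left, h'.rlog_left, sub_self] at this
    exact sub_eq_zero.1 this
  ext ⟨x, y⟩
  refine eq_of_rlog_eq (EG := EH) (u := fun s => W (x, s)) (v := fun s => W' (x, s))
    (h.1.comp_contDiff (contDiff_prodMk_right x)) (h'.1.comp_contDiff (contDiff_prodMk_right x))
    (fun s => ?_) (s₀ := y₀) (by rw [h.2.2.1, h'.2.2.1]) y
  rw [rlog_snd (h.1 _), rlog_snd (h'.1 _), key]

omit [LieGroup 𝓘(ℝ, EG) ∞ G] in
theorem IsSolW.cocycleW_eq {ax ay : ℝ × ℝ → EG} {B : ℝ × ℝ → EH} {x₀ y₀ : ℝ} {W : ℝ × ℝ → H}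
    (h : IsSolW C ax ay B x₀ y₀ W) (x y : ℝ) : cocycleW C ax ay B x x₀ y y₀ = W (x, y) := by
  rw [cocycleW, (Classical.epsilon_spec (p := fun u => IsSolW C ax ay B x₀ y₀ u) ⟨W, h⟩).unique h]

/-- The mixed equation decouples: `∂ᵧW W⁻¹` is an `x`-primitive of a known function, after which `W`
solves an equation in `y` with `x` among the parameters. No relation between `ax`, `ay` and `B` is
needed. -/
theorem exists_isSolW [FiniteDimensional ℝ P] [FiniteDimensional ℝ EG] [FiniteDimensional ℝ EH]
    (C : LieCrossedModule EG G EH H) {ax ay : P × (ℝ × ℝ) → EG} {B : P × (ℝ × ℝ) → EH}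
    (hax : ContDiff ℝ ∞ ax) (hay : ContDiff ℝ ∞ ay) (hB : ContDiff ℝ ∞ B) (x₀ y₀ : ℝ) :
    ∃ W : P × (ℝ × ℝ) → H, ContMDiff 𝓘(ℝ, P × (ℝ × ℝ)) 𝓘(ℝ, EH) ∞ W ∧
      ∀ p, IsSolW C (fun q => ax (p, q)) (fun q => ay (p, q)) (fun q => B (p, q)) x₀ y₀
        (fun q => W (p, q)) := by
  obtain ⟨u, hu, hus⟩ := exists_isSolF (G := G) hax x₀
  obtain ⟨v, hv, hvs⟩ := exists_isSolG (G := G) hay y₀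
  have := FiniteDimensional.complete ℝ EH
  have hβ : ContDiff ℝ ∞ (fun z : (P × ℝ) × ℝ =>
      -C.mDotL ((v (z.1.1, (x₀, z.1.2)))⁻¹ * (u (z.1.1, (z.2, z.1.2)))⁻¹)
        (B (z.1.1, (z.2, z.1.2)))) := by
    refine (ContDiff.clm_apply (contDiff_iff_contDiffAt.2 fun z => C.contDiffAt_mDotL ?_)
      (hB.comp (by fun_prop))).neg
    exact contMDiffAt_mul (n := ⊤)
      (contMDiffAt_inv (n := ⊤) (hv.comp_contDiff (by fun_prop)).contMDiffAt)
      (contMDiffAt_inv (n := ⊤) (hu.comp_contDiff (by fun_prop)).contMDiffAt)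
  obtain ⟨w, hw, hw0, hwd⟩ := exists_smooth_primitive hβ x₀
  obtain ⟨W₀, hW, hW0, hWs⟩ := exists_solution (G := H)
    (a := fun z : (P × ℝ) × ℝ => w ((z.1.1, z.2), z.1.2)) (hw.comp (by fun_prop)) y₀
  have hW' : ContMDiff 𝓘(ℝ, P × (ℝ × ℝ)) 𝓘(ℝ, EH) ∞
      (fun z : P × (ℝ × ℝ) => W₀ ((z.1, z.2.1), z.2.2)) := hW.comp_contDiff (by fun_prop)
  have hr : ∀ p s y, rightLogDeriv (EG := EH) (fun r => W₀ ((p, s), r)) y = w ((p, y), s) :=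
    fun p s y => by
      rw [rightLogDeriv_eq_rlog (hWs ((p, s), y)).contMDiffAt_right]
      exact (hWs ((p, s), y)).2
  refine ⟨_, hW', fun p => ⟨hW'.comp_contDiff (contDiff_prodMk_right p), fun y => ?_,
    fun x => hW0 _, fun x y => ?_⟩⟩
  -- At `x = x₀` the primitive vanishes, so the equation in `y` has zero coefficient and the
  -- boundary value `1` on this line comes for free.
  · refine eq_of_rlog_eq (EG := EH) (u := fun y => W₀ ((p, x₀), y)) (v := fun _ => 1)
      (hW.comp_contDiff (by fun_prop)) contMDiff_const (fun s => ?_) (s₀ := y₀) (hW0 _) y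
    rw [(hWs ((p, x₀), s)).2, rlog_const]
    exact hw0 _
  · simp only [hr]
    rw [(hwd (p, y) x).deriv, (hus p).cocycleF_eq, (hvs p).cocycleG_eq, C.mDot_eq]

/-! ### The component `Ψ` -/

omit [LieGroup 𝓘(ℝ, EG) ∞ G] in
theorem IsSolPsi.rlog_inv_eq {ax : ℝ × ℝ → EG} {ϰ : ℝ × ℝ → G} {Γx : ℝ × ℝ → EH} {x₀ : ℝ}
    {Λ : ℝ × ℝ → H} (h : IsSolPsi C ax ϰ Γx x₀ Λ) (x y : ℝ) :
    rlog (EG := EH) (fun s => (Λ (s, y))⁻¹) x 1 =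
      C.mDot ((cocycleF G ax x x₀ y)⁻¹ * (ϰ (x, y))⁻¹) (Γx (x, y)) := by
  have := h.2.2 x y
  rw [leftLogDeriv_eq_rlog] at this
  · exact neg_injective this
  · exact ((h.1.comp_contDiff (contDiff_prodMk_left y)) x).of_le (by simp)

omit [LieGroup 𝓘(ℝ, EG) ∞ G] in
theorem IsSolPsi.unique {ax : ℝ × ℝ → EG} {ϰ : ℝ × ℝ → G} {Γx : ℝ × ℝ → EH} {x₀ : ℝ}
    {Λ Λ' : ℝ × ℝ → H} (h : IsSolPsi C ax ϰ Γx x₀ Λ) (h' : IsSolPsi C ax ϰ Γx x₀ Λ') : Λ = Λ' := by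
  ext ⟨x, y⟩
  refine inv_injective (eq_of_rlog_eq (EG := EH) (u := fun s => (Λ (s, y))⁻¹)
    (v := fun s => (Λ' (s, y))⁻¹)
    (h.1.comp_contDiff (contDiff_prodMk_left y)).inv
    (h'.1.comp_contDiff (contDiff_prodMk_left y)).inv
    (fun s => ?_) (s₀ := x₀) (by rw [h.2.1, h'.2.1]) x)
  rw [h.rlog_inv_eq, h'.rlog_inv_eq]

omit [LieGroup 𝓘(ℝ, EG) ∞ G] in
theorem IsSolPsi.gaugePsi_eq {ax : ℝ × ℝ → EG} {ϰ : ℝ × ℝ → G} {Γx : ℝ × ℝ → EH} {x₀ : ℝ}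
    {Λ : ℝ × ℝ → H} (h : IsSolPsi C ax ϰ Γx x₀ Λ) (x y : ℝ) :
    gaugePsi C ax ϰ Γx x x₀ y = Λ (x, y) := by
  rw [gaugePsi, (Classical.epsilon_spec (p := fun u => IsSolPsi C ax ϰ Γx x₀ u) ⟨Λ, h⟩).unique h]

omit [LieGroup 𝓘(ℝ, EG) ∞ G] in
theorem LieCrossedModule.mDotL_mul (C : LieCrossedModule EG G EH H) (a b : G) :
    C.mDotL (a * b) = C.mDotL a ∘L C.mDotL b := by
  have h (a : G) := (C.contMDiff_m a).contMDiffAt (x := 1).of_le (m := 1) (by simp)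
  rw [mDotL, mDotL, mDotL, ← tanMap_comp (h a) (map_one _) (h b) (map_one _)]
  simp

/-- `J` stands for `ṁ(ϰ⁻¹)(Γₓ)` and is defined for all parameters; `ϰ` and `Γx` are required only at
those `p` where `J` has this form. Inverting a solution of the right equation gives `Λ`. -/
theorem exists_isSolPsi [FiniteDimensional ℝ P] [FiniteDimensional ℝ EG] [FiniteDimensional ℝ EH]
    (C : LieCrossedModule EG G EH H) {ax : P × (ℝ × ℝ) → EG} {J : P × (ℝ × ℝ) → EH}
    (hax : ContDiff ℝ ∞ ax) (hJ : ContDiff ℝ ∞ J) (x₀ : ℝ) :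
    ∃ Λ : P × (ℝ × ℝ) → H, ContMDiff 𝓘(ℝ, P × (ℝ × ℝ)) 𝓘(ℝ, EH) ∞ Λ ∧
      ∀ p (ϰ : ℝ × ℝ → G) (Γx : ℝ × ℝ → EH), (∀ q, C.mDotL (ϰ q)⁻¹ (Γx q) = J (p, q)) →
        IsSolPsi C (fun q => ax (p, q)) ϰ Γx x₀ (fun q => Λ (p, q)) := by
  obtain ⟨u, hu, hus⟩ := exists_isSolF (G := G) hax x₀
  have hβ : ContDiff ℝ ∞ (fun z : (P × ℝ) × ℝ =>
      C.mDotL (u (z.1.1, (z.2, z.1.2)))⁻¹ (J (z.1.1, (z.2, z.1.2)))) := by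
    refine ContDiff.clm_apply (contDiff_iff_contDiffAt.2 fun z => C.contDiffAt_mDotL ?_)
      (hJ.comp (by fun_prop))
    exact contMDiffAt_inv (n := ⊤) (hu.comp_contDiff (by fun_prop)).contMDiffAt
  obtain ⟨W, hW, hW0, hWs⟩ := exists_solution (G := H) hβ x₀
  have hW' : ContMDiff 𝓘(ℝ, P × (ℝ × ℝ)) 𝓘(ℝ, EH) ∞
      (fun z : P × (ℝ × ℝ) => (W ((z.1, z.2.2), z.2.1))⁻¹) :=
    (hW.comp_contDiff (by fun_prop)).inv
  refine ⟨_, hW', fun p ϰ Γx h => ⟨hW'.comp_contDiff (contDiff_prodMk_right p),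
    fun y => inv_eq_one.2 (hW0 _), fun x y => ?_⟩⟩
  rw [leftLogDeriv_eq_rlog (contMDiffAt_inv (n := 1) (hWs ((p, y), x)).contMDiffAt_right)]
  simp only [inv_inv]
  rw [(hWs ((p, y), x)).2, (hus p).cocycleF_eq, C.mDot_eq, C.mDotL_mul,
    ContinuousLinearMap.comp_apply, h]

end Cocycles

/-! ### Pull-back of differential forms to a normed space -/

section PullBack

variable {P : Type*} [NormedAddCommGroup P] [NormedSpace ℝ P]
  {E : Type*} [NormedAddCommGroup E] [NormedSpace ℝ E]
  {M : Type*} [TopologicalSpace M] [ChartedSpace E M]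
  {V : Type*} [NormedAddCommGroup V] [NormedSpace ℝ V] {k : ℕ}

/-- The manifold derivative of a map from a normed space, with values in the model space. -/
noncomputable def modelDeriv (E : Type*) [NormedAddCommGroup E] [NormedSpace ℝ E]
    {M : Type*} [TopologicalSpace M] [ChartedSpace E M] (K : P → M) (q : P) : P →L[ℝ] E :=
  mfderiv 𝓘(ℝ, P) 𝓘(ℝ, E) K q

/-- The value of a differential form as an alternating map on the model space. -/
def DiffForm.val (η : DiffForm E M V k) (p : M) : E [⋀^Fin k]→L[ℝ] V := η.toFun p

/-- The exterior derivative as an alternating map on the model space. -/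
noncomputable def DiffForm.dval (η : DiffForm E M V k) (p : M) : E [⋀^Fin (k + 1)]→L[ℝ] V :=
  η.extD p

/-- The pull-back of a differential form under a map from a normed space. -/
noncomputable def pullForm (η : DiffForm E M V k) (K : P → M) (q : P) : P [⋀^Fin k]→L[ℝ] V :=
  (η.val (K q)).compContinuousLinearMap (modelDeriv E K q)

theorem pullX_eq (η : DiffForm E M V 1) (S : ℝ × ℝ → M) (q : ℝ × ℝ) :
    pullX η S q = η.val (S q) ![modelDeriv E S q (1, 0)] := rfl

theorem pullY_eq (η : DiffForm E M V 1) (S : ℝ × ℝ → M) (q : ℝ × ℝ) :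
    pullY η S q = η.val (S q) ![modelDeriv E S q (0, 1)] := rfl

theorem pullXY_eq (η : DiffForm E M V 2) (S : ℝ × ℝ → M) (q : ℝ × ℝ) :
    pullXY η S q = η.val (S q) ![modelDeriv E S q (1, 0), modelDeriv E S q (0, 1)] := rfl

theorem pullForm_one (η : DiffForm E M V 1) (K : P → M) (q v : P) :
    pullForm η K q ![v] = η.val (K q) ![modelDeriv E K q v] := by
  rw [pullForm, ContinuousAlternatingMap.compContinuousLinearMap_apply]
  congr 1
  ext i
  fin_cases i
  rfl

theorem pullForm_two (η : DiffForm E M V 2) (K : P → M) (q v w : P) :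
    pullForm η K q ![v, w] = η.val (K q) ![modelDeriv E K q v, modelDeriv E K q w] := by
  rw [pullForm, ContinuousAlternatingMap.compContinuousLinearMap_apply]
  congr 1
  ext i
  fin_cases i <;> rfl

theorem modelDeriv_comp {P' : Type*} [NormedAddCommGroup P'] [NormedSpace ℝ P'] {K : P → M}
    {f : P' → P} {f' : P' →L[ℝ] P} {q : P'} (hK : ContMDiffAt 𝓘(ℝ, P) 𝓘(ℝ, E) 1 K (f q))
    (hf : HasFDerivAt f f' q) :
    modelDeriv E (fun x => K (f x)) q = modelDeriv E K (f q) ∘L f' :=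
  ((hK.mdifferentiableAt (by simp)).hasMFDerivAt.comp q hf.hasMFDerivAt).mfderiv

theorem Filter.EventuallyEq.modelDeriv {K K' : P → M} {q : P} (h : K =ᶠ[𝓝 q] K') :
    modelDeriv E K q = modelDeriv E K' q :=
  h.mfderiv_eq

theorem modelDeriv_const (p : M) (q : P) : modelDeriv E (fun _ : P => p) q = 0 :=
  mfderiv_const

variable [IsManifold 𝓘(ℝ, E) ∞ M]

theorem contDiffAt_extChartAt_comp {U : Set P} (hU : IsOpen U) {K : P → M}
    (hK : ContMDiffOn 𝓘(ℝ, P) 𝓘(ℝ, E) ∞ K U) {q : P} (hq : q ∈ U) {p : M}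
    (hp : K q ∈ (extChartAt 𝓘(ℝ, E) p).source) :
    ContDiffAt ℝ ∞ (fun x => extChartAt 𝓘(ℝ, E) p (K x)) q := by
  rw [← contMDiffAt_iff_contDiffAt]
  refine ContMDiffAt.comp q (contMDiffAt_extChartAt' ?_) (hK.contMDiffAt (hU.mem_nhds hq))
  rwa [← extChartAt_source 𝓘(ℝ, E)]

/-- The pull-back of a form in terms of its local expression. -/
theorem pullForm_eq_localRep (η : DiffForm E M V k) {U : Set P} (hU : IsOpen U) {K : P → M}
    (hK : ContMDiffOn 𝓘(ℝ, P) 𝓘(ℝ, E) ∞ K U) {q : P} (hq : q ∈ U) {p : M}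
    (hp : K q ∈ (extChartAt 𝓘(ℝ, E) p).source) :
    pullForm η K q = (localRep η.toFun p (extChartAt 𝓘(ℝ, E) p (K q))).compContinuousLinearMap
      (fderiv ℝ (fun x => extChartAt 𝓘(ℝ, E) p (K x)) q) := by
  have hKq : ContMDiffAt 𝓘(ℝ, P) 𝓘(ℝ, E) ∞ K q := hK.contMDiffAt (hU.mem_nhds hq)
  have hκ := contDiffAt_extChartAt_comp hU hK hq hp
  set e := extChartAt 𝓘(ℝ, E) p with he
  have hsymm : ContMDiffAt 𝓘(ℝ, E) 𝓘(ℝ, E) ∞ e.symm (e (K q)) :=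
    (contMDiffOn_extChartAt_symm p).contMDiffAt
      ((isOpen_extChartAt_target p).mem_nhds (e.map_source hp))
  have h1 : K =ᶠ[𝓝 q] fun x => e.symm (e (K x)) := by
    filter_upwards [hKq.continuousAt.preimage_mem_nhds ((isOpen_extChartAt_source p).mem_nhds hp)]
      with x hx
    exact (e.left_inv hx).symm
  have h2 : modelDeriv E K q = modelDeriv E e.symm (e (K q)) ∘L fderiv ℝ (fun x => e (K x)) q := by
    rw [Filter.EventuallyEq.modelDeriv h1]
    exact modelDeriv_comp (K := e.symm) (hsymm.of_le (by simp))
      (hκ.differentiableAt (by simp)).hasFDerivAt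
  have h3 : η.val (K q) = η.val (e.symm (e (K q))) := by rw [e.left_inv hp]
  ext v
  rw [pullForm, h2, h3]
  rfl

theorem eventually_pullForm_eq_localRep (η : DiffForm E M V k) {U : Set P} (hU : IsOpen U)
    {K : P → M} (hK : ContMDiffOn 𝓘(ℝ, P) 𝓘(ℝ, E) ∞ K U) {q : P} (hq : q ∈ U) :
    pullForm η K =ᶠ[𝓝 q] fun x =>
      (localRep η.toFun (K q) (extChartAt 𝓘(ℝ, E) (K q) (K x))).compContinuousLinearMap
      (fderiv ℝ (fun x => extChartAt 𝓘(ℝ, E) (K q) (K x)) x) := by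
  have hKq : ContinuousAt K q := (hK.contMDiffAt (hU.mem_nhds hq)).continuousAt
  filter_upwards [hU.mem_nhds hq, hKq.preimage_mem_nhds
    (extChartAt_source_mem_nhds (I := 𝓘(ℝ, E)) (K q))]
    with x hx hx'
  exact pullForm_eq_localRep η hU hK hx hx'

omit [IsManifold 𝓘(ℝ, E) ∞ M] in
theorem DiffForm.contDiffAt_localRep (η : DiffForm E M V k) (p : M) :
    ContDiffAt ℝ ∞ (localRep η.toFun p) (extChartAt 𝓘(ℝ, E) p p) :=
  (η.smooth p).contDiffAt (extChartAt_target_mem_nhds p)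

/-- In the chart at `K q` the form is smooth by definition of `DiffForm`, the coordinates of `K`
have smooth derivatives, and evaluating an alternating map on vectors is jointly analytic. -/
theorem contDiffAt_pullForm_apply (η : DiffForm E M V k) {U : Set P} (hU : IsOpen U) {K : P → M}
    (hK : ContMDiffOn 𝓘(ℝ, P) 𝓘(ℝ, E) ∞ K U) {q : P} (hq : q ∈ U) (v : Fin k → P) :
    ContDiffAt ℝ ∞ (fun x => pullForm η K x v) q := by
  have hκ := contDiffAt_extChartAt_comp hU hK hq (mem_extChartAt_source (K q))
  have h1 : ContDiffAt ℝ ∞ (fun x => localRep η.toFun (K q) (extChartAt 𝓘(ℝ, E) (K q) (K x))) q :=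
    ContDiffAt.comp q (g := localRep η.toFun (K q))
      (f := fun x => extChartAt 𝓘(ℝ, E) (K q) (K x)) (η.contDiffAt_localRep (K q)) hκ
  have h2 : ContDiffAt ℝ ∞ (fun x (i : Fin k) =>
      fderiv ℝ (fun x => extChartAt 𝓘(ℝ, E) (K q) (K x)) x (v i)) q :=
    contDiffAt_pi.2 fun i => (hκ.fderiv_right (m := ∞) (by simp)).clm_apply contDiffAt_const
  have h3 := (ContinuousLinearMap.analyticOnNhd_uncurry_of_multilinear (𝕜 := ℝ) (s := Set.univ)
    (ContinuousAlternatingMap.toContinuousMultilinearMapCLM ℝ :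
      (E [⋀^Fin k]→L[ℝ] V) →L[ℝ] _)).contDiffOn (n := ∞) uniqueDiffOn_univ
  refine ((h3.contDiffAt Filter.univ_mem).comp q (h1.prodMk h2)).congr_of_eventuallyEq ?_
  filter_upwards [eventually_pullForm_eq_localRep η hU hK hq] with x hx
  rw [hx]
  rfl

theorem differentiableAt_pullForm (η : DiffForm E M V k) {K : P → M}
    (hK : ContMDiff 𝓘(ℝ, P) 𝓘(ℝ, E) ∞ K) (q : P) : DifferentiableAt ℝ (pullForm η K) q := by
  have hκ := contDiffAt_extChartAt_comp isOpen_univ hK.contMDiffOn (Set.mem_univ q)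
    (mem_extChartAt_source (K q))
  refine DifferentiableAt.congr_of_eventuallyEq ?_
    (eventually_pullForm_eq_localRep η isOpen_univ hK.contMDiffOn (Set.mem_univ q))
  refine DifferentiableAt.continuousAlternatingMapCompContinuousLinearMap ?_ ?_
  · exact ((ContDiffAt.comp q (g := localRep η.toFun (K q))
      (f := fun x => extChartAt 𝓘(ℝ, E) (K q) (K x)) (η.contDiffAt_localRep (K q)) hκ).differentiableAt (by simp))
  · exact (hκ.fderiv_right (m := ∞) (by simp)).differentiableAt (by simp)

/-- The exterior derivative commutes with pull-backs. -/
theorem extDeriv_pullForm (η : DiffForm E M V k) {K : P → M}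
    (hK : ContMDiff 𝓘(ℝ, P) 𝓘(ℝ, E) ∞ K) (q : P) :
    extDeriv (pullForm η K) q = (η.dval (K q)).compContinuousLinearMap (modelDeriv E K q) := by
  have hκ := contDiffAt_extChartAt_comp isOpen_univ hK.contMDiffOn (Set.mem_univ q)
    (mem_extChartAt_source (K q))
  have h0 : DifferentiableAt ℝ (localRep η.toFun (K q))
      ((fun x => extChartAt 𝓘(ℝ, E) (K q) (K x)) q) :=
    (η.contDiffAt_localRep (K q)).differentiableAt (by simp)
  -- `extD` at `K q` is computed in the preferred chart at `K q`, the same chart that describes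
  -- `pullForm` near `q`. The statement for normed spaces thus applies without any independence of
  -- charts.
  have h3 := extDeriv_pullback (f := fun x => extChartAt 𝓘(ℝ, E) (K q) (K x)) (x := q) h0 hκ
    (by simpa using ENat.LEInfty.out)
  rw [(eventually_pullForm_eq_localRep η isOpen_univ hK.contMDiffOn (Set.mem_univ q)).extDeriv_eq,
    h3]
  have h1 : HasMFDerivAt 𝓘(ℝ, P) 𝓘(ℝ, E) (fun x => extChartAt 𝓘(ℝ, E) (K q) (K x)) q
      ((mfderiv 𝓘(ℝ, E) 𝓘(ℝ, E) (extChartAt 𝓘(ℝ, E) (K q)) (K q)).comp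
        (mfderiv 𝓘(ℝ, P) 𝓘(ℝ, E) K q)) :=
    (mdifferentiableAt_extChartAt (mem_chart_source E (K q))).hasMFDerivAt.comp q
      ((hK q).mdifferentiableAt (by simp)).hasMFDerivAt
  ext v
  refine congrArg (extDeriv (localRep η.toFun (K q)) (extChartAt 𝓘(ℝ, E) (K q) (K q)))
    (funext fun i => ?_)
  have h2 := DFunLike.congr_fun h1.mfderiv (v i)
  rw [mfderiv_eq_fderiv] at h2
  exact h2

end PullBack

/-! ### Smooth families over a closed set and their extension -/

section SmoothFamilies

variable {P : Type*} [NormedAddCommGroup P] [NormedSpace ℝ P]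
  {X : Type*} [NormedAddCommGroup X] [NormedSpace ℝ X]
  {X' : Type*} [NormedAddCommGroup X'] [NormedSpace ℝ X']
  {E : Type*} [NormedAddCommGroup E] [NormedSpace ℝ E]
  {M : Type*} [TopologicalSpace M] [ChartedSpace E M]
  {V : Type*} [NormedAddCommGroup V] [NormedSpace ℝ V] {k : ℕ}

theorem _root_.ContMDiff.smoothOnSubset {A : Set P} {F : P → M}
    (hF : ContMDiff 𝓘(ℝ, P) 𝓘(ℝ, E) ∞ F) {f : A → M} (h : ∀ a : A, F a = f a) :
    SmoothOnSubset E A f := fun _ =>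
  ⟨Set.univ, isOpen_univ, Set.mem_univ _, F, hF.contMDiffOn, fun b _ => h b⟩

/-- A smooth map from a closed subset to a vector space extends to a smooth map. -/
theorem SmoothOnSubset.exists_contDiff [FiniteDimensional ℝ P] {S : Set P} (hS : IsClosed S)
    {b : S → V} (h : SmoothOnSubset V S b) :
    ∃ g : P → V, ContDiff ℝ ∞ g ∧ ∀ q : S, g q = b q := by
  -- The prescribed set of values is at most a single point over `S` and the whole space elsewhere;
  -- convexity lets a partition of unity glue the local extensions.
  have hc : ∀ x, Convex ℝ {v : V | ∀ hx : x ∈ S, v = b ⟨x, hx⟩} := by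
    intro x u hu v hv s t _ _ hst hx
    rw [hu hx, hv hx, ← add_smul, hst, one_smul]
  obtain ⟨g, hg⟩ := exists_contMDiffMap_forall_mem_convex_of_local (n := ⊤) 𝓘(ℝ, P) hc
    fun x => by
      by_cases hx : x ∈ S
      · obtain ⟨U, hU, hxU, F, hF, hFb⟩ := h ⟨x, hx⟩
        exact ⟨U, hU.mem_nhds hxU, F, hF, fun y hy hyS => hFb ⟨y, hyS⟩ hy⟩
      · exact ⟨Sᶜ, hS.isOpen_compl.mem_nhds hx, fun _ => 0, contMDiffOn_const,
          fun y hy hyS => (hy hyS).elim⟩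
  exact ⟨g, g.contMDiff.contDiff, fun q => hg q q.2⟩

theorem SmoothFamily.exists_contDiff [FiniteDimensional ℝ P] [FiniteDimensional ℝ X] {A : Set P}
    (hA : IsClosed A) {b : A → X → V} (h : SmoothFamily V A b) :
    ∃ g : P × X → V, ContDiff ℝ ∞ g ∧ ∀ (a : A) x, g (a, x) = b a x := by
  obtain ⟨g, hg, hgb⟩ := SmoothOnSubset.exists_contDiff (hA.prod isClosed_univ) h
  exact ⟨g, hg, fun a x => hgb ⟨(a, x), a.2, Set.mem_univ x⟩⟩

theorem SmoothFamily.comp {A : Set P} {K : A → X → M} (h : SmoothFamily E A K) {f : X' → X}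
    (hf : ContDiff ℝ ∞ f) : SmoothFamily E A (fun a x => K a (f x)) := by
  rintro ⟨⟨a, x⟩, ha, hx⟩
  obtain ⟨U, hU, haU, F, hF, hFK⟩ := h ⟨(a, f x), ha, Set.mem_univ _⟩
  have hφ : ContDiff ℝ ∞ (fun z : P × X' => (z.1, f z.2)) :=
    contDiff_fst.prodMk (hf.comp contDiff_snd)
  exact ⟨(fun z : P × X' => (z.1, f z.2)) ⁻¹' U, hU.preimage hφ.continuous, haU,
    fun z => F (z.1, f z.2), hF.comp hφ.contMDiff.contMDiffOn subset_rfl,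
    fun b hb => hFK ⟨(b.1.1, f b.1.2), b.2.1, Set.mem_univ _⟩ hb⟩

theorem SmoothFamily.congr {A : Set P} {K K' : A → X → M} (h : SmoothFamily E A K)
    (h' : ∀ a x, K a x = K' a x) : SmoothFamily E A K' := by
  have : K = K' := funext fun a => funext fun x => h' a x
  rwa [← this]

/-- The pull-backs of a form under a smooth family of maps form a smooth family. -/
theorem SmoothFamily.pullForm [IsManifold 𝓘(ℝ, E) ∞ M] {A : Set P} {K : A → X → M}
    (h : SmoothFamily E A K) (η : DiffForm E M V k) (v : Fin k → X) :
    SmoothFamily V A (fun a x => pullForm η (K a) x v) := by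
  intro z
  obtain ⟨U, hU, haU, F, hF, hFK⟩ := h z
  -- The local extension `F` is differentiated only in directions `(0, v i)`. At points of `A × X`
  -- this sees just the slice `F (a, ·)`, which is `K a`, so the choice of extension is immaterial.
  refine ⟨U, hU, haU, fun z => HigherTransport.pullForm η F z (fun i => (0, v i)),
    fun z hz => ((contDiffAt_pullForm_apply η hU hF hz _).contMDiffAt).contMDiffWithinAt, ?_⟩
  rintro ⟨⟨a, x⟩, ha, hx⟩ hb
  have h1 : K ⟨a, ha⟩ =ᶠ[𝓝 x] fun y => F (a, y) := by
    filter_upwards [(hU.preimage (Continuous.prodMk_right a)).mem_nhds hb] with y hy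
    exact (hFK ⟨(a, y), ha, Set.mem_univ _⟩ hy).symm
  have h2 : modelDeriv E (K ⟨a, ha⟩) x = modelDeriv E F (a, x) ∘L ContinuousLinearMap.inr ℝ P X :=
    (Filter.EventuallyEq.modelDeriv h1).trans
      (modelDeriv_comp ((hF.contMDiffAt (hU.mem_nhds hb)).of_le (by simp))
        (hasFDerivAt_prodMk_right a x))
  change HigherTransport.pullForm η F (a, x) _ = HigherTransport.pullForm η (K ⟨a, ha⟩) x v
  rw [HigherTransport.pullForm, HigherTransport.pullForm, h2, ← h1.eq_of_nhds]
  rfl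

end SmoothFamilies

/-! ### Smoothness of the transports along a family -/

section Transport

variable {P : Type*} [NormedAddCommGroup P] [NormedSpace ℝ P] [FiniteDimensional ℝ P]
  {E : Type*} [NormedAddCommGroup E] [NormedSpace ℝ E]
  {M : Type*} [TopologicalSpace M] [ChartedSpace E M] [IsManifold 𝓘(ℝ, E) ∞ M]
  {EG : Type*} [NormedAddCommGroup EG] [NormedSpace ℝ EG] [FiniteDimensional ℝ EG]
  {G : Type*} [TopologicalSpace G] [ChartedSpace EG G] [Group G] [LieGroup 𝓘(ℝ, EG) ∞ G]
  {EH : Type*} [NormedAddCommGroup EH] [NormedSpace ℝ EH] [FiniteDimensional ℝ EH]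
  {H : Type*} [TopologicalSpace H] [ChartedSpace EH H] [Group H] [LieGroup 𝓘(ℝ, EH) ∞ H]
  {V : Type*} [NormedAddCommGroup V] [NormedSpace ℝ V]
  {C : LieCrossedModule EG G EH H} (D : ConnDoublet E M C) {A : Set P} {p₀ p₁ : A → M}

omit [FiniteDimensional ℝ P] in
theorem SmoothFamily.pullX {K : A → ℝ × ℝ → M} (h : SmoothFamily E A K) (η : DiffForm E M V 1) :
    SmoothFamily V A (fun a => pullX η (K a)) :=
  (h.pullForm η ![(1, 0)]).congr fun a x => pullForm_one η (K a) x (1, 0)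

omit [FiniteDimensional ℝ P] in
theorem SmoothFamily.pullY {K : A → ℝ × ℝ → M} (h : SmoothFamily E A K) (η : DiffForm E M V 1) :
    SmoothFamily V A (fun a => pullY η (K a)) :=
  (h.pullForm η ![(0, 1)]).congr fun a x => pullForm_one η (K a) x (0, 1)

omit [FiniteDimensional ℝ P] in
theorem SmoothFamily.pullXY {K : A → ℝ × ℝ → M} (h : SmoothFamily E A K) (η : DiffForm E M V 2) :
    SmoothFamily V A (fun a => pullXY η (K a)) :=
  (h.pullForm η ![(1, 0), (0, 1)]).congr fun a x => pullForm_two η (K a) x (1, 0) (0, 1)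

omit [FiniteDimensional ℝ P] [IsManifold 𝓘(ℝ, E) ∞ M] in
theorem SmoothFamily.unit {γ : ∀ a : A, Curve E (p₀ a) (p₁ a)}
    (h : SmoothFamily E A (fun a => (γ a).toFun)) : SmoothFamily E A (fun a => (γ a).unit) :=
  h.comp contDiff_fst

omit [FiniteDimensional ℝ P] [IsManifold 𝓘(ℝ, E) ∞ M] in
theorem SmoothFamily.source {γ₀ γ₁ : ∀ a : A, Curve E (p₀ a) (p₁ a)}
    {S : ∀ a : A, Surface (γ₀ a) (γ₁ a)} (h : SmoothFamily E A (fun a => (S a).toFun)) :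
    SmoothFamily E A (fun a => (γ₀ a).toFun) := by
  refine (h.comp (contDiff_prodMk_left (0 : ℝ))).congr fun a x => ?_
  obtain ⟨ε, h0, -, -, -, hs, -⟩ := (S a).sitting
  exact hs x 0 h0

omit [FiniteDimensional ℝ P] [IsManifold 𝓘(ℝ, E) ∞ M] in
theorem SmoothFamily.target {γ₀ γ₁ : ∀ a : A, Curve E (p₀ a) (p₁ a)}
    {S : ∀ a : A, Surface (γ₀ a) (γ₁ a)} (h : SmoothFamily E A (fun a => (S a).toFun)) :
    SmoothFamily E A (fun a => (γ₁ a).toFun) := by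
  refine (h.comp (contDiff_prodMk_left (1 : ℝ))).congr fun a x => ?_
  obtain ⟨ε, h0, -, -, -, -, ht⟩ := (S a).sitting
  exact ht x 1 (by linarith)

omit [FiniteDimensional ℝ EH] [LieGroup 𝓘(ℝ, EH) ∞ H] in
theorem ConnDoublet.smoothOnSubset_transport₁ (hA : IsClosed A) {γ : ∀ a : A, Curve E (p₀ a) (p₁ a)}
    (h : SmoothFamily E A (fun a => (γ a).toFun)) :
    SmoothOnSubset EG A (fun a => D.transport₁ (γ a)) := by
  obtain ⟨ax, hax, hx⟩ := (h.unit.pullX D.θ).exists_contDiff hA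
  obtain ⟨u, hu, hus⟩ := exists_isSolF (G := G) hax 0
  refine (hu.comp_contDiff (f := fun p : P => (p, (1, 0))) (by fun_prop)).smoothOnSubset
    fun a : A => ?_
  rw [transport₁, ← (hus a).cocycleF_eq]
  simp only [hx]

/-- The three coefficients are extended independently, so away from `A` they need not come from a
doublet; the solution `W` exists regardless and has the right meaning over `A`. -/
theorem ConnDoublet.smoothOnSubset_transport₂ (hA : IsClosed A)
    {γ₀ γ₁ : ∀ a : A, Curve E (p₀ a) (p₁ a)} {S : ∀ a : A, Surface (γ₀ a) (γ₁ a)}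
    (h : SmoothFamily E A (fun a => (S a).toFun)) :
    SmoothOnSubset EH A (fun a => D.transport₂ (S a)) := by
  obtain ⟨ax, hax, hx⟩ := (h.pullX D.θ).exists_contDiff hA
  obtain ⟨ay, hay, hy⟩ := (h.pullY D.θ).exists_contDiff hA
  obtain ⟨B, hB, hxy⟩ := (h.pullXY D.Υ).exists_contDiff hA
  obtain ⟨W, hW, hWs⟩ := exists_isSolW C hax hay hB 1 0
  refine (hW.comp_contDiff (f := fun p : P => (p, (0, 1))) (by fun_prop)).smoothOnSubset
    fun a : A => ?_
  rw [transport₂, ← (hWs a).cocycleW_eq]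
  simp only [hx, hy, hxy]

omit [FiniteDimensional ℝ P] [IsManifold 𝓘(ℝ, E) ∞ M] [FiniteDimensional ℝ EG] in
/-- The form `ṁ(g⁻¹)(J)` along a smooth family of maps. -/
theorem SmoothFamily.mDotL_inv {X : Type*} [NormedAddCommGroup X] [NormedSpace ℝ X]
    {K : A → X → M} (h : SmoothFamily E A K) (C : LieCrossedModule EG G EH H)
    (T : GaugeTransf E M EG G EH) {b : A → X → EH} (hb : SmoothFamily EH A b) :
    SmoothFamily EH A (fun a x => C.mDotL (T.g (K a x))⁻¹ (b a x)) := by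
  intro z
  obtain ⟨U, hU, haU, F, hF, hFK⟩ := h z
  obtain ⟨U', hU', haU', F', hF', hFb⟩ := hb z
  have := FiniteDimensional.complete ℝ EH
  refine ⟨U ∩ U', hU.inter hU', ⟨haU, haU'⟩, fun z => C.mDotL (T.g (F z))⁻¹ (F' z),
    fun z hz => ContMDiffAt.contMDiffWithinAt ?_, ?_⟩
  · rw [contMDiffAt_iff_contDiffAt]
    refine (C.contDiffAt_mDotL (contMDiffAt_inv (n := ⊤) ?_)).clm_apply
      (hF'.contMDiffAt (hU'.mem_nhds hz.2)).contDiffAt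
    exact T.smooth_g.contMDiffAt.comp z (hF.contMDiffAt (hU.mem_nhds hz.1))
  · intro b hb
    change C.mDotL (T.g (F b))⁻¹ (F' b) = _
    rw [hFK b hb.1, hFb b hb.2]

theorem ConnDoublet.smoothOnSubset_gaugeTransport (hA : IsClosed A) (T : GaugeTransf E M EG G EH)
    {γ : ∀ a : A, Curve E (p₀ a) (p₁ a)} (h : SmoothFamily E A (fun a => (γ a).toFun)) :
    SmoothOnSubset EH A (fun a => D.gaugeTransport T (γ a)) := by
  obtain ⟨ax, hax, hx⟩ := (h.unit.pullX D.θ).exists_contDiff hA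
  obtain ⟨J, hJ, hJx⟩ := (h.unit.mDotL_inv C T (h.unit.pullX T.J)).exists_contDiff hA
  obtain ⟨Λ, hΛ, hΛs⟩ := exists_isSolPsi C hax hJ 1
  refine (hΛ.comp_contDiff (f := fun p : P => (p, (0, 0))) (by fun_prop)).smoothOnSubset
    fun a : A => ?_
  rw [gaugeTransport, ← (hΛs a (fun q => T.g ((γ a).unit q)) _ fun q => (hJx a q).symm).gaugePsi_eq]
  simp only [hx]

end Transport

/-! ### The Maurer-Cartan equation in the chart at the unit -/

section MaurerCartan

variable {P : Type*} [NormedAddCommGroup P] [NormedSpace ℝ P]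
  {EG : Type*} [NormedAddCommGroup EG] [NormedSpace ℝ EG]
  {G : Type*} [TopologicalSpace G] [ChartedSpace EG G] [Group G] [LieGroup 𝓘(ℝ, EG) ∞ G]

variable (EG G) in
/-- The second derivative of the multiplication at the unit, in the preferred chart: the derivative
of the right translations. -/
noncomputable def rightTransDeriv₂ : EG →L[ℝ] EG →L[ℝ] EG :=
  fderiv ℝ (rightTransDeriv EG G) (unitChart EG G 1)

theorem hasFDerivAt_rightTransDeriv : HasFDerivAt (rightTransDeriv EG G) (rightTransDeriv₂ EG G)
    (unitChart EG G 1) :=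
  ((contDiffAt_rightTransDeriv (mem_extChartAt_target (I := 𝓘(ℝ, EG)) (1 : G))).differentiableAt
    (by simp)).hasFDerivAt

/-- The coordinate derivative of `v = u (u p)⁻¹` is `R_v ∘ rlog u`. Differentiating once more and
using the symmetry of the second derivative leaves exactly the derivative of `R`. -/
theorem fderiv_rlog_sub {u : P → G} {p : P} (hu : ContMDiffAt 𝓘(ℝ, P) 𝓘(ℝ, EG) ∞ u p) (X Y : P) :
    fderiv ℝ (rlog (EG := EG) u) p X Y - fderiv ℝ (rlog (EG := EG) u) p Y X =
      rightTransDeriv₂ EG G (rlog u p Y) (rlog u p X) -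
        rightTransDeriv₂ EG G (rlog u p X) (rlog u p Y) := by
  set v : P → G := fun q => u q * (u p)⁻¹ with hvdef
  have hv : ContMDiffAt 𝓘(ℝ, P) 𝓘(ℝ, EG) ∞ v p := contMDiffAt_mul (n := ⊤) hu contMDiffAt_const
  have hvp : v p = 1 := by simp [v]
  have hr : rlog (EG := EG) v = rlog u := funext fun q => rlog_mul_const u _ q
  have hk : ContDiffAt ℝ ∞ (fun q => unitChart EG G (v q)) p := ContMDiffAt.unitChart (n := ⊤) hv hvp
  have hev : fderiv ℝ (fun q => unitChart EG G (v q)) =ᶠ[𝓝 p]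
      fun q => rightTransDeriv EG G (unitChart EG G (v q)) ∘L rlog u q := by
    have h1 : ∀ᶠ q in 𝓝 p, ContMDiffAt 𝓘(ℝ, P) 𝓘(ℝ, EG) 1 v q :=
      (contMDiffAt_iff_contMDiffAt_nhds (by simp)).1 (hv.of_le (m := 1) (by simp))
    have h2 : ∀ᶠ q in 𝓝 p, v q ∈ (unitChart EG G).source :=
      hv.continuousAt (by rw [hvp]; exact extChartAt_source_mem_nhds (I := 𝓘(ℝ, EG)) (1 : G))
    filter_upwards [h1, h2] with q hq hq'
    rw [(fderiv_unitChart_eq_rightTransDeriv hq hq').fderiv, hr]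
  have hd1 : HasFDerivAt (fun q => unitChart EG G (v q)) (rlog (EG := EG) u p) p := by
    rw [← hr]
    have := fderiv_unitChart_eq_rightTransDeriv (hv.of_le (m := 1) (by simp))
      (by rw [hvp]; exact mem_extChartAt_source (I := 𝓘(ℝ, EG)) (1 : G))
    rwa [hvp, rightTransDeriv_one, ContinuousLinearMap.id_comp] at this
  have hR : HasFDerivAt (rightTransDeriv EG G) (rightTransDeriv₂ EG G) (unitChart EG G (v p)) := by
    rw [hvp]
    exact hasFDerivAt_rightTransDeriv
  have hR2 := hR.comp p hd1
  have hd2 := hR2.clm_comp ((contDiffAt_rlog hu).differentiableAt (by simp)).hasFDerivAt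
  have hsymm := (hk.isSymmSndFDerivAt (by simpa using ENat.LEInfty.out)).eq X Y
  rw [(hd2.congr_of_eventuallyEq hev).fderiv] at hsymm
  simp [hvp, rightTransDeriv_one] at hsymm
  rw [sub_eq_sub_iff_add_eq_add, hsymm, add_comm]

variable (EG G) in
/-- The differential at the unit of the left translation by the element with coordinates `y`. -/
noncomputable def leftTransDeriv (y : EG) : EG →L[ℝ] EG :=
  fderiv ℝ (fun x => unitChart EG G ((unitChart EG G).symm y * (unitChart EG G).symm x))
    (unitChart EG G 1)

omit [LieGroup 𝓘(ℝ, EG) ∞ G] in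
theorem leftTransDeriv_one :
    leftTransDeriv EG G (unitChart EG G 1) = ContinuousLinearMap.id ℝ EG := by
  rw [← dOne_unitChart_symm (EG := EG) (G := G), leftTransDeriv, unitChart_symm_one]
  simp [dOne]

/-- The mixed second derivatives of the multiplication agree. -/
theorem hasFDerivAt_leftTransDeriv :
    HasFDerivAt (leftTransDeriv EG G) (rightTransDeriv₂ EG G).flip (unitChart EG G 1) := by
  set e := unitChart EG G 1 with he
  have hμ : ContDiffAt ℝ ∞ (fun z : EG × EG =>
      unitChart EG G ((unitChart EG G).symm z.2 * (unitChart EG G).symm z.1)) (e, e) :=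
    contDiffAt_unitChart_mul (mem_extChartAt_target (I := 𝓘(ℝ, EG)) (1 : G))
  set μ : EG × EG → EG := fun z =>
    unitChart EG G ((unitChart EG G).symm z.2 * (unitChart EG G).symm z.1) with hμdef
  have hd : HasFDerivAt (fderiv ℝ μ) (fderiv ℝ (fderiv ℝ μ) (e, e)) (e, e) :=
    ((hμ.fderiv_right (m := ∞) (by simp)).differentiableAt (by simp)).hasFDerivAt
  have hev : ∀ᶠ z in 𝓝 (e, e), DifferentiableAt ℝ μ z := by
    filter_upwards [(hμ.of_le (m := 1) (by simp)).eventually (by simp)] with z hz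
    exact hz.differentiableAt (by simp)
  have hl : leftTransDeriv EG G =ᶠ[𝓝 e] fun x => fderiv ℝ μ (e, x) ∘L .inl ℝ EG EG := by
    have hc : ContinuousAt (fun x => (e, x)) e := by fun_prop
    filter_upwards [hc.eventually hev] with x hx
    exact (HasFDerivAt.comp e (f := fun y => (y, x)) hx.hasFDerivAt
      (hasFDerivAt_prodMk_left e x)).fderiv
  have hr : rightTransDeriv EG G =ᶠ[𝓝 e] fun y => fderiv ℝ μ (y, e) ∘L .inr ℝ EG EG := by
    have hc : ContinuousAt (fun y => (y, e)) e := by fun_prop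
    filter_upwards [hc.eventually hev] with y hy
    exact (HasFDerivAt.comp e (f := fun x => (y, x)) hy.hasFDerivAt
      (hasFDerivAt_prodMk_right y e)).fderiv
  have h1 := (HasFDerivAt.comp e (f := fun x => (e, x)) hd (hasFDerivAt_prodMk_right e e)).clm_comp
    (hasFDerivAt_const (ContinuousLinearMap.inl ℝ EG EG) e)
  have h2 := (HasFDerivAt.comp e (f := fun x => (x, e)) hd (hasFDerivAt_prodMk_left e e)).clm_comp
    (hasFDerivAt_const (ContinuousLinearMap.inr ℝ EG EG) e)
  have h3 : rightTransDeriv₂ EG G = _ := (h2.congr_of_eventuallyEq hr).fderiv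
  have h4 := h1.congr_of_eventuallyEq hl
  convert! h4 using 1
  rw [h3]
  ext v w
  have hsymm := hμ.isSymmSndFDerivAt (by simpa using ENat.LEInfty.out)
  simpa using hsymm.eq (w, 0) (0, v)

/-- The invariant vector fields in the preferred chart at the unit. -/
theorem mpullbackWithin_mulInvariantVectorField {y : EG} (hy : y ∈ (unitChart EG G).target)
    (v : GroupLieAlgebra 𝓘(ℝ, EG) G) :
    VectorField.mpullbackWithin 𝓘(ℝ, EG) 𝓘(ℝ, EG) (extChartAt 𝓘(ℝ, EG) (1 : G)).symm
      (mulInvariantVectorField v) (Set.range 𝓘(ℝ, EG)) y = leftTransDeriv EG G y v := by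
  have : IsManifold 𝓘(ℝ, EG) 1 G := IsManifold.of_le (n := ∞) (by simp)
  set g := (unitChart EG G).symm y with hg
  have hgs : g ∈ (unitChart EG G).source := (unitChart EG G).map_target hy
  rw [VectorField.mpullbackWithin_apply, ContinuousLinearMap.inverse_eq
    (mfderivWithin_extChartAt_symm_comp_mfderiv_extChartAt hy)
    (mfderiv_extChartAt_comp_mfderivWithin_extChartAt_symm hy)]
  have hm : MDifferentiableAt 𝓘(ℝ, EG) 𝓘(ℝ, EG) (fun x : G => g * x) 1 :=
    (contMDiff_const.mul contMDiff_id).contMDiffAt.mdifferentiableAt (n := ∞) (by simp)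
  have hφ : MDifferentiableAt 𝓘(ℝ, EG) 𝓘(ℝ, EG) (extChartAt 𝓘(ℝ, EG) (1 : G)) (g * 1) := by
    refine mdifferentiableAt_extChartAt ?_
    rw [mul_one, ← extChartAt_source 𝓘(ℝ, EG)]
    exact hgs
  have h2 := hφ.hasMFDerivAt.comp (1 : G) hm.hasMFDerivAt
  have h3 : HasFDerivWithinAt (fun x => unitChart EG G (g * (unitChart EG G).symm x))
      (show EG →L[ℝ] EG from (mfderiv 𝓘(ℝ, EG) 𝓘(ℝ, EG) (extChartAt 𝓘(ℝ, EG) (1 : G)) (g * 1)).comp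
        (mfderiv 𝓘(ℝ, EG) 𝓘(ℝ, EG) (fun x : G => g * x) 1)) Set.univ (unitChart EG G 1) := by
    have h := h2.2
    rw [ModelWithCorners.range_eq_univ] at h
    exact h
  have h4 := DFunLike.congr_fun h3.hasFDerivAt_of_univ.fderiv (show EG from v)
  rw [mul_one] at h4
  exact h4.symm

/-- In coordinates the left-invariant field of `v` is `y ↦ L_y v`, and its derivative at the unit is
`rightTransDeriv₂ EG G v` because mixed second derivatives commute. The chart has identity
differential at the unit, so the bracket is the coordinate one. -/
theorem lieBr_eq (v w : EG) :
    lieBr G v w = rightTransDeriv₂ EG G w v - rightTransDeriv₂ EG G v w := by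
  have : IsManifold 𝓘(ℝ, EG) 1 G := IsManifold.of_le (n := ∞) (by simp)
  set e := unitChart EG G 1 with he
  have hV : ∀ v : GroupLieAlgebra 𝓘(ℝ, EG) G,
      VectorField.mpullbackWithin 𝓘(ℝ, EG) 𝓘(ℝ, EG) (extChartAt 𝓘(ℝ, EG) (1 : G)).symm
      (mulInvariantVectorField v) (Set.range 𝓘(ℝ, EG)) =ᶠ[𝓝 e] fun y => leftTransDeriv EG G y v :=
    fun v => by
      filter_upwards [extChartAt_target_mem_nhds (I := 𝓘(ℝ, EG)) (1 : G)] with y hy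
      exact mpullbackWithin_mulInvariantVectorField hy v
  have hid : mfderiv 𝓘(ℝ, EG) 𝓘(ℝ, EG) (extChartAt 𝓘(ℝ, EG) (1 : G)) 1 =
      ContinuousLinearMap.id ℝ (TangentSpace 𝓘(ℝ, EG) (1 : G)) := by
    have h := (mdifferentiableAt_extChartAt (I := 𝓘(ℝ, EG)) (mem_chart_source EG (1 : G))).hasMFDerivAt.2
    rw [ModelWithCorners.range_eq_univ] at h
    have h' : HasFDerivAt (fun x => unitChart EG G ((unitChart EG G).symm x)) (show EG →L[ℝ] EG from
      mfderiv 𝓘(ℝ, EG) 𝓘(ℝ, EG) (extChartAt 𝓘(ℝ, EG) (1 : G)) 1) e := h.hasFDerivAt_of_univ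
    exact h'.unique ((hasFDerivAt_id (𝕜 := ℝ) e).congr_of_eventuallyEq eventually_unitChart_right_inv)
  have hinv : (mfderiv 𝓘(ℝ, EG) 𝓘(ℝ, EG) (extChartAt 𝓘(ℝ, EG) (1 : G)) 1).inverse =
      ContinuousLinearMap.id ℝ (TangentSpace 𝓘(ℝ, EG) (1 : G)) :=
    ContinuousLinearMap.inverse_eq (by rw [hid]; rfl) (by rw [hid]; rfl)
  have h2 : lieBr G v w = VectorField.lieBracketWithin ℝ
      (VectorField.mpullbackWithin 𝓘(ℝ, EG) 𝓘(ℝ, EG) (extChartAt 𝓘(ℝ, EG) (1 : G)).symm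
        (mulInvariantVectorField (show GroupLieAlgebra 𝓘(ℝ, EG) G from v)) (Set.range 𝓘(ℝ, EG)))
      (VectorField.mpullbackWithin 𝓘(ℝ, EG) 𝓘(ℝ, EG) (extChartAt 𝓘(ℝ, EG) (1 : G)).symm
        (mulInvariantVectorField (show GroupLieAlgebra 𝓘(ℝ, EG) G from w)) (Set.range 𝓘(ℝ, EG)))
      (Set.univ ∩ Set.range 𝓘(ℝ, EG)) e :=
    DFunLike.congr_fun hinv _
  have hd : ∀ v, fderiv ℝ (fun y => leftTransDeriv EG G y v) e = rightTransDeriv₂ EG G v :=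
    fun v => by
      have := (hasFDerivAt_leftTransDeriv (EG := EG) (G := G)).clm_apply (hasFDerivAt_const v _)
      rw [this.fderiv]
      ext
      simp
  rw [h2, Set.univ_inter, (hV v).lieBracketWithin_vectorField_eq_nhds (hV w),
    ModelWithCorners.range_eq_univ, VectorField.lieBracketWithin_univ, VectorField.lieBracket,
    hd, hd]
  simp only [he, leftTransDeriv_one]
  rfl

end MaurerCartan

/-! ### Infinitesimal identities of a crossed module -/

section Infinitesimal

variable {P : Type*} [NormedAddCommGroup P] [NormedSpace ℝ P]
  {EG : Type*} [NormedAddCommGroup EG] [NormedSpace ℝ EG]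
  {G : Type*} [TopologicalSpace G] [ChartedSpace EG G] [Group G] [LieGroup 𝓘(ℝ, EG) ∞ G]
  {EH : Type*} [NormedAddCommGroup EH] [NormedSpace ℝ EH]
  {H : Type*} [TopologicalSpace H] [ChartedSpace EH H] [Group H] [LieGroup 𝓘(ℝ, EH) ∞ H]

variable (G) in
/-- Every element of the Lie algebra is the velocity of a curve. -/
theorem exists_curve_rlog_eq (x : EG) : ∃ β : ℝ → G, ContMDiffAt 𝓘(ℝ, ℝ) 𝓘(ℝ, EG) ∞ β 0 ∧
    β 0 = 1 ∧ rlog (EG := EG) β 0 1 = x := by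
  set e := unitChart EG G 1 with he
  have hf : HasDerivAt (fun r : ℝ => e + r • x) x 0 := by
    simpa using ((hasDerivAt_id (0 : ℝ)).smul_const x).const_add e
  have h0 : e + (0 : ℝ) • x = e := by simp
  have hβ0 : (unitChart EG G).symm (e + (0 : ℝ) • x) = 1 := by rw [h0, he, unitChart_symm_one]
  refine ⟨fun r => (unitChart EG G).symm (e + r • x), ?_, hβ0, ?_⟩
  · refine ContMDiffAt.comp (I' := 𝓘(ℝ, EG)) (0 : ℝ) (g := (unitChart EG G).symm)
      (f := fun r : ℝ => e + r • x) ?_ ?_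
    · rw [h0]
      exact contMDiffAt_unitChart_symm
    · exact ContDiffAt.contMDiffAt (by fun_prop)
  · unfold rlog dOne
    simp only [hβ0, inv_one, mul_one]
    have hev : (fun r : ℝ => unitChart EG G ((unitChart EG G).symm (e + r • x))) =ᶠ[𝓝 0]
        fun r => e + r • x := by
      have hc : Filter.Tendsto (fun r : ℝ => e + r • x) (𝓝 0) (𝓝 e) := by
        have := hf.continuousAt.tendsto
        rwa [h0] at this
      exact hc.eventually eventually_unitChart_right_inv
    rw [hev.fderiv_eq, hf.hasFDerivAt.fderiv]
    simp

variable (C : LieCrossedModule EG G EH H)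

/-- `m̂` as a continuous bilinear map. -/
noncomputable def LieCrossedModule.mHatL (C : LieCrossedModule EG G EH H) : EG →L[ℝ] EH →L[ℝ] EH :=
  fderiv ℝ (fun y => C.mDotL ((unitChart EG G).symm y)) (unitChart EG G 1)

theorem LieCrossedModule.differentiableAt_mDotL :
    DifferentiableAt ℝ (fun y => C.mDotL ((unitChart EG G).symm y)) (unitChart EG G 1) :=
  (C.contDiffAt_mDotL contMDiffAt_unitChart_symm).differentiableAt (by simp)

omit [LieGroup 𝓘(ℝ, EG) ∞ G] [LieGroup 𝓘(ℝ, EH) ∞ H] in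
theorem LieCrossedModule.mDotL_one : C.mDotL 1 = ContinuousLinearMap.id ℝ EH := by
  rw [mDotL, map_one]
  exact tanMap_id

theorem LieCrossedModule.mHat_eq (x : EG) (v : EH) : C.mHat x v = C.mHatL x v := by
  have hd := C.differentiableAt_mDotL.clm_apply (differentiableAt_const v)
  have hfun : (fun a : G => C.mDot a v) = fun a => C.mDotL a v := funext fun a => C.mDot_eq a v
  have hc : ContinuousAt (fun a : G => C.mDotL a v) 1 := by
    have h1 : ContinuousAt (unitChart EG G) 1 := continuousAt_extChartAt (1 : G)
    have h2 := ContinuousAt.comp (f := unitChart EG G) hd.continuousAt h1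
    refine h2.congr ?_
    filter_upwards [eventually_unitChart_symm (EG := EG) (k := fun a : G => a) continuousAt_id rfl]
      with a ha
    rw [Function.comp_apply, ha]
  have hm : MDifferentiableAt 𝓘(ℝ, EG) 𝓘(ℝ, EH) (fun a : G => C.mDotL a v) 1 :=
    (mdifferentiableAt_iff _ _).2 ⟨hc, hd.differentiableWithinAt⟩
  have h := hm.hasMFDerivAt.2
  rw [ModelWithCorners.range_eq_univ] at h
  have h' : HasFDerivAt (fun y => C.mDotL ((unitChart EG G).symm y) v) (show EG →L[ℝ] EH from
    mfderiv 𝓘(ℝ, EG) 𝓘(ℝ, EH) (fun a : G => C.mDotL a v) 1) (unitChart EG G 1) :=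
    h.hasFDerivAt_of_univ
  have h2 := h'.unique (C.differentiableAt_mDotL.hasFDerivAt.clm_apply (hasFDerivAt_const v _))
  rw [LieCrossedModule.mHat, hfun]
  refine (DFunLike.congr_fun h2 x).trans ?_
  simp [mHatL]

/-- The derivative of `ṁ(u)(v)`. -/
theorem LieCrossedModule.hasFDerivAt_mDotL_apply {u : P → G} {p : P}
    (hu : ContMDiffAt 𝓘(ℝ, P) 𝓘(ℝ, EG) ∞ u p) {v : P → EH} {v' : P →L[ℝ] EH}
    (hv : HasFDerivAt v v' p) :
    HasFDerivAt (fun q => C.mDotL (u q) (v q)) (C.mHatL.flip (C.mDotL (u p) (v p)) ∘L rlog u p +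
      C.mDotL (u p) ∘L v') p := by
  have h1 := fderiv_comp_unitChart (EG := EG) (ψ := C.mDotL) (p := p)
    (k := fun q => u q * (u p)⁻¹) C.differentiableAt_mDotL
    (contMDiffAt_mul (n := 1) (hu.of_le (by simp)) contMDiffAt_const) (by simp)
  have h2 := h1.clm_apply ((C.mDotL (u p)).hasFDerivAt.comp p hv)
  -- Splitting off `ṁ(u p)` leaves an argument that passes through the unit at `p`, where the
  -- derivative of `ṁ` is `mHatL`.
  have h3 : (fun q => C.mDotL (u q * (u p)⁻¹) (C.mDotL (u p) (v q))) =
      fun q => C.mDotL (u q) (v q) := by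
    ext q
    rw [← ContinuousLinearMap.comp_apply, ← C.mDotL_mul, inv_mul_cancel_right]
  have h4 := h2.congr_of_eventuallyEq (Filter.EventuallyEq.of_eq h3.symm)
  convert! h4 using 1
  ext X
  simp [C.mDotL_one, mHatL, rlog, add_comm]

variable (EG G) in
/-- The crossed module of a Lie group acting on itself by conjugation. -/
def conjModule : LieCrossedModule EG G EG G where
  t := MonoidHom.id G
  m := MulAut.conj
  smooth_t := contMDiff_id
  smooth_m := (contMDiff_fst.mul contMDiff_snd).mul contMDiff_fst.inv
  t_m _ _ := rfl
  m_t _ _ := rfl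

/-- Regarding conjugation as a crossed module makes the adjoint action an instance of `mDotL` and
its differential one of `mHatL`; the derivative rules then serve both. -/
theorem conjModule_mDotL (a : G) : (conjModule EG G).mDotL a = lieAd EG a := rfl

theorem rlog_curve_mul {u v : ℝ → G} {s r : ℝ} (hu : ContMDiffAt 𝓘(ℝ, ℝ) 𝓘(ℝ, EG) 1 u s)
    (hv : ContMDiffAt 𝓘(ℝ, ℝ) 𝓘(ℝ, EG) 1 v r) (z : ℝ × ℝ) :
    rlog (EG := EG) (fun q : ℝ × ℝ => u q.1 * v q.2) (s, r) z =
      z.1 • rlog u s 1 + lieAd EG (u s) (z.2 • rlog v r 1) := by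
  rw [rlog_mul (u := fun q : ℝ × ℝ => u q.1) (v := fun q : ℝ × ℝ => v q.2)
    (ContMDiffAt.comp (I' := 𝓘(ℝ, ℝ)) (s, r) (f := fun q : ℝ × ℝ => q.1) hu
      contDiff_fst.contMDiff.contMDiffAt)
    (ContMDiffAt.comp (I' := 𝓘(ℝ, ℝ)) (s, r) (f := fun q : ℝ × ℝ => q.2) hv
      contDiff_snd.contMDiff.contMDiffAt),
    rlog_comp (f := fun q : ℝ × ℝ => q.1) hu hasFDerivAt_fst,
    rlog_comp (f := fun q : ℝ × ℝ => q.2) hv hasFDerivAt_snd]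
  simp only [add_apply, ContinuousLinearMap.comp_apply,
    ContinuousLinearMap.coe_fst', ContinuousLinearMap.coe_snd', ← map_smul, smul_eq_mul, mul_one]

/-- The bracket is the differential of the adjoint action. -/
theorem lieBr_eq_mHatL (v w : EG) : lieBr G v w = (conjModule EG G).mHatL v w := by
  obtain ⟨β, hβ, hβ0, hβv⟩ := exists_curve_rlog_eq G v
  obtain ⟨ζ, hζ, hζ0, hζw⟩ := exists_curve_rlog_eq G w
  -- For this product `rlog` is constantly `v` in the first direction along the second axis, and
  -- `Ad(β s) w` in the second direction along the first axis. The Maurer-Cartan formula at the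
  -- origin then equates the bracket with the derivative of `Ad`.
  set U : ℝ × ℝ → G := fun q => β q.1 * ζ q.2 with hU
  have hUs : ContMDiffAt 𝓘(ℝ, ℝ × ℝ) 𝓘(ℝ, EG) ∞ U (0, 0) :=
    contMDiffAt_mul (n := ⊤)
      (ContMDiffAt.comp (I' := 𝓘(ℝ, ℝ)) (0, 0) (f := fun q : ℝ × ℝ => q.1) hβ
        contDiff_fst.contMDiff.contMDiffAt)
      (ContMDiffAt.comp (I' := 𝓘(ℝ, ℝ)) (0, 0) (f := fun q : ℝ × ℝ => q.2) hζ
        contDiff_snd.contMDiff.contMDiffAt)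
  have hβ1 := (contMDiffAt_iff_contMDiffAt_nhds (by simp)).1 (hβ.of_le (m := 1) (by simp))
  have hζ1 := (contMDiffAt_iff_contMDiffAt_nhds (by simp)).1 (hζ.of_le (m := 1) (by simp))
  have hd := ((contDiffAt_rlog hUs).differentiableAt (by simp)).hasFDerivAt
  have hX : fderiv ℝ (rlog (EG := EG) U) (0, 0) (1, 0) (0, 1) = (conjModule EG G).mHatL v w := by
    have h1 := (HasFDerivAt.comp (0 : ℝ) (f := fun s : ℝ => (s, (0 : ℝ))) hd
      (hasFDerivAt_prodMk_left 0 0)).clm_apply (hasFDerivAt_const ((0 : ℝ), (1 : ℝ)) (0 : ℝ))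
    have h2 := (conjModule EG G).hasFDerivAt_mDotL_apply hβ (hasFDerivAt_const w 0)
    have h3 : (fun s : ℝ => rlog (EG := EG) U (s, 0) (0, 1)) =ᶠ[𝓝 0]
        fun s => (conjModule EG G).mDotL (β s) w := by
      filter_upwards [hβ1] with s hs
      rw [hU, rlog_curve_mul hs hζ1.self_of_nhds, hζw]
      simp [conjModule_mDotL]
    have h4 := DFunLike.congr_fun (h1.unique (h2.congr_of_eventuallyEq h3)) 1
    simpa [hβ0, hβv, LieCrossedModule.mDotL_one] using h4
  have hY : fderiv ℝ (rlog (EG := EG) U) (0, 0) (0, 1) (1, 0) = 0 := by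
    have h1 := (HasFDerivAt.comp (0 : ℝ) (f := fun s : ℝ => ((0 : ℝ), s)) hd
      (hasFDerivAt_prodMk_right 0 0)).clm_apply (hasFDerivAt_const ((1 : ℝ), (0 : ℝ)) (0 : ℝ))
    have h3 : (fun s : ℝ => rlog (EG := EG) U (0, s) (1, 0)) =ᶠ[𝓝 0] fun _ => v := by
      filter_upwards [hζ1] with s hs
      rw [hU, rlog_curve_mul hβ1.self_of_nhds hs, hβv]
      simp
    have h4 := DFunLike.congr_fun (h1.unique ((hasFDerivAt_const v 0).congr_of_eventuallyEq h3)) 1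
    simpa using h4
  have hr : ∀ z, rlog (EG := EG) U (0, 0) z = z.1 • v + z.2 • w := fun z => by
    rw [hU, rlog_curve_mul hβ1.self_of_nhds hζ1.self_of_nhds, hβ0, lieAd_one, hβv, hζw]
    rfl
  have := fderiv_rlog_sub hUs (1, 0) (0, 1)
  rw [hX, hY, hr, hr] at this
  rw [lieBr_eq]
  simpa using this.symm

/-- The Maurer-Cartan equation. -/
theorem fderiv_rlog_sub_eq_lieBr {u : P → G} {p : P} (hu : ContMDiffAt 𝓘(ℝ, P) 𝓘(ℝ, EG) ∞ u p)
    (X Y : P) : fderiv ℝ (rlog (EG := EG) u) p X Y - fderiv ℝ (rlog (EG := EG) u) p Y X =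
      lieBr G (rlog u p X) (rlog u p Y) := by
  rw [fderiv_rlog_sub hu, lieBr_eq]

theorem lieBr_swap (v w : EG) : lieBr G v w = - lieBr G w v := by
  rw [lieBr_eq, lieBr_eq, neg_sub]

/-- `ṫ` as a continuous linear map. -/
noncomputable def LieCrossedModule.tDotL (C : LieCrossedModule EG G EH H) : EH →L[ℝ] EG := tanMap C.t

omit [LieGroup 𝓘(ℝ, EG) ∞ G] [LieGroup 𝓘(ℝ, EH) ∞ H] in
theorem LieCrossedModule.tDot_eq (v : EH) : C.tDot v = C.tDotL v :=
  mfderiv_eq_tanMap (C.smooth_t.contMDiffAt.mdifferentiableAt (by simp)) (map_one _) v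

theorem LieCrossedModule.rlog_t {u : P → H} {p : P} (hu : ContMDiffAt 𝓘(ℝ, P) 𝓘(ℝ, EH) 1 u p) :
    rlog (EG := EG) (fun q => C.t (u q)) p = C.tDotL ∘L rlog u p := by
  unfold rlog
  simp only [← map_inv, ← map_mul]
  exact dOne_comp (ψ := C.t) (k := fun q => u q * (u p)⁻¹)
    (C.smooth_t.contMDiffAt.of_le (by simp)) (map_one _)
    (contMDiffAt_mul (n := 1) hu contMDiffAt_const) (by simp)

/-- The infinitesimal Peiffer identity: differentiate `m (t (β r)) = conj (β r)` along a curve with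
velocity `w`. -/
theorem LieCrossedModule.mHatL_tDotL (w v : EH) : C.mHatL (C.tDotL w) v = lieBr H w v := by
  obtain ⟨β, hβ, hβ0, hβw⟩ := exists_curve_rlog_eq H w
  have ht : ContMDiffAt 𝓘(ℝ, ℝ) 𝓘(ℝ, EG) ∞ (fun r => C.t (β r)) 0 :=
    C.smooth_t.contMDiffAt.comp (0 : ℝ) hβ
  have h1 := C.hasFDerivAt_mDotL_apply ht (hasFDerivAt_const v 0)
  have h2 := (conjModule EH H).hasFDerivAt_mDotL_apply hβ (hasFDerivAt_const v 0)
  have h3 : (fun r => C.mDotL (C.t (β r)) v) = fun r => (conjModule EH H).mDotL (β r) v := by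
    ext r
    simp only [LieCrossedModule.mDotL, C.m_t]
    rfl
  rw [h3] at h1
  have h4 := DFunLike.congr_fun (h1.unique h2) 1
  rw [C.rlog_t (hβ.of_le (by simp))] at h4
  rw [lieBr_eq_mHatL]
  simpa [hβ0, hβw, LieCrossedModule.mDotL_one] using h4

/-- Infinitesimal equivariance, by differentiating the two expressions of `t ∘ m a` given by `t_m`.
-/
theorem LieCrossedModule.tDotL_mDotL (a : G) (v : EH) :
    C.tDotL (C.mDotL a v) = lieAd EG a (C.tDotL v) := by
  have ht : ContMDiffAt 𝓘(ℝ, EH) 𝓘(ℝ, EG) 1 C.t 1 := C.smooth_t.contMDiffAt.of_le (by simp)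
  have hm : ContMDiffAt 𝓘(ℝ, EH) 𝓘(ℝ, EH) 1 (fun B => C.m a B) 1 :=
    (C.contMDiff_m a).contMDiffAt.of_le (by simp)
  have hc : ContMDiffAt 𝓘(ℝ, EG) 𝓘(ℝ, EG) 1 (fun x => a * x * a⁻¹) 1 :=
    (contMDiff_conj a).contMDiffAt.of_le (by simp)
  have h1 := tanMap_comp (ψ := C.t) ht (map_one _) hm (map_one _)
  have h2 := tanMap_comp (ψ := fun x => a * x * a⁻¹) hc (by simp) ht (map_one _)
  have h3 : (fun B => C.t (C.m a B)) = fun B => a * C.t B * a⁻¹ := funext fun B => C.t_m a B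
  rw [h3] at h1
  exact DFunLike.congr_fun (h1.symm.trans h2) v

/-- Differentiate `ṁ(a) ṁ(β r) = ṁ(a β r a⁻¹) ṁ(a)` along a curve with velocity `x`. -/
theorem LieCrossedModule.mDotL_mHatL (a : G) (x : EG) (v : EH) :
    C.mDotL a (C.mHatL x v) = C.mHatL (lieAd EG a x) (C.mDotL a v) := by
  obtain ⟨β, hβ, hβ0, hβx⟩ := exists_curve_rlog_eq G x
  have hβ1 := hβ.of_le (m := 1) (by simp)
  have h1 := (C.mDotL a).hasFDerivAt.comp 0 (C.hasFDerivAt_mDotL_apply hβ (hasFDerivAt_const v 0))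
  have hα : ContMDiffAt 𝓘(ℝ, ℝ) 𝓘(ℝ, EG) ∞ (fun r => a * β r * a⁻¹) 0 :=
    contMDiffAt_mul (n := ⊤) (contMDiffAt_mul (n := ⊤) contMDiffAt_const hβ) contMDiffAt_const
  have h2 := C.hasFDerivAt_mDotL_apply hα (hasFDerivAt_const (C.mDotL a v) 0)
  have h3 : (fun r => C.mDotL (a * β r * a⁻¹) (C.mDotL a v)) =
      C.mDotL a ∘ fun r => C.mDotL (β r) v := by
    ext r
    rw [← ContinuousLinearMap.comp_apply, ← C.mDotL_mul, inv_mul_cancel_right, C.mDotL_mul]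
    rfl
  rw [h3, rlog_mul_const, rlog_mul (contMDiffAt_const (c := a)) hβ1, rlog_const] at h2
  have h4 := DFunLike.congr_fun (h1.unique h2) 1
  simpa [hβ0, hβx, LieCrossedModule.mDotL_one] using h4

theorem lieAd_lieBr (a : G) (v w : EG) :
    lieAd EG a (lieBr G v w) = lieBr G (lieAd EG a v) (lieAd EG a w) := by
  rw [lieBr_eq_mHatL, lieBr_eq_mHatL]
  exact (conjModule EG G).mDotL_mHatL a v w

end Infinitesimal

/-! ### Integration of flat forms and pulled-back structure equations -/

section Flatness

variable {P : Type*} [NormedAddCommGroup P] [NormedSpace ℝ P]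
  {F : Type*} [NormedAddCommGroup F] [NormedSpace ℝ F]
  {E : Type*} [NormedAddCommGroup E] [NormedSpace ℝ E]
  {M : Type*} [TopologicalSpace M] [ChartedSpace E M]
  {EG : Type*} [NormedAddCommGroup EG] [NormedSpace ℝ EG]
  {G : Type*} [TopologicalSpace G] [ChartedSpace EG G] [Group G]
  {EH : Type*} [NormedAddCommGroup EH] [NormedSpace ℝ EH]
  {H : Type*} [TopologicalSpace H] [ChartedSpace EH H] [Group H]

theorem eq_of_fderiv_apply_eq {f g : P → F} (hf : Differentiable ℝ f) (hg : Differentiable ℝ g)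
    {X : P} (h : ∀ q, fderiv ℝ f q X = fderiv ℝ g q X) {p : P} (h0 : f p = g p) (t : ℝ) :
    f (p + t • X) = g (p + t • X) := by
  have hd : ∀ s : ℝ, HasDerivAt (fun s : ℝ => f (p + s • X) - g (p + s • X)) 0 s := fun s => by
    have hl : HasDerivAt (fun s : ℝ => p + s • X) X s := by
      simpa using ((hasDerivAt_id s).smul_const X).const_add p
    have := ((hf (p + s • X)).hasFDerivAt.comp_hasDerivAt s hl).sub
      ((hg (p + s • X)).hasFDerivAt.comp_hasDerivAt s hl)
    rwa [h, sub_self] at this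
  have := is_const_of_deriv_eq_zero (fun s => (hd s).differentiableAt) (fun s => (hd s).deriv) t 0
  simpa [h0, sub_eq_zero] using this

theorem fderiv_apply_const {L : P → P →L[ℝ] F} {q : P} (hL : DifferentiableAt ℝ L q) (X Y : P) :
    fderiv ℝ (fun p => L p Y) q X = fderiv ℝ L q X Y := by
  rw [(hL.hasFDerivAt.clm_apply (hasFDerivAt_const Y q)).fderiv]
  simp

variable [LieGroup 𝓘(ℝ, EG) ∞ G]

/-- A map from the plane whose logarithmic derivative agrees with a flat form in the direction of `x`,
and in the direction of `y` on one vertical line, agrees with it everywhere. -/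
theorem rlog_eq_of_flat {u : ℝ × ℝ → G} (hu : ContMDiff 𝓘(ℝ, ℝ × ℝ) 𝓘(ℝ, EG) ∞ u)
    {αx αy : ℝ × ℝ → EG} (hαy : Differentiable ℝ αy) (hx : ∀ q, rlog u q (1, 0) = αx q)
    (hflat : ∀ q, fderiv ℝ αy q (1, 0) - fderiv ℝ αx q (0, 1) = lieBr G (αx q) (αy q))
    {x₀ : ℝ} (h0 : ∀ y, rlog u (x₀, y) (0, 1) = αy (x₀, y)) (q : ℝ × ℝ) :
    rlog u q (0, 1) = αy q := by
  have hr : ∀ q, DifferentiableAt ℝ (rlog (EG := EG) u) q := fun q =>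
    (contDiffAt_rlog (hu q)).differentiableAt (by simp)
  have hδ : ∀ q, HasFDerivAt (fun q => rlog u q (0, 1) - αy q)
      (fderiv ℝ (fun q => rlog u q (0, 1)) q - fderiv ℝ αy q) q := fun q =>
    ((hr q).clm_apply (differentiableAt_const _)).hasFDerivAt.sub (hαy q).hasFDerivAt
  -- Let `δ` be the difference of the two sides. Maurer-Cartan and flatness give `∂ₓδ = [αx, δ]`, so
  -- `Ad(u⁻¹) δ` has zero `x`-derivative; it vanishes at `x₀` and hence everywhere.
  have hη : ∀ q, HasFDerivAt (fun q => lieAd EG (u q)⁻¹ (rlog u q (0, 1) - αy q)) _ q := fun q =>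
    (conjModule EG G).hasFDerivAt_mDotL_apply (contMDiffAt_inv (n := ⊤) (hu q)) (hδ q)
  have key := eq_of_fderiv_apply_eq (X := ((1 : ℝ), (0 : ℝ))) (p := (x₀, q.2))
    (fun q => (hη q).differentiableAt) (differentiable_const (0 : EG)) (fun p => by
      have hMC := fderiv_rlog_sub_eq_lieBr (hu p) (1, 0) (0, 1)
      rw [← fderiv_apply_const (hr p), ← fderiv_apply_const (hr p), hx p] at hMC
      simp only [hx] at hMC
      rw [(hη p).fderiv, rlog_inv ((hu p).of_le (by simp))]
      simp only [add_apply, sub_apply, ContinuousLinearMap.comp_apply, neg_apply,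
        ContinuousLinearMap.flip_apply, conjModule_mDotL, ← lieBr_eq_mHatL, hx]
      rw [lieBr_eq_mHatL, map_neg, neg_apply, ← lieBr_eq_mHatL, ← lieAd_lieBr, ← map_neg, ← map_add]
      have h1 : fderiv ℝ (fun q => rlog u q (0, 1)) p (1, 0) - fderiv ℝ αy p (1, 0) =
          lieBr G (αx p) (rlog u p (0, 1)) - lieBr G (αx p) (αy p) := by
        rw [← hMC, ← hflat p]
        abel
      rw [h1]
      simp [lieBr_eq_mHatL]) (by simp [h0]) (q.1 - x₀)
  have hq : ((x₀, q.2) : ℝ × ℝ) + (q.1 - x₀) • (1, 0) = q := by ext <;> simp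
  rw [hq] at key
  have := congrArg (lieAd EG (u q)) key
  rw [lieAd_apply_inv, map_zero] at this
  exact sub_eq_zero.1 this

variable [LieGroup 𝓘(ℝ, EH) ∞ H] [IsManifold 𝓘(ℝ, E) ∞ M] {C : LieCrossedModule EG G EH H}
  (D : ConnDoublet E M C)

omit [LieGroup 𝓘(ℝ, EG) ∞ G] [LieGroup 𝓘(ℝ, EH) ∞ H] in
/-- The pull-back of the exterior derivative of a `1`-form. -/
theorem DiffForm.fderiv_pullForm_sub (η : DiffForm E M F 1) {K : P → M}
    (hK : ContMDiff 𝓘(ℝ, P) 𝓘(ℝ, E) ∞ K) (q X Y : P) :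
    fderiv ℝ (fun q => pullForm η K q ![Y]) q X - fderiv ℝ (fun q => pullForm η K q ![X]) q Y =
      η.dval (K q) ![modelDeriv E K q X, modelDeriv E K q Y] := by
  have h1 := extDeriv_apply (differentiableAt_pullForm η hK q) ![X, Y]
  rw [extDeriv_pullForm η hK] at h1
  have h3 : (η.dval (K q)).compContinuousLinearMap (modelDeriv E K q) ![X, Y] =
      η.dval (K q) ![modelDeriv E K q X, modelDeriv E K q Y] := by
    rw [ContinuousAlternatingMap.compContinuousLinearMap_apply]
    congr 1
    ext i
    fin_cases i <;> rfl
  refine Eq.trans ?_ (h1.symm.trans h3)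
  have e0 : (0 : Fin 2).removeNth ![X, Y] = ![Y] := by ext i; fin_cases i; rfl
  have e1 : (1 : Fin 2).removeNth ![X, Y] = ![X] := by ext i; fin_cases i; rfl
  rw [Fin.sum_univ_two, e0, e1]
  simp [sub_eq_add_neg]

omit [LieGroup 𝓘(ℝ, EG) ∞ G] [LieGroup 𝓘(ℝ, EH) ∞ H] in
/-- The pull-back of the equation `dθ + ½[θ, θ] = ṫ(Υ)`. -/
theorem ConnDoublet.fderiv_pullForm_sub {K : P → M} (hK : ContMDiff 𝓘(ℝ, P) 𝓘(ℝ, E) ∞ K) (q X Y : P) :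
    fderiv ℝ (fun q => pullForm D.θ K q ![Y]) q X - fderiv ℝ (fun q => pullForm D.θ K q ![X]) q Y +
      lieBr G (pullForm D.θ K q ![X]) (pullForm D.θ K q ![Y]) =
      C.tDotL (pullForm D.Υ K q ![X, Y]) := by
  have h2 := D.fake_flat (K q) (modelDeriv E K q X) (modelDeriv E K q Y)
  rw [C.tDot_eq, sub_eq_zero] at h2
  rw [D.θ.fderiv_pullForm_sub hK, pullForm_one, pullForm_one, pullForm_two]
  exact h2

/-- The `3`-form `dΥ + [θ, Υ]`. -/
noncomputable def ConnDoublet.curvature (D : ConnDoublet E M C) (p : M) (v₁ v₂ v₃ : E) : EH :=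
  D.Υ.dval p ![v₁, v₂, v₃] + (C.mHatL (D.θ.val p ![v₁]) (D.Υ.val p ![v₂, v₃]) -
    C.mHatL (D.θ.val p ![v₂]) (D.Υ.val p ![v₁, v₃]) +
    C.mHatL (D.θ.val p ![v₃]) (D.Υ.val p ![v₁, v₂]))

omit [IsManifold 𝓘(ℝ, E) ∞ M] in
theorem ConnDoublet.IsFlat.curvature_eq_zero {D : ConnDoublet E M C} (hD : D.IsFlat) (p : M)
    (v₁ v₂ v₃ : E) : D.curvature p v₁ v₂ v₃ = 0 := by
  have h := hD p v₁ v₂ v₃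
  simp only [C.mHat_eq] at h
  exact h

omit [LieGroup 𝓘(ℝ, EG) ∞ G] [LieGroup 𝓘(ℝ, EH) ∞ H] in
/-- The pull-back of the `3`-form `dΥ + [θ, Υ]`. -/
theorem ConnDoublet.fderiv_pullForm_sub_add {K : P → M} (hK : ContMDiff 𝓘(ℝ, P) 𝓘(ℝ, E) ∞ K)
    (q X Y Z : P) :
    fderiv ℝ (fun q => pullForm D.Υ K q ![Y, Z]) q X -
      fderiv ℝ (fun q => pullForm D.Υ K q ![X, Z]) q Y +
      fderiv ℝ (fun q => pullForm D.Υ K q ![X, Y]) q Z +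
      (C.mHatL (pullForm D.θ K q ![X]) (pullForm D.Υ K q ![Y, Z]) -
        C.mHatL (pullForm D.θ K q ![Y]) (pullForm D.Υ K q ![X, Z]) +
        C.mHatL (pullForm D.θ K q ![Z]) (pullForm D.Υ K q ![X, Y])) =
      D.curvature (K q) (modelDeriv E K q X) (modelDeriv E K q Y) (modelDeriv E K q Z) := by
  have h1 := extDeriv_apply (differentiableAt_pullForm D.Υ hK q) ![X, Y, Z]
  rw [extDeriv_pullForm D.Υ hK] at h1
  have h3 : (D.Υ.dval (K q)).compContinuousLinearMap (modelDeriv E K q) ![X, Y, Z] =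
      D.Υ.dval (K q) ![modelDeriv E K q X, modelDeriv E K q Y, modelDeriv E K q Z] := by
    rw [ContinuousAlternatingMap.compContinuousLinearMap_apply]
    congr 1
    ext i
    fin_cases i <;> rfl
  have e0 : (0 : Fin 3).removeNth ![X, Y, Z] = ![Y, Z] := by ext i; fin_cases i <;> rfl
  have e1 : (1 : Fin 3).removeNth ![X, Y, Z] = ![X, Z] := by ext i; fin_cases i <;> rfl
  have e2 : (2 : Fin 3).removeNth ![X, Y, Z] = ![X, Y] := by ext i; fin_cases i <;> rfl
  rw [ConnDoublet.curvature, ← h3, h1, Fin.sum_univ_three, e0, e1, e2]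
  simp only [pullForm_one, pullForm_two]
  simp [sub_eq_add_neg]

end Flatness

/-! ### Alternating and bilinear maps on dependent vectors -/

section LinearDependence

variable {P : Type*} [NormedAddCommGroup P] [NormedSpace ℝ P]
  {E : Type*} [NormedAddCommGroup E] [NormedSpace ℝ E]
  {F : Type*} [NormedAddCommGroup F] [NormedSpace ℝ F]
  {F₁ : Type*} [NormedAddCommGroup F₁] [NormedSpace ℝ F₁]
  {F₂ : Type*} [NormedAddCommGroup F₂] [NormedSpace ℝ F₂] {n m : ℕ}

theorem not_linearIndependent_of_rank_le {L : P →L[ℝ] E} (h : L.toLinearMap.rank ≤ n) (hnm : n < m)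
    (e : Fin m → P) : ¬ LinearIndependent ℝ (fun i => L (e i)) := by
  intro hli
  have h1 : LinearIndependent ℝ (fun i => L.toLinearMap.rangeRestrict (e i)) :=
    LinearIndependent.of_comp (LinearMap.range L.toLinearMap).subtype hli
  have h2 := h1.cardinal_lift_le_rank
  have h3 : (Cardinal.lift (Cardinal.mk (Fin m)) : Cardinal) ≤ n :=
    h2.trans (Cardinal.lift_le_nat_iff.2 h)
  simp only [Cardinal.mk_fin, Cardinal.lift_natCast, Nat.cast_le] at h3
  omega

theorem alternating_eq_zero (f : E [⋀^Fin n]→L[ℝ] F) {v : Fin n → E} (h : ¬ LinearIndependent ℝ v) :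
    f v = 0 :=
  f.toAlternatingMap.map_linearDependent v h

theorem alternating_one_smul (f : E [⋀^Fin 1]→L[ℝ] F) (c : ℝ) (v : E) : f ![c • v] = c • f ![v] :=
  f.toContinuousMultilinearMap.cons_smul ![] c v

theorem alternating_one_add (f : E [⋀^Fin 1]→L[ℝ] F) (v w : E) : f ![v + w] = f ![v] + f ![w] :=
  f.toContinuousMultilinearMap.cons_add ![] v w

theorem alternating_one_zero (f : E [⋀^Fin 1]→L[ℝ] F) : f ![0] = 0 :=
  f.map_coord_zero 0 rfl

theorem alternating_two_smul (f : E [⋀^Fin 2]→L[ℝ] F) (c : ℝ) (v w : E) :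
    f ![c • v, w] = c • f ![v, w] :=
  f.toContinuousMultilinearMap.cons_smul ![w] c v

theorem alternating_two_add (f : E [⋀^Fin 2]→L[ℝ] F) (v v' w : E) :
    f ![v + v', w] = f ![v, w] + f ![v', w] :=
  f.toContinuousMultilinearMap.cons_add ![w] v v'

theorem alternating_two_self (f : E [⋀^Fin 2]→L[ℝ] F) (v : E) : f ![v, v] = 0 :=
  f.map_eq_zero_of_eq _ (i := 0) (j := 1) rfl (by simp)

theorem alternating_two_swap (f : E [⋀^Fin 2]→L[ℝ] F) (v w : E) : f ![w, v] = - f ![v, w] := by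
  have h1 := f.map_swap ![v, w] (i := 0) (j := 1) (by simp)
  refine Eq.trans (congrArg f ?_) h1
  ext i
  fin_cases i <;> rfl

/-- One of the vectors is a multiple of the other, and the scalar moves freely between the two
arguments; homogeneity of `f` and `g` is enough. -/
theorem bilinear_comm_of_not_linearIndependent (b : F₁ →L[ℝ] F₂ →L[ℝ] F) {f : E → F₁} {g : E → F₂}
    (hf : ∀ (c : ℝ) v, f (c • v) = c • f v) (hg : ∀ (c : ℝ) v, g (c • v) = c • g v) {v w : E}
    (h : ¬ LinearIndependent ℝ ![v, w]) : b (f v) (g w) = b (f w) (g v) := by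
  have h0 : ¬ ∀ s t : ℝ, s • v + t • w = 0 → s = 0 ∧ t = 0 := fun h' =>
    h (LinearIndependent.pair_iff.2 h')
  push Not at h0
  obtain ⟨s, t, hst, hne⟩ := h0
  have key : ∀ {v w : E} {s t : ℝ}, s ≠ 0 → s • v + t • w = 0 → b (f v) (g w) = b (f w) (g v) := by
    intro v w s t hs hst
    have : v = (-(s⁻¹ * t)) • w := by
      rw [neg_smul, mul_smul, ← sub_eq_zero, sub_neg_eq_add,
        ← smul_right_injective E hs |>.eq_iff, smul_add, smul_inv_smul₀ hs, hst, smul_zero]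
    rw [this, hf, hg]
    simp
  by_cases hs : s = 0
  · exact (key (hne hs) ((add_comm _ _).trans hst)).symm
  · exact key hs hst

end LinearDependence

/-! ### Thin surfaces and invariance of the `1`-transport -/

section Thin

variable {E : Type*} [NormedAddCommGroup E] [NormedSpace ℝ E]
  {M : Type*} [TopologicalSpace M] [ChartedSpace E M] [IsManifold 𝓘(ℝ, E) ∞ M]
  {EG : Type*} [NormedAddCommGroup EG] [NormedSpace ℝ EG]
  {G : Type*} [TopologicalSpace G] [ChartedSpace EG G] [Group G] [LieGroup 𝓘(ℝ, EG) ∞ G]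
  {EH : Type*} [NormedAddCommGroup EH] [NormedSpace ℝ EH]
  {H : Type*} [TopologicalSpace H] [ChartedSpace EH H] [Group H] [LieGroup 𝓘(ℝ, EH) ∞ H]
  {V : Type*} [NormedAddCommGroup V] [NormedSpace ℝ V]
  {C : LieCrossedModule EG G EH H} (D : ConnDoublet E M C)

omit [LieGroup 𝓘(ℝ, EG) ∞ G] [LieGroup 𝓘(ℝ, EH) ∞ H] [IsManifold 𝓘(ℝ, E) ∞ M] in
-- Both `dΥ` and the cyclic expression `[θ, Υ]` are alternating in their three arguments. For the
-- latter this is checked by hand, with the first vector a combination of the others; the remaining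
-- cases follow by transposition.
theorem ConnDoublet.curvature_eq_zero_of_not_linearIndependent (p : M) {v : Fin 3 → E}
    (h : ¬ LinearIndependent ℝ v) : D.curvature p (v 0) (v 1) (v 2) = 0 := by
  have h0 : D.Υ.dval p ![v 0, v 1, v 2] = 0 := by
    have hv : ![v 0, v 1, v 2] = v := by ext i; fin_cases i <;> rfl
    rw [hv]
    exact alternating_eq_zero _ h
  rw [ConnDoublet.curvature, h0, zero_add]
  rw [Fintype.linearIndependent_iff] at h
  push Not at h
  obtain ⟨g, hg, j, hj⟩ := h
  rw [Fin.sum_univ_three] at hg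
  generalize v 0 = X at *
  generalize v 1 = Y at *
  generalize v 2 = Z at *
  set θ := D.θ.val p
  set Υ := D.Υ.val p
  have key : ∀ {X Y Z : E} {a b c : ℝ}, a ≠ 0 → a • X + b • Y + c • Z = 0 →
      C.mHatL (θ ![X]) (Υ ![Y, Z]) - C.mHatL (θ ![Y]) (Υ ![X, Z]) +
        C.mHatL (θ ![Z]) (Υ ![X, Y]) = 0 := by
    intro X Y Z a b c ha habc
    obtain ⟨β, γ, rfl⟩ : ∃ β γ : ℝ, X = β • Y + γ • Z := by
      refine ⟨-(a⁻¹ * b), -(a⁻¹ * c), ?_⟩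
      rw [← (smul_right_injective E ha).eq_iff]
      simp only [smul_add, smul_neg, neg_smul, mul_smul, smul_inv_smul₀ ha]
      rw [← sub_eq_zero, ← habc]
      abel
    simp only [alternating_one_add, alternating_one_smul, alternating_two_add,
      alternating_two_smul, alternating_two_self, alternating_two_swap Υ Y Z]
    simp only [map_add, map_smul, map_neg, add_apply, smul_apply, smul_zero, zero_add,
      add_zero, smul_neg]
    abel
  fin_cases j
  · exact key hj hg
  · have := key (X := Y) (Y := X) (Z := Z) hj (b := g 0) (c := g 2) (by rw [← hg]; simp only [Fin.mk_one]; abel)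
    rw [alternating_two_swap Υ X Y, map_neg] at this
    rw [← neg_eq_zero, ← this]
    abel
  · have := key (X := Z) (Y := X) (Z := Y) hj (b := g 0) (c := g 1) (by rw [← hg]; simp only [Fin.reduceFinMk]; abel)
    rw [alternating_two_swap Υ Y Z, alternating_two_swap Υ X Z, map_neg, map_neg] at this
    rw [← this]
    abel

omit [LieGroup 𝓘(ℝ, EG) ∞ G] [LieGroup 𝓘(ℝ, EH) ∞ H] [IsManifold 𝓘(ℝ, E) ∞ M] in
theorem pullX_eq_modelDeriv_line (η : DiffForm E M V 1) {S : ℝ × ℝ → M}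
    (hS : ContMDiff 𝓘(ℝ, ℝ × ℝ) 𝓘(ℝ, E) ∞ S) (x y : ℝ) :
    pullX η S (x, y) = η.val (S (x, y)) ![modelDeriv E (fun s => S (s, y)) x 1] := by
  rw [pullX_eq, modelDeriv_comp (K := S) (f := fun s => (s, y)) ((hS _).of_le (by simp))
    (hasFDerivAt_prodMk_left x y)]
  rfl

omit [LieGroup 𝓘(ℝ, EG) ∞ G] [LieGroup 𝓘(ℝ, EH) ∞ H] [IsManifold 𝓘(ℝ, E) ∞ M] in
theorem pullY_eq_zero (η : DiffForm E M V 1) {S : ℝ × ℝ → M}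
    (hS : ContMDiff 𝓘(ℝ, ℝ × ℝ) 𝓘(ℝ, E) ∞ S) {x : ℝ} {p : M} (h : ∀ y, S (x, y) = p) (y : ℝ) :
    pullY η S (x, y) = 0 := by
  have h1 := modelDeriv_comp (K := S) (f := fun s => (x, s)) ((hS (x, y)).of_le (by simp))
    (hasFDerivAt_prodMk_right x y)
  simp only [h, modelDeriv_const] at h1
  have h2 : modelDeriv E S (x, y) (0, 1) = 0 := (DFunLike.congr_fun h1 1).symm
  rw [pullY_eq, h2, alternating_one_zero]

theorem contDiff_pullForm_apply {P : Type*} [NormedAddCommGroup P] [NormedSpace ℝ P] {k : ℕ}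
    (η : DiffForm E M V k) {K : P → M} (hK : ContMDiff 𝓘(ℝ, P) 𝓘(ℝ, E) ∞ K) (v : Fin k → P) :
    ContDiff ℝ ∞ (fun q => pullForm η K q v) :=
  contDiff_iff_contDiffAt.2 fun q =>
    contDiffAt_pullForm_apply η isOpen_univ hK.contMDiffOn (Set.mem_univ q) v

theorem contDiff_pullX (η : DiffForm E M V 1) {S : ℝ × ℝ → M}
    (hS : ContMDiff 𝓘(ℝ, ℝ × ℝ) 𝓘(ℝ, E) ∞ S) : ContDiff ℝ ∞ (pullX η S) := by
  have h := contDiff_pullForm_apply η hS ![(1, 0)]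
  simp only [pullForm_one] at h
  exact h

theorem contDiff_pullY (η : DiffForm E M V 1) {S : ℝ × ℝ → M}
    (hS : ContMDiff 𝓘(ℝ, ℝ × ℝ) 𝓘(ℝ, E) ∞ S) : ContDiff ℝ ∞ (pullY η S) := by
  have h := contDiff_pullForm_apply η hS ![(0, 1)]
  simp only [pullForm_one] at h
  exact h

/-- A map from the plane of rank at most one. -/
def IsThin (S : ℝ × ℝ → M) : Prop :=
  ∀ q, ¬ LinearIndependent ℝ ![modelDeriv E S q (1, 0), modelDeriv E S q (0, 1)]

omit [IsManifold 𝓘(ℝ, E) ∞ M] in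
theorem isThin_of_rank_le {S : ℝ × ℝ → M}
    (h : ∀ q, (mfderiv 𝓘(ℝ, ℝ × ℝ) 𝓘(ℝ, E) S q).toLinearMap.rank ≤ 1) :
    IsThin (E := E) S := fun q => by
  have h1 : (modelDeriv E S q).toLinearMap.rank ≤ (1 : ℕ) := by
    rw [Nat.cast_one]
    exact h q
  have h2 := not_linearIndependent_of_rank_le (m := 2) h1 (by norm_num) ![(1, 0), (0, 1)]
  have h3 : (fun i => modelDeriv E S q (![(1, 0), (0, 1)] i)) =
      ![modelDeriv E S q (1, 0), modelDeriv E S q (0, 1)] := by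
    ext i
    fin_cases i <;> rfl
  rwa [h3] at h2

omit [LieGroup 𝓘(ℝ, EH) ∞ H] in
/-- On a thin surface, the `1`-transport integrates the connection form in all directions. -/
theorem IsSolF.rlog_of_isThin {S : ℝ × ℝ → M} (hS : ContMDiff 𝓘(ℝ, ℝ × ℝ) 𝓘(ℝ, E) ∞ S)
    (hT : IsThin (E := E) S) {x₀ : ℝ} {p : M} (hp : ∀ y, S (x₀, y) = p) {u : ℝ × ℝ → G}
    (hu : IsSolF (pullX D.θ S) x₀ u) (q : ℝ × ℝ) : rlog u q (0, 1) = - pullY D.θ S q := by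
  refine rlog_eq_of_flat hu.1 (αx := fun q => - pullX D.θ S q) (αy := fun q => - pullY D.θ S q)
    ((contDiff_pullY D.θ hS).neg.differentiable (by simp)) hu.rlog_eq (fun q => ?_)
    (x₀ := x₀) (fun y => ?_) q
  -- Thinness kills the pull-back of `Υ`, so `fake_flat` says that `-θ` satisfies the Maurer-Cartan
  -- equation on the surface.
  · have h := D.fderiv_pullForm_sub hS q (1, 0) (0, 1)
    simp only [pullForm_one, pullForm_two] at h
    rw [alternating_eq_zero _ (hT q), map_zero] at h
    have h' : fderiv ℝ (pullY D.θ S) q (1, 0) - fderiv ℝ (pullX D.θ S) q (0, 1) +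
      lieBr G (pullX D.θ S q) (pullY D.θ S q) = 0 := h
    rw [fderiv_fun_neg, fderiv_fun_neg, neg_apply, neg_apply]
    have h2 : lieBr G (-pullX D.θ S q) (-pullY D.θ S q) = lieBr G (pullX D.θ S q) (pullY D.θ S q) := by
      simp [lieBr_eq_mHatL]
    rw [h2, ← sub_eq_zero, ← neg_eq_zero, ← h']
    abel
  · rw [pullY_eq_zero D.θ hS hp, neg_zero, ← rlog_snd (hu.1 _)]
    simp only [hu.2.1, rlog_const]
    rfl

theorem eq_of_rlog_eq_zero {u : ℝ × ℝ → G}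
    (hu : ContMDiff 𝓘(ℝ, ℝ × ℝ) 𝓘(ℝ, EG) ∞ u) {x : ℝ}
    (h : ∀ y, rlog (EG := EG) u (x, y) (0, 1) = 0) (y y' : ℝ) : u (x, y) = u (x, y') :=
  eq_of_rlog_eq (EG := EG) (u := fun s => u (x, s)) (v := fun _ => u (x, y'))
    (hu.comp_contDiff (contDiff_prodMk_right x)) contMDiff_const
    (fun s => by rw [rlog_snd (hu _), h, rlog_const]; rfl) (s₀ := y') rfl y

variable {p₀ p₁ : M}

omit [LieGroup 𝓘(ℝ, EH) ∞ H] in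
theorem exists_isSolF_pullX [FiniteDimensional ℝ EG] (η : DiffForm E M EG 1) {S : ℝ × ℝ → M}
    (hS : ContMDiff 𝓘(ℝ, ℝ × ℝ) 𝓘(ℝ, E) ∞ S) (x₀ : ℝ) :
    ∃ u : ℝ × ℝ → G, IsSolF (pullX η S) x₀ u := by
  obtain ⟨v, -, hv⟩ := exists_isSolF (G := G) (P := ℝ) (ax := fun z => pullX η S z.2)
    ((contDiff_pullX η hS).comp contDiff_snd) x₀
  exact ⟨_, hv 0⟩

omit [LieGroup 𝓘(ℝ, EH) ∞ H] in
/-- The component `f` depends only on the restriction of the surface to a horizontal line. -/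
theorem cocycleF_pullX_congr [FiniteDimensional ℝ EG] (η : DiffForm E M EG 1) {S S' : ℝ × ℝ → M}
    (hS : ContMDiff 𝓘(ℝ, ℝ × ℝ) 𝓘(ℝ, E) ∞ S) (hS' : ContMDiff 𝓘(ℝ, ℝ × ℝ) 𝓘(ℝ, E) ∞ S') {y y' : ℝ}
    (h : ∀ x, S (x, y) = S' (x, y')) (x x₀ : ℝ) :
    cocycleF G (pullX η S) x x₀ y = cocycleF G (pullX η S') x x₀ y' := by
  obtain ⟨u, hu⟩ := exists_isSolF_pullX (G := G) η hS x₀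
  obtain ⟨v, hv⟩ := exists_isSolF_pullX (G := G) η hS' x₀
  rw [hu.cocycleF_eq, hv.cocycleF_eq]
  refine eq_of_rlog_eq (EG := EG) (u := fun s => u (s, y)) (v := fun s => v (s, y'))
    (hu.1.comp_contDiff (contDiff_prodMk_left y)) (hv.1.comp_contDiff (contDiff_prodMk_left y'))
    (fun s => ?_) (s₀ := x₀) (by rw [hv.2.1, hu.2.1]) x
  rw [rlog_fst (hv.1 _), rlog_fst (hu.1 _), hv.rlog_eq, hu.rlog_eq,
    pullX_eq_modelDeriv_line η hS, pullX_eq_modelDeriv_line η hS']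
  simp only [h]

omit [LieGroup 𝓘(ℝ, EH) ∞ H] in
theorem ConnDoublet.transport₁_eq {S : ℝ × ℝ → M} (hS : ContMDiff 𝓘(ℝ, ℝ × ℝ) 𝓘(ℝ, E) ∞ S)
    [FiniteDimensional ℝ EG] {u : ℝ × ℝ → G} (hu : IsSolF (pullX D.θ S) 0 u) {y : ℝ}
    (γ : Curve E p₀ p₁) (hγ : ∀ x, S (x, y) = γ.toFun x) : D.transport₁ γ = u (1, y) := by
  rw [← hu.cocycleF_eq, cocycleF_pullX_congr D.θ hS (S' := γ.unit)
    (γ.smooth.comp_contDiff contDiff_fst) (y' := 0) hγ]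
  rfl

omit [LieGroup 𝓘(ℝ, EH) ∞ H] in
/-- Thin homotopy invariance of the `1`-parallel transport. -/
theorem ConnDoublet.transport₁_eq_of_thinHomotopic [FiniteDimensional ℝ EG] {γ₀ γ₁ : Curve E p₀ p₁}
    (h : Curve.ThinHomotopic γ₀ γ₁) : D.transport₁ γ₀ = D.transport₁ γ₁ := by
  obtain ⟨S, hS⟩ := h
  obtain ⟨ε, h0, -, hx0, hx1, hy0, hy1⟩ := S.sitting
  obtain ⟨u, hu⟩ := exists_isSolF_pullX (G := G) D.θ S.smooth 0
  rw [D.transport₁_eq S.smooth hu γ₀ (fun x => hy0 x 0 h0),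
    D.transport₁_eq S.smooth hu γ₁ (fun x => hy1 x 1 (by linarith))]
  -- On the edge `x = 1` the surface is constant, so the `y`-component of `θ` is zero and `u (1, ·)`
  -- does not move.
  refine eq_of_rlog_eq_zero (EG := EG) hu.1 (fun y => ?_) 0 1
  rw [IsSolF.rlog_of_isThin D S.smooth (isThin_of_rank_le hS) (fun y => hx0 0 y h0) hu,
    pullY_eq_zero D.θ S.smooth (fun y => hx1 1 y (by linarith)), neg_zero]

omit [LieGroup 𝓘(ℝ, EH) ∞ H] in
-- `inducedMap` is the genuine quotient map only in the branch where the transport respects the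
-- relation, hence the appeal to thin homotopy invariance.
theorem ConnDoublet.functor₁_mk [FiniteDimensional ℝ EG] (γ : Curve E p₀ p₁) :
    D.functor₁ (Quot.mk _ γ) = D.transport₁ γ := by
  rw [functor₁, inducedMap, dif_pos fun γ₀ γ₁ h => D.transport₁_eq_of_thinHomotopic h]

end Thin

/-! ### Thin homotopy invariance of the gauge transformation -/

section GaugeInvariance

variable {P : Type*} [NormedAddCommGroup P] [NormedSpace ℝ P]
  {E : Type*} [NormedAddCommGroup E] [NormedSpace ℝ E]
  {M : Type*} [TopologicalSpace M] [ChartedSpace E M] [IsManifold 𝓘(ℝ, E) ∞ M]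
  {EG : Type*} [NormedAddCommGroup EG] [NormedSpace ℝ EG]
  {G : Type*} [TopologicalSpace G] [ChartedSpace EG G] [Group G] [LieGroup 𝓘(ℝ, EG) ∞ G]
  {EH : Type*} [NormedAddCommGroup EH] [NormedSpace ℝ EH]
  {H : Type*} [TopologicalSpace H] [ChartedSpace EH H] [Group H] [LieGroup 𝓘(ℝ, EH) ∞ H]
  {C : LieCrossedModule EG G EH H} (D : ConnDoublet E M C) {p₀ p₁ : M}

omit [IsManifold 𝓘(ℝ, E) ∞ M] in
/-- The logarithmic derivative of a map that factors through a manifold. -/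
theorem exists_rlog_comp_eq {φ : M → G} (hφ : ContMDiff 𝓘(ℝ, E) 𝓘(ℝ, EG) ∞ φ) {K : P → M} {q : P}
    (hK : ContMDiffAt 𝓘(ℝ, P) 𝓘(ℝ, E) ∞ K q) :
    ∃ ℓ : E →L[ℝ] EG, rlog (EG := EG) (fun x => φ (K x)) q = ℓ ∘L modelDeriv E K q := by
  have h1 : MDifferentiableAt 𝓘(ℝ, E) 𝓘(ℝ, EG) (fun x => φ x * (φ (K q))⁻¹) (K q) :=
    (hφ.mul contMDiff_const).contMDiffAt.mdifferentiableAt (n := ∞) (by simp)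
  have h2 := h1.hasMFDerivAt.comp q (hK.mdifferentiableAt (by simp)).hasMFDerivAt
  refine ⟨mfderiv 𝓘(ℝ, E) 𝓘(ℝ, EG) (fun x => φ x * (φ (K q))⁻¹) (K q), ?_⟩
  ext v
  have h3 := mfderiv_eq_dOne (EG := EG) (k := fun x => φ (K x) * (φ (K q))⁻¹)
    h2.mdifferentiableAt (by simp) v
  exact h3.symm.trans (DFunLike.congr_fun h2.mfderiv v)

/-- The coefficients of `ṁ(κ)(J)` along a thin surface, `κ` with logarithmic derivative factoring
through the surface, form a flat form. -/
theorem fderiv_mDotL_pullForm_of_isThin {S : ℝ × ℝ → M} (hS : ContMDiff 𝓘(ℝ, ℝ × ℝ) 𝓘(ℝ, E) ∞ S)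
    (hT : IsThin (E := E) S) (J : DiffForm E M EH 1) {κ : ℝ × ℝ → G}
    (hκ : ContMDiff 𝓘(ℝ, ℝ × ℝ) 𝓘(ℝ, EG) ∞ κ) {q : ℝ × ℝ} {N : E → EG}
    (hN : ∀ (c : ℝ) v, N (c • v) = c • N v)
    (hX : rlog κ q (1, 0) = N (modelDeriv E S q (1, 0)))
    (hY : rlog κ q (0, 1) = N (modelDeriv E S q (0, 1))) :
    fderiv ℝ (fun q => C.mDotL (κ q) (pullY J S q)) q (1, 0) -
      fderiv ℝ (fun q => C.mDotL (κ q) (pullX J S q)) q (0, 1) =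
      lieBr H (C.mDotL (κ q) (pullX J S q)) (C.mDotL (κ q) (pullY J S q)) := by
  have hJ : ∀ (c : ℝ) v, C.mDotL (κ q) (J.val (S q) ![c • v]) = c • C.mDotL (κ q) (J.val (S q) ![v]) :=
    fun c v => by rw [alternating_one_smul, map_smul]
  have h1 := J.fderiv_pullForm_sub hS q (1, 0) (0, 1)
  simp only [pullForm_one] at h1
  rw [alternating_eq_zero _ (hT q)] at h1
  have h2 : fderiv ℝ (pullY J S) q (1, 0) = fderiv ℝ (pullX J S) q (0, 1) := sub_eq_zero.1 h1
  rw [(C.hasFDerivAt_mDotL_apply (hκ q)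
      ((contDiff_pullY J hS).differentiable (by simp) q).hasFDerivAt).fderiv,
    (C.hasFDerivAt_mDotL_apply (hκ q)
      ((contDiff_pullX J hS).differentiable (by simp) q).hasFDerivAt).fderiv]
  simp only [add_apply, ContinuousLinearMap.comp_apply, ContinuousLinearMap.flip_apply, h2, hX, hY,
    add_sub_add_right_eq_sub, lieBr_eq_mHatL]
  -- Along a thin surface `dJ` pulls back to zero, and the two `m̂`-terms agree because `N` and `J`
  -- are evaluated on dependent vectors.
  have h3 := bilinear_comm_of_not_linearIndependent C.mHatL (f := N)
    (g := fun v => C.mDotL (κ q) (J.val (S q) ![v])) hN hJ (hT q)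
  have h4 := bilinear_comm_of_not_linearIndependent (conjModule EH H).mHatL
    (f := fun v => C.mDotL (κ q) (J.val (S q) ![v]))
    (g := fun v => C.mDotL (κ q) (J.val (S q) ![v])) hJ hJ (hT q)
  have h5 := lieBr_swap (G := H) (C.mDotL (κ q) (pullX J S q)) (C.mDotL (κ q) (pullY J S q))
  rw [lieBr_eq_mHatL, lieBr_eq_mHatL] at h5
  rw [pullX_eq, pullY_eq] at h5 ⊢
  rw [h3, sub_self]
  rw [← h4] at h5
  -- By `h4` the bracket is symmetric in the two coefficients and by `h5` antisymmetric, so twice it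
  -- is zero.
  refine smul_right_injective EH (two_ne_zero' ℝ) ?_
  dsimp only
  rw [smul_zero, two_smul]
  exact (eq_neg_iff_add_eq_zero.1 h5).symm

variable [FiniteDimensional ℝ EG] [FiniteDimensional ℝ EH]

theorem exists_isSolPsi_pullX (T : GaugeTransf E M EG G EH) {S : ℝ × ℝ → M}
    (hS : ContMDiff 𝓘(ℝ, ℝ × ℝ) 𝓘(ℝ, E) ∞ S) (x₀ : ℝ) : ∃ Λ : ℝ × ℝ → H,
      IsSolPsi C (pullX D.θ S) (fun q => T.g (S q)) (pullX T.J S) x₀ Λ := by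
  have hg : ContMDiff 𝓘(ℝ, ℝ × ℝ) 𝓘(ℝ, EG) ∞ (fun q => T.g (S q)) := T.smooth_g.comp hS
  have hJ : ContDiff ℝ ∞ (fun z : ℝ × (ℝ × ℝ) => C.mDotL (T.g (S z.2))⁻¹ (pullX T.J S z.2)) := by
    refine ContDiff.clm_apply (contDiff_iff_contDiffAt.2 fun z => C.contDiffAt_mDotL ?_)
      ((contDiff_pullX T.J hS).comp contDiff_snd)
    exact contMDiffAt_inv (n := ⊤) (hg.comp_contDiff contDiff_snd).contMDiffAt
  obtain ⟨Λ, -, hΛ⟩ := exists_isSolPsi C (ax := fun z : ℝ × (ℝ × ℝ) => pullX D.θ S z.2)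
    ((contDiff_pullX D.θ hS).comp contDiff_snd) hJ x₀
  exact ⟨_, hΛ 0 _ _ fun q => rfl⟩

theorem ConnDoublet.gaugeTransport_eq (T : GaugeTransf E M EG G EH) {S : ℝ × ℝ → M}
    (hS : ContMDiff 𝓘(ℝ, ℝ × ℝ) 𝓘(ℝ, E) ∞ S) {Λ : ℝ × ℝ → H}
    (hΛ : IsSolPsi C (pullX D.θ S) (fun q => T.g (S q)) (pullX T.J S) 1 Λ) {y : ℝ}
    (γ : Curve E p₀ p₁) (hγ : ∀ x, S (x, y) = γ.toFun x) : D.gaugeTransport T γ = Λ (0, y) := by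
  have hγs : ContMDiff 𝓘(ℝ, ℝ × ℝ) 𝓘(ℝ, E) ∞ γ.unit := γ.smooth.comp_contDiff contDiff_fst
  obtain ⟨Λ', hΛ'⟩ := exists_isSolPsi_pullX D T hγs 1
  rw [gaugeTransport, hΛ'.gaugePsi_eq]
  refine inv_injective (eq_of_rlog_eq (EG := EH) (u := fun s => (Λ' (s, 0))⁻¹)
    (v := fun s => (Λ (s, y))⁻¹)
    (hΛ'.1.comp_contDiff (contDiff_prodMk_left 0)).inv
    (hΛ.1.comp_contDiff (contDiff_prodMk_left y)).inv
    (fun s => ?_) (s₀ := 1) (by rw [hΛ.2.1, hΛ'.2.1]) 0)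
  have hc := cocycleF_pullX_congr (G := G) D.θ hS hγs (y := y) (y' := 0) hγ s 1
  rw [hΛ.rlog_inv_eq, hΛ'.rlog_inv_eq, hc, pullX_eq_modelDeriv_line T.J hS,
    pullX_eq_modelDeriv_line T.J hγs]
  simp only [hγ, Curve.unit]

/-- Thin homotopy invariance of the gauge transformation. -/
theorem ConnDoublet.gaugeTransport_eq_of_thinHomotopic (T : GaugeTransf E M EG G EH)
    {γ₀ γ₁ : Curve E p₀ p₁} (h : Curve.ThinHomotopic γ₀ γ₁) :
    D.gaugeTransport T γ₀ = D.gaugeTransport T γ₁ := by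
  obtain ⟨S, hS⟩ := h
  obtain ⟨ε, h0, -, hx0, hx1, hy0, hy1⟩ := S.sitting
  have hT := isThin_of_rank_le hS
  have hSs := S.smooth
  obtain ⟨u, hu⟩ := exists_isSolF_pullX (G := G) D.θ hSs 1
  obtain ⟨Λ, hΛ⟩ := exists_isSolPsi_pullX D T hSs 1
  rw [D.gaugeTransport_eq T hSs hΛ γ₀ (fun x => hy0 x 0 h0),
    D.gaugeTransport_eq T hSs hΛ γ₁ (fun x => hy1 x 1 (by linarith))]
  set κ : ℝ × ℝ → G := fun q => (u q)⁻¹ * (T.g (S.toFun q))⁻¹ with hκdef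
  have hg : ContMDiff 𝓘(ℝ, E) 𝓘(ℝ, EG) ∞ (fun x => (T.g x)⁻¹) := T.smooth_g.inv
  have hgS : ContMDiff 𝓘(ℝ, ℝ × ℝ) 𝓘(ℝ, EG) ∞ (fun q => (T.g (S.toFun q))⁻¹) := hg.comp hSs
  have hκ : ContMDiff 𝓘(ℝ, ℝ × ℝ) 𝓘(ℝ, EG) ∞ κ := hu.1.inv.mul hgS
  have hY := fun q => IsSolF.rlog_of_isThin D hSs hT (x₀ := 1) (fun y => hx1 1 y (by linarith)) hu q
  -- The defining equation of `Λ` gives this formula for `Λ⁻¹` in the direction of `x`; flatness of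
  -- `ṁ(κ)(J)` transfers it to the direction of `y`, starting from the constant edge `x = 1`.
  have key : ∀ q, rlog (fun q => (Λ q)⁻¹) q (0, 1) = C.mDotL (κ q) (pullY T.J S.toFun q) := by
    refine rlog_eq_of_flat (EG := EH) hΛ.1.inv
      (αx := fun q => C.mDotL (κ q) (pullX T.J S.toFun q)) (x₀ := 1)
      (fun q => (C.hasFDerivAt_mDotL_apply (hκ q)
        ((contDiff_pullY T.J hSs).differentiable (by simp) q).hasFDerivAt).differentiableAt)
      (fun q => ?_) (fun q => ?_) (fun y => ?_)
    · rw [← rlog_fst (hΛ.1.inv _), hΛ.rlog_inv_eq, C.mDot_eq, hu.cocycleF_eq]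
    · obtain ⟨ℓ, hℓ⟩ := exists_rlog_comp_eq hg (hSs q)
      -- On a thin surface `rlog u` is `-θ` in both directions, so `rlog κ` depends on the direction
      -- only through the derivative of the surface, as the flatness lemma demands.
      have hr : ∀ X, rlog κ q X = lieAd EG (u q)⁻¹ (ℓ (modelDeriv E S.toFun q X) - rlog u q X) := by
        intro X
        rw [hκdef, rlog_mul (contMDiffAt_inv (n := 1) ((hu.1 q).of_le (by simp)))
          ((hgS q).of_le (by simp)), rlog_inv ((hu.1 q).of_le (by simp)), hℓ]
        simp [sub_eq_add_neg, add_comm]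
      refine fderiv_mDotL_pullForm_of_isThin hSs hT T.J hκ
        (N := fun v => lieAd EG (u q)⁻¹ (ℓ v + D.θ.val (S.toFun q) ![v])) (fun c v => ?_) ?_ ?_
      · rw [alternating_one_smul, map_smul, ← smul_add, map_smul]
      · rw [hr, hu.rlog_eq, sub_neg_eq_add]
        rfl
      · rw [hr, hY, sub_neg_eq_add]
        rfl
    · rw [pullY_eq_zero T.J hSs (fun y => hx1 1 y (by linarith)), map_zero,
        ← rlog_snd (hΛ.1.inv _)]
      simp only [hΛ.2.1, inv_one, rlog_const]
      rfl
  refine inv_injective (eq_of_rlog_eq_zero (EG := EH) hΛ.1.inv (fun y => ?_) 0 1)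
  rw [key, pullY_eq_zero T.J hSs (fun y => hx0 0 y h0), map_zero]

theorem ConnDoublet.gaugeFunctor_mk (T : GaugeTransf E M EG G EH) (γ : Curve E p₀ p₁) :
    D.gaugeFunctor T (Quot.mk _ γ) = D.gaugeTransport T γ := by
  rw [gaugeFunctor, inducedMap, dif_pos fun γ₀ γ₁ h => D.gaugeTransport_eq_of_thinHomotopic T h]

end GaugeInvariance

/-! ### Vanishing derivatives along lines -/

section Lines

variable {P : Type*} [NormedAddCommGroup P] [NormedSpace ℝ P]
  {F : Type*} [NormedAddCommGroup F] [NormedSpace ℝ F]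
  {E : Type*} [NormedAddCommGroup E] [NormedSpace ℝ E]
  {M : Type*} [TopologicalSpace M] [ChartedSpace E M]
  {G : Type*} [TopologicalSpace G] [ChartedSpace E G] [Group G]

theorem hasFDerivAt_line (q Y : P) :
    HasFDerivAt (fun s : ℝ => q + s • Y) ((ContinuousLinearMap.id ℝ ℝ).smulRight Y) 0 :=
  ((hasFDerivAt_id (0 : ℝ)).smul_const Y).const_add q

theorem fderiv_apply_eq_zero_of_line {f : P → F} {q Y : P} (hf : DifferentiableAt ℝ f q)
    (h : ∀ s : ℝ, f (q + s • Y) = f q) : fderiv ℝ f q Y = 0 := by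
  have h0 : HasFDerivAt f (fderiv ℝ f q) (q + (0 : ℝ) • Y) := by simpa using hf.hasFDerivAt
  have h1 := HasFDerivAt.comp (0 : ℝ) (f := fun s : ℝ => q + s • Y) h0 (hasFDerivAt_line q Y)
  have h2 := h1.unique ((hasFDerivAt_const (f q) (0 : ℝ)).congr_of_eventuallyEq
    (Filter.Eventually.of_forall h))
  simpa using DFunLike.congr_fun h2 1

theorem modelDeriv_apply_eq_zero_of_line {K : P → M} {q Y : P}
    (hK : ContMDiff 𝓘(ℝ, P) 𝓘(ℝ, E) ∞ K) (h : ∀ s : ℝ, K (q + s • Y) = K q) :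
    modelDeriv E K q Y = 0 := by
  have h1 := modelDeriv_comp (K := K) (f := fun s : ℝ => q + s • Y) ((hK _).of_le (by simp))
    (hasFDerivAt_line q Y)
  simp only [h, modelDeriv_const, zero_smul, add_zero] at h1
  simpa using (DFunLike.congr_fun h1 1).symm

theorem rlog_apply_eq_zero_of_line [LieGroup 𝓘(ℝ, E) ∞ G] {u : P → G} {q Y : P}
    (hu : ContMDiff 𝓘(ℝ, P) 𝓘(ℝ, E) ∞ u) (h : ∀ s : ℝ, u (q + s • Y) = u q) :
    rlog (EG := E) u q Y = 0 := by
  have h1 := rlog_comp (u := u) (f := fun s : ℝ => q + s • Y) ((hu _).of_le (by simp))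
    (hasFDerivAt_line q Y)
  simp only [h, rlog_const, zero_smul, add_zero] at h1
  simpa using (DFunLike.congr_fun h1 1).symm

theorem fderiv_fderiv_apply_comm {f : P → F} (hf : ContDiff ℝ ∞ f) (q X Y : P) :
    fderiv ℝ (fun p => fderiv ℝ f p Y) q X = fderiv ℝ (fun p => fderiv ℝ f p X) q Y := by
  have hd : DifferentiableAt ℝ (fderiv ℝ f) q :=
    (hf.fderiv_right (m := ∞) (by simp)).differentiable (by simp) q
  rw [fderiv_apply_const hd, fderiv_apply_const hd]
  exact (hf.contDiffAt.isSymmSndFDerivAt (by simpa using ENat.LEInfty.out)).eq X Y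

end Lines

/-! ### Integrating the curvature `3`-form along the first axis -/

section SurfaceInvariance

variable {E : Type*} [NormedAddCommGroup E] [NormedSpace ℝ E]
  {M : Type*} [TopologicalSpace M] [ChartedSpace E M] [IsManifold 𝓘(ℝ, E) ∞ M]
  {EG : Type*} [NormedAddCommGroup EG] [NormedSpace ℝ EG]
  {G : Type*} [TopologicalSpace G] [ChartedSpace EG G] [Group G] [LieGroup 𝓘(ℝ, EG) ∞ G]
  {EH : Type*} [NormedAddCommGroup EH] [NormedSpace ℝ EH]
  {H : Type*} [TopologicalSpace H] [ChartedSpace EH H] [Group H] [LieGroup 𝓘(ℝ, EH) ∞ H]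
  {V : Type*} [NormedAddCommGroup V] [NormedSpace ℝ V]
  {F : Type*} [NormedAddCommGroup F] [NormedSpace ℝ F]
  {C : LieCrossedModule EG G EH H} (D : ConnDoublet E M C)

theorem eq_of_fderiv_fst_eq {f g : ℝ × ℝ × ℝ → F} (hf : Differentiable ℝ f)
    (hg : Differentiable ℝ g) (h : ∀ q, fderiv ℝ f q (1, 0, 0) = fderiv ℝ g q (1, 0, 0)) {c : ℝ}
    (h0 : ∀ q, q.1 = c → f q = g q) (q : ℝ × ℝ × ℝ) : f q = g q := by
  have := eq_of_fderiv_apply_eq hf hg h (h0 (c, q.2) rfl) (q.1 - c)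
  have hq : ((c, q.2) : ℝ × ℝ × ℝ) + (q.1 - c) • (1, 0, 0) = q := by ext <;> simp
  rwa [hq] at this

omit [LieGroup 𝓘(ℝ, EG) ∞ G] [LieGroup 𝓘(ℝ, EH) ∞ H] [IsManifold 𝓘(ℝ, E) ∞ M] in
theorem modelDeriv_eq_zero_of_face {K : ℝ × ℝ × ℝ → M}
    (hK : ContMDiff 𝓘(ℝ, ℝ × ℝ × ℝ) 𝓘(ℝ, E) ∞ K) {c : ℝ} {p : M} (h : ∀ q, q.1 = c → K q = p)
    {q Y : ℝ × ℝ × ℝ} (hq : q.1 = c) (hY : Y.1 = 0) : modelDeriv E K q Y = 0 :=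
  modelDeriv_apply_eq_zero_of_line hK fun s => by rw [h q hq, h _ (by simp [hq, hY])]

/-- The gauge transform of the connection form by the transport along the first axis. -/
theorem ConnDoublet.lieAd_sub_rlog_eq {K : ℝ × ℝ × ℝ → M}
    (hK : ContMDiff 𝓘(ℝ, ℝ × ℝ × ℝ) 𝓘(ℝ, E) ∞ K) {c : ℝ} {p : M} (hp : ∀ q, q.1 = c → K q = p)
    {k : ℝ × ℝ × ℝ → G} (hk : ContMDiff 𝓘(ℝ, ℝ × ℝ × ℝ) 𝓘(ℝ, EG) ∞ k) (hk1 : ∀ q, q.1 = c → k q = 1)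
    (hkr : ∀ q, rlog k q (1, 0, 0) = lieAd EG (k q) (pullForm D.θ K q ![(1, 0, 0)]))
    {Y : ℝ × ℝ × ℝ} (hY : Y.1 = 0) {w : ℝ × ℝ × ℝ → EH} (hw : ContDiff ℝ ∞ w)
    (hwd : ∀ q, fderiv ℝ w q (1, 0, 0) =
      - C.mDotL (k q) (pullForm D.Υ K q ![(1, 0, 0), Y]))
    (hw1 : ∀ q, q.1 = c → w q = 0) (q : ℝ × ℝ × ℝ) :
    lieAd EG (k q) (pullForm D.θ K q ![Y]) - rlog k q Y = - C.tDotL (w q) := by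
  have ha : ∀ Z q, HasFDerivAt (fun q => pullForm D.θ K q ![Z])
      (fderiv ℝ (fun q => pullForm D.θ K q ![Z]) q) q := fun Z q =>
    ((contDiff_pullForm_apply D.θ hK ![Z]).differentiable (by simp) q).hasFDerivAt
  have hA : ∀ Z q, HasFDerivAt (fun q => lieAd EG (k q) (pullForm D.θ K q ![Z])) _ q := fun Z q =>
    (conjModule EG G).hasFDerivAt_mDotL_apply (hk q) (ha Z q)
  have hr : ∀ q, DifferentiableAt ℝ (rlog (EG := EG) k) q := fun q =>
    (contDiffAt_rlog (hk q)).differentiableAt (by simp)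
  have hrY : Differentiable ℝ (fun q => rlog (EG := EG) k q Y) := fun q =>
    (hr q).clm_apply (differentiableAt_const _)
  have hwd' : Differentiable ℝ w := hw.differentiable (by simp)
  -- The gauge-transformed connection has no `x`-component, by `hkr`, so the `x`-derivative of its
  -- `Y`-component is its curvature, which equivariance and `fake_flat` identify with `ṫ` of
  -- `ṁ(k)(Υ)`. Both sides vanish on the face `q.1 = c`.
  refine eq_of_fderiv_fst_eq (c := c) (f := fun q => lieAd EG (k q) (pullForm D.θ K q ![Y]) - rlog k q Y)
    (g := fun q => - C.tDotL (w q)) (fun q => (hA Y q).differentiableAt.sub (hrY q))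
    (fun q => (C.tDotL.differentiableAt.comp q (hwd' q)).neg) (fun q => ?_) (fun q hq => ?_) q
  · have h1 : fderiv ℝ (fun q => - C.tDotL (w q)) q (1, 0, 0) =
        C.tDotL (C.mDotL (k q) (pullForm D.Υ K q ![(1, 0, 0), Y])) := by
      have h : HasFDerivAt (fun q => - C.tDotL (w q)) _ q :=
        (C.tDotL.hasFDerivAt.comp q (hwd' q).hasFDerivAt).neg
      rw [h.fderiv]
      simp [hwd]
    have hMC := fderiv_rlog_sub_eq_lieBr (hk q) (1, 0, 0) Y
    rw [← fderiv_apply_const (hr q), ← fderiv_apply_const (hr q)] at hMC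
    simp only [hkr] at hMC
    rw [(hA (1, 0, 0) q).fderiv, sub_eq_iff_eq_add] at hMC
    have hF := D.fderiv_pullForm_sub hK q (1, 0, 0) Y
    rw [h1, fderiv_fun_sub (hA Y q).differentiableAt (hrY q), sub_apply, hMC, (hA Y q).fderiv,
      C.tDotL_mDotL, ← hF]
    simp only [add_apply, ContinuousLinearMap.comp_apply, ContinuousLinearMap.flip_apply,
      conjModule_mDotL, ← lieBr_eq_mHatL, hkr, map_add, map_sub, lieAd_lieBr]
    rw [lieBr_swap (rlog k q Y)]
    abel
  · have h1 : pullForm D.θ K q ![Y] = 0 := by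
      rw [pullForm_one, modelDeriv_eq_zero_of_face hK hp hq hY, alternating_one_zero]
    have h2 : rlog (EG := EG) k q Y = 0 := rlog_apply_eq_zero_of_line hk fun s => by
      rw [hk1 q hq, hk1 _ (by simp [hq, hY])]
    simp [h1, h2, hw1 q hq]

/-- The form with components `w₂`, `w₃` is flat on the face `{c'} × ℝ²`. -/
theorem ConnDoublet.fderiv_sub_eq_lieBr_of_curvature {K : ℝ × ℝ × ℝ → M}
    (hK : ContMDiff 𝓘(ℝ, ℝ × ℝ × ℝ) 𝓘(ℝ, E) ∞ K)
    (hcurv : ∀ q, D.curvature (K q) (modelDeriv E K q (1, 0, 0)) (modelDeriv E K q (0, 1, 0))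
      (modelDeriv E K q (0, 0, 1)) = 0)
    {c c' : ℝ} {p p' : M} (hp : ∀ q, q.1 = c → K q = p) (hp' : ∀ q, q.1 = c' → K q = p')
    {k : ℝ × ℝ × ℝ → G} (hk : ContMDiff 𝓘(ℝ, ℝ × ℝ × ℝ) 𝓘(ℝ, EG) ∞ k) (hk1 : ∀ q, q.1 = c → k q = 1)
    (hkr : ∀ q, rlog k q (1, 0, 0) = lieAd EG (k q) (pullForm D.θ K q ![(1, 0, 0)]))
    {w₂ w₃ : ℝ × ℝ × ℝ → EH} (hw₂ : ContDiff ℝ ∞ w₂) (hw₃ : ContDiff ℝ ∞ w₃)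
    (hd₂ : ∀ q, fderiv ℝ w₂ q (1, 0, 0) =
      - C.mDotL (k q) (pullForm D.Υ K q ![(1, 0, 0), (0, 1, 0)]))
    (hd₃ : ∀ q, fderiv ℝ w₃ q (1, 0, 0) =
      - C.mDotL (k q) (pullForm D.Υ K q ![(1, 0, 0), (0, 0, 1)]))
    (h₂ : ∀ q, q.1 = c → w₂ q = 0) (h₃ : ∀ q, q.1 = c → w₃ q = 0) {q : ℝ × ℝ × ℝ} (hq : q.1 = c') :
    fderiv ℝ w₃ q (0, 1, 0) - fderiv ℝ w₂ q (0, 0, 1) = lieBr H (w₂ q) (w₃ q) := by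
  have hB : ∀ X Y q, HasFDerivAt (fun q => pullForm D.Υ K q ![X, Y])
      (fderiv ℝ (fun q => pullForm D.Υ K q ![X, Y]) q) q := fun X Y q =>
    ((contDiff_pullForm_apply D.Υ hK ![X, Y]).differentiable (by simp) q).hasFDerivAt
  have hβ : ∀ X Y q, HasFDerivAt (fun q => C.mDotL (k q) (pullForm D.Υ K q ![X, Y])) _ q :=
    fun X Y q => C.hasFDerivAt_mDotL_apply (hk q) (hB X Y q)
  have hw₂d : Differentiable ℝ w₂ := hw₂.differentiable (by simp)
  have hw₃d : Differentiable ℝ w₃ := hw₃.differentiable (by simp)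
  have hb : ∀ q, HasFDerivAt (fun q => lieBr H (w₂ q) (w₃ q)) _ q := fun q => by
    simp only [lieBr_eq_mHatL]
    exact ((conjModule EH H).mHatL.hasFDerivAt.comp q (hw₂d q).hasFDerivAt).clm_apply
      (hw₃d q).hasFDerivAt
  have hE : ∀ {w : ℝ × ℝ × ℝ → EH} (_ : ContDiff ℝ ∞ w) (Z : ℝ × ℝ × ℝ),
      Differentiable ℝ (fun q => fderiv ℝ w q Z) := fun hw Z q =>
    ((hw.fderiv_right (m := ∞) (by simp)).differentiable (by simp) q).clm_apply
      (differentiableAt_const _)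
  have hface : ∀ {c : ℝ} {p : M} (_ : ∀ q, q.1 = c → K q = p) {q : ℝ × ℝ × ℝ} (_ : q.1 = c),
      pullForm D.Υ K q ![(0, 1, 0), (0, 0, 1)] = 0 := fun hp q hq => by
    rw [pullForm_two, modelDeriv_eq_zero_of_face hK hp hq rfl]
    exact (D.Υ.val (K q)).map_coord_zero 0 rfl
  -- The identity is proved on all of `ℝ³` with a correction by the `yz`-coefficient of `Υ`. The
  -- correction vanishes on both faces, where `K` is constant: on one this starts the integration,
  -- on the other it gives the claim.
  have key := eq_of_fderiv_fst_eq (c := c)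
    (f := fun q => fderiv ℝ w₃ q (0, 1, 0) - fderiv ℝ w₂ q (0, 0, 1))
    (g := fun q => lieBr H (w₂ q) (w₃ q) -
      C.mDotL (k q) (pullForm D.Υ K q ![(0, 1, 0), (0, 0, 1)]))
    (fun q => (hE hw₃ _ q).sub (hE hw₂ _ q))
    (fun q => (hb q).differentiableAt.sub (hβ _ _ q).differentiableAt) (fun q => ?_)
    (fun q hq => ?_) q
  · rw [key]
    simp [hface hp' hq]
  · have hc₂ := D.lieAd_sub_rlog_eq hK hp hk hk1 hkr (Y := (0, 1, 0)) rfl hw₂ hd₂ h₂ q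
    have hc₃ := D.lieAd_sub_rlog_eq hK hp hk hk1 hkr (Y := (0, 0, 1)) rfl hw₃ hd₃ h₃ q
    have hbi := D.fderiv_pullForm_sub_add hK q (1, 0, 0) (0, 1, 0) (0, 0, 1)
    rw [hcurv] at hbi
    have hbi' := congrArg (C.mDotL (k q)) hbi
    simp only [map_add, map_sub, map_zero, C.mDotL_mHatL] at hbi'
    rw [sub_eq_iff_eq_add] at hc₂ hc₃
    -- The transformed connection is `-ṫ(w₂)`, `-ṫ(w₃)` up to the logarithmic derivative of `k`. The
    -- Peiffer identity then turns the action of `θ` on `Υ` into brackets in `𝔥`.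
    rw [hc₂, hc₃, ← hkr] at hbi'
    simp only [map_add, map_neg, add_apply, neg_apply, C.mHatL_tDotL] at hbi'
    rw [fderiv_fun_sub (hE hw₃ _ q) (hE hw₂ _ q),
      fderiv_fun_sub (hb q).differentiableAt (hβ _ _ q).differentiableAt, sub_apply, sub_apply,
      fderiv_fderiv_apply_comm hw₃, fderiv_fderiv_apply_comm hw₂]
    simp only [hd₂, hd₃]
    rw [fderiv_fun_neg, fderiv_fun_neg, (hβ _ _ q).fderiv, (hβ _ _ q).fderiv, (hβ _ _ q).fderiv,
      (hb q).fderiv]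
    simp only [add_apply, neg_apply, ContinuousLinearMap.comp_apply, ContinuousLinearMap.flip_apply,
      Function.comp_apply, hd₂, hd₃, map_neg, ← lieBr_eq_mHatL]
    rw [lieBr_swap (C.mDotL (k q) _) (w₃ q), ← sub_eq_zero, ← hbi']
    abel
  · have e1 : fderiv ℝ w₃ q (0, 1, 0) = 0 := fderiv_apply_eq_zero_of_line (hw₃d q) fun s => by
      rw [h₃ q hq, h₃ _ (by simp [hq])]
    have e2 : fderiv ℝ w₂ q (0, 0, 1) = 0 := fderiv_apply_eq_zero_of_line (hw₂d q) fun s => by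
      rw [h₂ q hq, h₂ _ (by simp [hq])]
    simp [e1, e2, hface hp hq, h₂ q hq, lieBr_eq_mHatL]

end SurfaceInvariance

/-! ### Homotopy invariance of the `2`-transport -/

section SurfaceHomotopy

variable {E : Type*} [NormedAddCommGroup E] [NormedSpace ℝ E]
  {M : Type*} [TopologicalSpace M] [ChartedSpace E M]
  {EG : Type*} [NormedAddCommGroup EG] [NormedSpace ℝ EG]
  {G : Type*} [TopologicalSpace G] [ChartedSpace EG G] [Group G]
  {EH : Type*} [NormedAddCommGroup EH] [NormedSpace ℝ EH]
  {H : Type*} [TopologicalSpace H] [ChartedSpace EH H] [Group H]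
  {V : Type*} [NormedAddCommGroup V] [NormedSpace ℝ V]
  {F : Type*} [NormedAddCommGroup F] [NormedSpace ℝ F]

theorem hasFDerivAt_slice (z : ℝ) (p : ℝ × ℝ) :
    HasFDerivAt (fun p : ℝ × ℝ => (p.1, p.2, z))
      ((ContinuousLinearMap.fst ℝ ℝ ℝ).prod ((ContinuousLinearMap.snd ℝ ℝ ℝ).prod 0)) p :=
  hasFDerivAt_fst.prodMk (hasFDerivAt_snd.prodMk (hasFDerivAt_const z p))

theorem fderiv_apply_fst_eq {f : ℝ × ℝ × ℝ → F} (hf : Differentiable ℝ f) {q : ℝ × ℝ × ℝ} {d : F}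
    (h : HasDerivAt (fun s => f (s, q.2)) d q.1) : fderiv ℝ f q (1, 0, 0) = d := by
  have h1 := HasFDerivAt.comp q.1 (f := fun s : ℝ => (s, q.2)) (hf (q.1, q.2)).hasFDerivAt
    (hasFDerivAt_prodMk_left q.1 q.2)
  exact DFunLike.congr_fun (h1.unique h.hasFDerivAt) 1 |>.trans (by simp)

theorem modelDeriv_slice {K : ℝ × ℝ × ℝ → M} (hK : ContMDiff 𝓘(ℝ, ℝ × ℝ × ℝ) 𝓘(ℝ, E) ∞ K) (z : ℝ)
    (p v : ℝ × ℝ) : modelDeriv E (fun p : ℝ × ℝ => K (p.1, p.2, z)) p v =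
      modelDeriv E K (p.1, p.2, z) (v.1, v.2, 0) := by
  rw [modelDeriv_comp (K := K) (f := fun p : ℝ × ℝ => (p.1, p.2, z)) ((hK _).of_le (by simp))
    (hasFDerivAt_slice z p)]
  rfl

theorem rlog_slice [LieGroup 𝓘(ℝ, EG) ∞ G] {u : ℝ × ℝ × ℝ → G}
    (hu : ContMDiff 𝓘(ℝ, ℝ × ℝ × ℝ) 𝓘(ℝ, EG) ∞ u) (z : ℝ) (p v : ℝ × ℝ) :
    rlog (EG := EG) (fun p : ℝ × ℝ => u (p.1, p.2, z)) p v =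
      rlog u (p.1, p.2, z) (v.1, v.2, 0) := by
  rw [rlog_comp (u := u) (f := fun p : ℝ × ℝ => (p.1, p.2, z)) ((hu _).of_le (by simp))
    (hasFDerivAt_slice z p)]
  rfl

theorem pullX_slice (η : DiffForm E M V 1) {K : ℝ × ℝ × ℝ → M}
    (hK : ContMDiff 𝓘(ℝ, ℝ × ℝ × ℝ) 𝓘(ℝ, E) ∞ K) (z : ℝ) (p : ℝ × ℝ) :
    pullX η (fun p => K (p.1, p.2, z)) p = pullForm η K (p.1, p.2, z) ![(1, 0, 0)] := by
  rw [pullX_eq, modelDeriv_slice hK, pullForm_one]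

theorem pullY_slice (η : DiffForm E M V 1) {K : ℝ × ℝ × ℝ → M}
    (hK : ContMDiff 𝓘(ℝ, ℝ × ℝ × ℝ) 𝓘(ℝ, E) ∞ K) (z : ℝ) (p : ℝ × ℝ) :
    pullY η (fun p => K (p.1, p.2, z)) p = pullForm η K (p.1, p.2, z) ![(0, 1, 0)] := by
  rw [pullY_eq, modelDeriv_slice hK, pullForm_one]

theorem pullXY_slice (η : DiffForm E M V 2) {K : ℝ × ℝ × ℝ → M}
    (hK : ContMDiff 𝓘(ℝ, ℝ × ℝ × ℝ) 𝓘(ℝ, E) ∞ K) (z : ℝ) (p : ℝ × ℝ) :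
    pullXY η (fun p => K (p.1, p.2, z)) p =
      pullForm η K (p.1, p.2, z) ![(1, 0, 0), (0, 1, 0)] := by
  rw [pullXY_eq, modelDeriv_slice hK, modelDeriv_slice hK, pullForm_two]

variable [LieGroup 𝓘(ℝ, EG) ∞ G] [LieGroup 𝓘(ℝ, EH) ∞ H] [IsManifold 𝓘(ℝ, E) ∞ M]
  {C : LieCrossedModule EG G EH H} (D : ConnDoublet E M C)

/-- A surface is constant on the line `x = 1` from which `W` is integrated, so the factor `g` drops
out of the equation for `W`. -/
theorem cocycleG_eq_one {ay : ℝ × ℝ → EG} (hay : ContDiff ℝ ∞ ay) [FiniteDimensional ℝ EG] {x : ℝ}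
    (h : ∀ y, ay (x, y) = 0) (y y₀ : ℝ) : cocycleG G ay x y y₀ = 1 := by
  obtain ⟨v, -, hv⟩ := exists_isSolG (G := G) (P := ℝ) (ay := fun z => ay z.2)
    (hay.comp contDiff_snd) y₀
  rw [(hv 0).cocycleG_eq]
  have hc := (hv 0).1.comp_contDiff (contDiff_prodMk_right x)
  refine eq_of_rlog_eq (EG := EG) (v := fun _ => 1) hc contMDiff_const (fun s => ?_)
    (s₀ := y₀) ((hv 0).2.1 x) y
  rw [← rightLogDeriv_eq_rlog ((hc s).of_le (by simp)), (hv 0).2.2, rlog_const]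
  simp [h]

/-- The `2`-transport does not change along a map `ℝ³ → M` annihilating the curvature which is
constant on two opposite faces and thin on two others. -/
theorem ConnDoublet.cocycleW_slice_eq [FiniteDimensional ℝ EG] [FiniteDimensional ℝ EH]
    {K : ℝ × ℝ × ℝ → M} (hK : ContMDiff 𝓘(ℝ, ℝ × ℝ × ℝ) 𝓘(ℝ, E) ∞ K)
    (hcurv : ∀ q, D.curvature (K q) (modelDeriv E K q (1, 0, 0)) (modelDeriv E K q (0, 1, 0))
      (modelDeriv E K q (0, 0, 1)) = 0)
    {p p' : M} (hp : ∀ q, q.1 = 1 → K q = p) (hp' : ∀ q, q.1 = 0 → K q = p')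
    (h0 : ∀ x z, pullForm D.Υ K (x, 0, z) ![(1, 0, 0), (0, 0, 1)] = 0)
    (h1 : ∀ x z, pullForm D.Υ K (x, 1, z) ![(1, 0, 0), (0, 0, 1)] = 0) (z z' : ℝ) :
    cocycleW C (pullX D.θ fun p => K (p.1, p.2, z)) (pullY D.θ fun p => K (p.1, p.2, z))
        (pullXY D.Υ fun p => K (p.1, p.2, z)) 0 1 1 0 =
      cocycleW C (pullX D.θ fun p => K (p.1, p.2, z')) (pullY D.θ fun p => K (p.1, p.2, z'))
        (pullXY D.Υ fun p => K (p.1, p.2, z')) 0 1 1 0 := by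
  have := FiniteDimensional.complete ℝ EH
  have hslice : ∀ z, ContMDiff 𝓘(ℝ, ℝ × ℝ) 𝓘(ℝ, E) ∞ (fun p : ℝ × ℝ => K (p.1, p.2, z)) :=
    fun z => hK.comp_contDiff (by fun_prop)
  have hax : ContDiff ℝ ∞ (fun s : ℝ × (ℝ × ℝ) => pullX D.θ (fun p => K (p.1, p.2, s.1)) s.2) := by
    simp only [pullX_slice D.θ hK]
    exact (contDiff_pullForm_apply D.θ hK _).comp (f := fun s : ℝ × (ℝ × ℝ) => (s.2.1, s.2.2, s.1))
      (by fun_prop)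
  have hay : ContDiff ℝ ∞ (fun s : ℝ × (ℝ × ℝ) => pullY D.θ (fun p => K (p.1, p.2, s.1)) s.2) := by
    simp only [pullY_slice D.θ hK]
    exact (contDiff_pullForm_apply D.θ hK _).comp (f := fun s : ℝ × (ℝ × ℝ) => (s.2.1, s.2.2, s.1))
      (by fun_prop)
  have hB : ContDiff ℝ ∞ (fun s : ℝ × (ℝ × ℝ) => pullXY D.Υ (fun p => K (p.1, p.2, s.1)) s.2) := by
    simp only [pullXY_slice D.Υ hK]
    exact (contDiff_pullForm_apply D.Υ hK _).comp (f := fun s : ℝ × (ℝ × ℝ) => (s.2.1, s.2.2, s.1))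
      (by fun_prop)
  obtain ⟨u, hu, hus⟩ := exists_isSolF (G := G) hax 1
  obtain ⟨W, hW, hWs⟩ := exists_isSolW C hax hay hB 1 0
  let v : ℝ × ℝ × ℝ → G := fun q => u (q.2.2, (q.1, q.2.1))
  let Z : ℝ × ℝ × ℝ → H := fun q => W (q.2.2, (q.1, q.2.1))
  have hv : ContMDiff 𝓘(ℝ, ℝ × ℝ × ℝ) 𝓘(ℝ, EG) ∞ v := hu.comp_contDiff (by fun_prop)
  have hZ : ContMDiff 𝓘(ℝ, ℝ × ℝ × ℝ) 𝓘(ℝ, EH) ∞ Z := hW.comp_contDiff (by fun_prop)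
  have hk : ContMDiff 𝓘(ℝ, ℝ × ℝ × ℝ) 𝓘(ℝ, EG) ∞ (fun q => (v q)⁻¹) := hv.inv
  have hk1 : ∀ q : ℝ × ℝ × ℝ, q.1 = 1 → (v q)⁻¹ = 1 := fun q hq => by
    rw [inv_eq_one, ← (hus q.2.2).2.1 q.2.1, ← hq]
  have hkr : ∀ q, rlog (fun q => (v q)⁻¹) q (1, 0, 0) =
      lieAd EG (v q)⁻¹ (pullForm D.θ K q ![(1, 0, 0)]) := fun q => by
    have h := (hus q.2.2).rlog_eq (q.1, q.2.1)
    rw [pullX_slice D.θ hK] at h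
    rw [rlog_inv ((hv q).of_le (by simp)), neg_apply, ContinuousLinearMap.comp_apply,
      ← rlog_slice hv q.2.2 (q.1, q.2.1) (1, 0), h, map_neg, neg_neg]
  let w₂ : ℝ × ℝ × ℝ → EH := fun q => rlog Z q (0, 1, 0)
  have hw₂ : ContDiff ℝ ∞ w₂ := contDiff_iff_contDiffAt.2 fun q =>
    (contDiffAt_rlog (hZ q)).clm_apply contDiffAt_const
  have hw₂' : ∀ x y z, w₂ (x, y, z) = rlog (fun p => W (z, p)) (x, y) (0, 1) := fun x y z =>
    (rlog_slice hZ z (x, y) (0, 1)).symm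
  have hd₂ : ∀ q, fderiv ℝ w₂ q (1, 0, 0) =
      - C.mDotL (v q)⁻¹ (pullForm D.Υ K q ![(1, 0, 0), (0, 1, 0)]) := fun q => by
    refine fderiv_apply_fst_eq (hw₂.differentiable (by simp)) ?_
    have h := (hWs q.2.2).hasDerivAt q.1 q.2.1
    rw [cocycleG_eq_one (contDiff_pullY D.θ (hslice q.2.2))
      (pullY_eq_zero D.θ (hslice q.2.2) fun y => hp (1, y, q.2.2) rfl), (hus q.2.2).cocycleF_eq,
      C.mDot_eq, pullXY_slice D.Υ hK, inv_one, one_mul] at h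
    exact h.congr_of_eventuallyEq (Filter.Eventually.of_forall fun s => hw₂' _ _ _)
  have h₂ : ∀ q, q.1 = 1 → w₂ q = 0 := fun q hq => by
    have h := hw₂' q.1 q.2.1 q.2.2
    rw [hq, (hWs q.2.2).rlog_left] at h
    rw [← h, ← hq]
  -- `w₃` is the candidate for `∂_zW W⁻¹` at `x = 0`: it satisfies the same equation as `w₂`, with
  -- `z` in place of `y`, and vanishes at `x = 1`.
  obtain ⟨w, hw, hw1, hwd⟩ := exists_smooth_primitive (P := ℝ × ℝ)
    (g := fun s : (ℝ × ℝ) × ℝ => - C.mDotL (v (s.2, s.1.1, s.1.2))⁻¹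
      (pullForm D.Υ K (s.2, s.1.1, s.1.2) ![(1, 0, 0), (0, 0, 1)]))
    (contDiff_iff_contDiffAt.2 fun s => ((C.contDiffAt_mDotL (hk.comp_contDiff (by fun_prop) s)).clm_apply
      ((contDiff_pullForm_apply D.Υ hK _).comp
        (f := fun s : (ℝ × ℝ) × ℝ => (s.2, s.1.1, s.1.2)) (by fun_prop)).contDiffAt).neg) 1
  let w₃ : ℝ × ℝ × ℝ → EH := fun q => w (q.2, q.1)
  have hw₃ : ContDiff ℝ ∞ w₃ := hw.comp (f := fun q : ℝ × ℝ × ℝ => (q.2, q.1)) (by fun_prop)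
  have hd₃ : ∀ q, fderiv ℝ w₃ q (1, 0, 0) =
      - C.mDotL (v q)⁻¹ (pullForm D.Υ K q ![(1, 0, 0), (0, 0, 1)]) := fun q =>
    fderiv_apply_fst_eq (hw₃.differentiable (by simp)) (hwd q.2 q.1)
  have h₃ : ∀ q, q.1 = 1 → w₃ q = 0 := fun q hq => by
    change w (q.2, q.1) = 0
    rw [hq, hw1]
  have hthin : ∀ {y z : ℝ}, (∀ x, pullForm D.Υ K (x, y, z) ![(1, 0, 0), (0, 0, 1)] = 0) →
      w₃ (0, y, z) = 0 := fun {y z} h => by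
    rw [← hw1 (y, z)]
    exact is_const_of_deriv_eq_zero (fun s => (hwd (y, z) s).differentiableAt)
      (fun s => by rw [(hwd (y, z) s).deriv]; simp [h]) 0 1
  let T : ℝ × ℝ → H := fun p => Z (0, p)
  have hT : ContMDiff 𝓘(ℝ, ℝ × ℝ) 𝓘(ℝ, EH) ∞ T := hZ.comp_contDiff (by fun_prop)
  have hface : ∀ {w : ℝ × ℝ × ℝ → EH} (_ : ContDiff ℝ ∞ w) (p : ℝ × ℝ),
      HasFDerivAt (fun p => w (0, p)) (fderiv ℝ w (0, p) ∘L ContinuousLinearMap.inr ℝ ℝ (ℝ × ℝ)) p :=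
    fun hw p => HasFDerivAt.comp p (f := fun p : ℝ × ℝ => ((0 : ℝ), p))
      (hw.differentiable (by simp) (0, p)).hasFDerivAt (hasFDerivAt_prodMk_right 0 p)
  -- On the face `x = 0`, with coordinates `(y, z)`, the form `(w₂, w₃)` is flat and `T` integrates
  -- `w₂`. At `y = 0` both sides are zero: `T` is `1` there, and the rank condition kills `w₃`.
  have hTr : ∀ q, rlog (EG := EH) T q (0, 1) = w₃ (0, q) := by
    refine rlog_eq_of_flat hT (αx := fun p => w₂ (0, p)) (αy := fun p => w₃ (0, p))
      (fun p => (hface hw₃ p).differentiableAt) (fun q => ?_) (fun q => ?_) (x₀ := 0) (fun z => ?_)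
    · rw [rlog_comp (u := Z) (f := fun p : ℝ × ℝ => ((0 : ℝ), p)) ((hZ _).of_le (by simp))
        (hasFDerivAt_prodMk_right 0 q)]
      rfl
    · rw [(hface hw₃ q).fderiv, (hface hw₂ q).fderiv]
      exact D.fderiv_sub_eq_lieBr_of_curvature hK hcurv hp hp' hk hk1 hkr hw₂ hw₃ hd₂ hd₃ h₂ h₃ rfl
    · rw [hthin fun x => h0 x z, ← rlog_snd (hT _)]
      have h : (fun s => T (0, s)) = fun _ => 1 := funext fun s => (hWs s).2.2.1 0
      rw [h, rlog_const]
      rfl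
  rw [(hWs z).cocycleW_eq, (hWs z').cocycleW_eq]
  -- At `y = 1` the second rank condition gives `w₃ = 0`, so `T (1, ·)`, which is the `2`-transport
  -- of the slices, is constant.
  exact eq_of_rlog_eq_zero (EG := EH) hT (x := 1) (fun z => by rw [hTr, hthin fun x => h1 x z]) z z'

omit [LieGroup 𝓘(ℝ, EG) ∞ G] [LieGroup 𝓘(ℝ, EH) ∞ H] [IsManifold 𝓘(ℝ, E) ∞ M] in
theorem pullForm_two_eq_zero_of_rank_le (η : DiffForm E M V 2) {K : ℝ × ℝ × ℝ → M} {q : ℝ × ℝ × ℝ}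
    (h : (mfderiv 𝓘(ℝ, ℝ × ℝ × ℝ) 𝓘(ℝ, E) K q).toLinearMap.rank ≤ 1) (v w : ℝ × ℝ × ℝ) :
    pullForm η K q ![v, w] = 0 := by
  have h1 : (modelDeriv E K q).toLinearMap.rank ≤ (1 : ℕ) := by
    rw [Nat.cast_one]
    exact h
  exact alternating_eq_zero (η.val (K q))
    (not_linearIndependent_of_rank_le (m := 2) h1 (by norm_num) ![v, w])

variable {p₀ p₁ : M}

/-- Invariance of the `2`-transport under homotopies annihilating the curvature. -/
theorem ConnDoublet.transport₂_eq_of_homotopy [FiniteDimensional ℝ EG] [FiniteDimensional ℝ EH]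
    {S₀ S₁ : AnySurface E p₀ p₁} {K : ℝ × ℝ × ℝ → M} (hK : IsSurfaceHomotopy S₀ S₁ K)
    (hcurv : ∀ q, D.curvature (K q) (modelDeriv E K q (1, 0, 0)) (modelDeriv E K q (0, 1, 0))
      (modelDeriv E K q (0, 0, 1)) = 0) : D.transport₂ S₀.surface = D.transport₂ S₁.surface := by
  obtain ⟨hK, ⟨ε, h0, -, hx0, hx1, -, -, hz0, hz1⟩, hr0, hr1⟩ := hK
  have h := D.cocycleW_slice_eq hK hcurv (p := p₁) (p' := p₀)
    (fun q hq => hx1 q.1 q.2.1 q.2.2 (by linarith)) (fun q hq => hx0 q.1 q.2.1 q.2.2 (by linarith))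
    (fun x z => pullForm_two_eq_zero_of_rank_le D.Υ (hr0 x z) _ _)
    (fun x z => pullForm_two_eq_zero_of_rank_le D.Υ (hr1 x z) _ _) 0 1
  have e0 : (fun p : ℝ × ℝ => K (p.1, p.2, 0)) = S₀.surface.toFun := funext fun p =>
    hz0 p.1 p.2 0 h0
  have e1 : (fun p : ℝ × ℝ => K (p.1, p.2, 1)) = S₁.surface.toFun := funext fun p =>
    hz1 p.1 p.2 1 (by linarith)
  rwa [e0, e1] at h

/-- For a thin homotopy the three partial derivatives are dependent, so the curvature `3`-form
vanishes along it even when the doublet is not flat. -/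
theorem ConnDoublet.functor₂_mk [FiniteDimensional ℝ EG] [FiniteDimensional ℝ EH]
    (S : AnySurface E p₀ p₁) : D.functor₂ (Quot.mk _ S) = D.transport₂ S.surface := by
  rw [functor₂, inducedMap, dif_pos]
  rintro S₀ S₁ ⟨K, hK, hr⟩
  refine D.transport₂_eq_of_homotopy hK fun q => ?_
  have h1 : (modelDeriv E K q).toLinearMap.rank ≤ (2 : ℕ) := by
    rw [Nat.cast_ofNat]
    exact hr q
  exact D.curvature_eq_zero_of_not_linearIndependent (K q) (not_linearIndependent_of_rank_le (m := 3)
    h1 (by norm_num) ![(1, 0, 0), (0, 1, 0), (0, 0, 1)])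

theorem ConnDoublet.flatFunctor₂_mk [FiniteDimensional ℝ EG] [FiniteDimensional ℝ EH] {D : ConnDoublet E M C}
    (hD : D.IsFlat) (S : AnySurface E p₀ p₁) :
    D.flatFunctor₂ (Quot.mk _ S) = D.transport₂ S.surface := by
  rw [flatFunctor₂, inducedMap, dif_pos]
  rintro S₀ S₁ ⟨K, hK⟩
  exact D.transport₂_eq_of_homotopy hK fun q => hD.curvature_eq_zero _ _ _ _

end SurfaceHomotopy
end HigherTransport

theorem mainTheorem12
    {E : Type*} [NormedAddCommGroup E] [NormedSpace ℝ E] [FiniteDimensional ℝ E]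
    {M : Type*} [TopologicalSpace M] [ChartedSpace E M] [IsManifold 𝓘(ℝ, E) ∞ M] [T2Space M]
    {EG : Type*} [NormedAddCommGroup EG] [NormedSpace ℝ EG] [FiniteDimensional ℝ EG]
    {G : Type*} [TopologicalSpace G] [ChartedSpace EG G] [Group G] [LieGroup 𝓘(ℝ, EG) ∞ G]
    [T2Space G]
    {EH : Type*} [NormedAddCommGroup EH] [NormedSpace ℝ EH] [FiniteDimensional ℝ EH]
    {H : Type*} [TopologicalSpace H] [ChartedSpace EH H] [Group H] [LieGroup 𝓘(ℝ, EH) ∞ H]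
    [T2Space H]
    (C : HigherTransport.LieCrossedModule EG G EH H) (D : HigherTransport.ConnDoublet E M C)
    (d : ℕ) (A : Set (EuclideanSpace ℝ (Fin d))) (hA : IsCompact A) :
    -- the parallel transport 2-functor
    (∀ (p₀ p₁ : A → M) (γ₀ γ₁ : ∀ a : A, HigherTransport.Curve E (p₀ a) (p₁ a))
      (S : ∀ a : A, HigherTransport.Surface (γ₀ a) (γ₁ a)),
      HigherTransport.SmoothFamily E A (fun a => (S a).toFun) →
        (HigherTransport.SmoothOnSubset EG A (fun a => D.transport₁ (γ₀ a)) ∧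
          HigherTransport.SmoothOnSubset EG A (fun a => D.transport₁ (γ₁ a)) ∧
          HigherTransport.SmoothOnSubset EH A (fun a => D.transport₂ (S a))) ∧
        (HigherTransport.SmoothOnSubset EG A (fun a => D.functor₁ (Quot.mk _ (γ₀ a))) ∧
          HigherTransport.SmoothOnSubset EG A (fun a => D.functor₁ (Quot.mk _ (γ₁ a))) ∧
          HigherTransport.SmoothOnSubset EH A
            (fun a => D.functor₂ (Quot.mk _ ⟨γ₀ a, γ₁ a, S a⟩))) ∧
        (D.IsFlat → HigherTransport.SmoothOnSubset EH A
            (fun a => D.flatFunctor₂ (Quot.mk _ ⟨γ₀ a, γ₁ a, S a⟩)))) ∧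
    -- the gauge pseudonatural transformation
    (∀ (T : HigherTransport.GaugeTransf E M EG G EH) (p₀ p₁ : A → M)
      (γ : ∀ a : A, HigherTransport.Curve E (p₀ a) (p₁ a)),
      HigherTransport.SmoothFamily E A (fun a => (γ a).toFun) →
        HigherTransport.SmoothOnSubset EH A (fun a => D.gaugeTransport T (γ a)) ∧
        HigherTransport.SmoothOnSubset EH A (fun a => D.gaugeFunctor T (Quot.mk _ (γ a)))) := by
  -- Closedness is what the extension of the coefficients off `A` relies on.
  have hA' := hA.isClosed
  refine ⟨fun p₀ p₁ γ₀ γ₁ S h => ?_, fun T p₀ p₁ γ h => ?_⟩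
  · have h₀ := D.smoothOnSubset_transport₁ hA' h.source
    have h₁ := D.smoothOnSubset_transport₁ hA' h.target
    have h₂ := D.smoothOnSubset_transport₂ hA' h
    -- By invariance the induced maps on classes of representatives are the transports themselves,
    -- so their smoothness is already known.
    simp only [HigherTransport.ConnDoublet.functor₁_mk, HigherTransport.ConnDoublet.functor₂_mk]
    refine ⟨⟨h₀, h₁, h₂⟩, ⟨h₀, h₁, h₂⟩, fun hD => ?_⟩
    simpa only [HigherTransport.ConnDoublet.flatFunctor₂_mk hD] using h₂
  · have h' := D.smoothOnSubset_gaugeTransport hA' T h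
    simp only [HigherTransport.ConnDoublet.gaugeFunctor_mk]
    exact ⟨h', h'⟩
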